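/- Directions are unit vectors of $\mathbb{R}^2$; two directions $d,d'$ are opposite if $d'=-d$. A finite point set $S\subset\mathbb{R}^2$ is in $\mathcal{D}$-general position if, for every $d\in\mathcal{D}$, no two points of $S$ lie on a line orthogonal to $d$. A geometric path is $d$-monotone if the orthogonal projections of its vertices on a line directed as $d$ are pairwise distinct and appear, along the path, in the order of the line or in the reverse order. A spanning tree of $S$ (drawn with straight-line edges) is $\mathcal{D}$-monotone if for every two distinct vertices $u,v$ the path of the tree between $u$ and $v$ is $d$-monotone for some $d\in\mathcal{D}$. It is a minimum $\mathcal{D}$-monotone spanning tree if the sum of the Euclidean lengths of its edges is minimum among all $\mathcal{D}$-monotone spanning trees of $S$. $\mathrm{MMST}(S,\mathcal{D})$ is the problem of computing such a tree. **Theorem.** There are a function $f\colon\mathbb{N}\to\mathbb{N}$ and an algorithm on the real RAM (unit-cost exact real arithmetic $+,-,\cdot,/,\sqrt{\ }$ and comparisons; natural-number counters and addresses with unit-cost addition, subtraction and comparison; indirect addressing) such that the following holds. Given any $k\ge 1$ distinct, pairwise non-opposite directions forming a set $\mathcal{D}$, and any $n\ge 1$ distinct points forming a set $S$ in $\mathcal{D}$-general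 position, the algorithm halts and outputs a minimum $\mathcal{D}$-monotone spanning tree of $S$; for $n\ge 2$ it makes at most $f(k)\cdot n^{2k-1}\log n$ steps. In particular, the problem $\mathrm{MMST}(S,\mathcal{D})$ for such inputs is in XP when parameterized by $k$: there are computable functions $g,h\colon\mathbb{N}\to\mathbb{N}$ and a real RAM algorithm that solves every instance with $k$ directions and $N$ input numbers in at most $g(k)\cdot N^{h(k)}$ steps. -/

import Mathlib

/-! ## The real RAM

A random-access machine with two kinds of memory: cells holding natural numbers (used for counters
and addresses) and cells holding exact real numbers. Each kind is organised in banks; a program is a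
finite text, so it names only finitely many banks, and inside a bank the cells are addressed
indirectly by computed natural numbers. Natural numbers may be added, subtracted (truncated at `0`)
and compared. Real numbers may be added, subtracted, multiplied, divided, compared, and square roots
may be taken; there is no rounding, no conversion from reals to naturals, and the only numerals are
natural numbers. Every memory access, arithmetic operation, comparison, constant, assignment and
branching costs one step. -/

namespace RealRAM

/-- A memory configuration: `nats b i` and `reals b i` are the contents of cell `i` of bank `b`. -/
structure State where
  nats : ℕ → ℕ → ℕ
  reals : ℕ → ℕ → ℝ

/-- Natural number expressions; `read b i` is the content of cell `i` of bank `b`. -/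
inductive NatExpr where
  | const (c : ℕ)
  | read (b : ℕ) (i : NatExpr)
  | plus (e₁ e₂ : NatExpr)
  | minus (e₁ e₂ : NatExpr)

/-- Value of a natural number expression. -/
def NatExpr.eval (σ : State) : NatExpr → ℕ
  | .const c => c
  | .read b i => σ.nats b (i.eval σ)
  | .plus e₁ e₂ => e₁.eval σ + e₂.eval σ
  | .minus e₁ e₂ => e₁.eval σ - e₂.eval σ

/-- Number of operations in the evaluation of a natural number expression. -/
def NatExpr.cost : NatExpr → ℕ
  | .const _ => 1
  | .read _ i => i.cost + 1
  | .plus e₁ e₂ => e₁.cost + e₂.cost + 1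
  | .minus e₁ e₂ => e₁.cost + e₂.cost + 1

/-- Real number expressions. -/
inductive RealExpr where
  | const (c : ℕ)
  | read (b : ℕ) (i : NatExpr)
  | plus (e₁ e₂ : RealExpr)
  | minus (e₁ e₂ : RealExpr)
  | times (e₁ e₂ : RealExpr)
  | divide (e₁ e₂ : RealExpr)
  | sqrt (e : RealExpr)

/-- Value of a real number expression. -/
noncomputable def RealExpr.eval (σ : State) : RealExpr → ℝ
  | .const c => (c : ℝ)
  | .read b i => σ.reals b (i.eval σ)
  | .plus e₁ e₂ => e₁.eval σ + e₂.eval σ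
  | .minus e₁ e₂ => e₁.eval σ - e₂.eval σ
  | .times e₁ e₂ => e₁.eval σ * e₂.eval σ
  | .divide e₁ e₂ => e₁.eval σ / e₂.eval σ
  | .sqrt e => Real.sqrt (e.eval σ)

/-- Number of operations in the evaluation of a real number expression. -/
def RealExpr.cost : RealExpr → ℕ
  | .const _ => 1
  | .read _ i => i.cost + 1
  | .plus e₁ e₂ => e₁.cost + e₂.cost + 1
  | .minus e₁ e₂ => e₁.cost + e₂.cost + 1
  | .times e₁ e₂ => e₁.cost + e₂.cost + 1
  | .divide e₁ e₂ => e₁.cost + e₂.cost + 1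
  | .sqrt e => e.cost + 1

/-- Tests: comparisons of numbers and their Boolean combinations. -/
inductive Test where
  | natEq (e₁ e₂ : NatExpr)
  | natLt (e₁ e₂ : NatExpr)
  | realEq (e₁ e₂ : RealExpr)
  | realLt (e₁ e₂ : RealExpr)
  | neg (b : Test)
  | both (b₁ b₂ : Test)

/-- Truth of a test. -/
def Test.Holds (σ : State) : Test → Prop
  | .natEq e₁ e₂ => e₁.eval σ = e₂.eval σ
  | .natLt e₁ e₂ => e₁.eval σ < e₂.eval σ
  | .realEq e₁ e₂ => e₁.eval σ = e₂.eval σ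
  | .realLt e₁ e₂ => e₁.eval σ < e₂.eval σ
  | .neg b => ¬ b.Holds σ
  | .both b₁ b₂ => b₁.Holds σ ∧ b₂.Holds σ

/-- Number of operations in the evaluation of a test. -/
def Test.cost : Test → ℕ
  | .natEq e₁ e₂ => e₁.cost + e₂.cost + 1
  | .natLt e₁ e₂ => e₁.cost + e₂.cost + 1
  | .realEq e₁ e₂ => e₁.cost + e₂.cost + 1
  | .realLt e₁ e₂ => e₁.cost + e₂.cost + 1
  | .neg b => b.cost + 1
  | .both b₁ b₂ => b₁.cost + b₂.cost + 1

/-- Programs. `setNat b i e` and `setReal b i e` store the value of `e` in cell `i` of bank `b`. -/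
inductive Program where
  | skip
  | setNat (b : ℕ) (i e : NatExpr)
  | setReal (b : ℕ) (i : NatExpr) (e : RealExpr)
  | seq (c₁ c₂ : Program)
  | branch (b : Test) (c₁ c₂ : Program)
  | loop (b : Test) (c : Program)

/-- The memory after storing `v` in cell `i` of bank `b` of natural numbers. -/
def State.storeNat (σ : State) (b i v : ℕ) : State :=
  { σ with nats := Function.update σ.nats b (Function.update (σ.nats b) i v) }

/-- The memory after storing `v` in cell `i` of bank `b` of real numbers. -/
noncomputable def State.storeReal (σ : State) (b i : ℕ) (v : ℝ) : State :=
  { σ with reals := Function.update σ.reals b (Function.update (σ.reals b) i v) }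

/-- `Exec c σ t σ'`: started in memory `σ`, the program `c` halts after exactly `t` steps with
memory `σ'`. -/
inductive Exec : Program → State → ℕ → State → Prop
  | skip (σ : State) : Exec .skip σ 1 σ
  | setNat (σ : State) (b : ℕ) (i e : NatExpr) :
      Exec (.setNat b i e) σ (i.cost + e.cost + 1) (σ.storeNat b (i.eval σ) (e.eval σ))
  | setReal (σ : State) (b : ℕ) (i : NatExpr) (e : RealExpr) :
      Exec (.setReal b i e) σ (i.cost + e.cost + 1) (σ.storeReal b (i.eval σ) (e.eval σ))
  | seq {c₁ c₂ : Program} {σ σ₁ σ₂ : State} {t₁ t₂ : ℕ} :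
      Exec c₁ σ t₁ σ₁ → Exec c₂ σ₁ t₂ σ₂ → Exec (.seq c₁ c₂) σ (t₁ + t₂) σ₂
  | branchTrue {b : Test} {c₁ c₂ : Program} {σ σ₁ : State} {t : ℕ} :
      b.Holds σ → Exec c₁ σ t σ₁ → Exec (.branch b c₁ c₂) σ (b.cost + 1 + t) σ₁
  | branchFalse {b : Test} {c₁ c₂ : Program} {σ σ₁ : State} {t : ℕ} :
      ¬ b.Holds σ → Exec c₂ σ t σ₁ → Exec (.branch b c₁ c₂) σ (b.cost + 1 + t) σ₁
  | loopFalse {b : Test} {c : Program} {σ : State} :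
      ¬ b.Holds σ → Exec (.loop b c) σ (b.cost + 1) σ
  | loopTrue {b : Test} {c : Program} {σ σ₁ σ₂ : State} {t₁ t₂ : ℕ} :
      b.Holds σ → Exec c σ t₁ σ₁ → Exec (.loop b c) σ₁ t₂ σ₂ →
        Exec (.loop b c) σ (b.cost + 1 + t₁ + t₂) σ₂

/-- A program has at most one run from a given memory, so the step count and the final memory are
well defined. -/
theorem Exec.deterministic {c : Program} {σ σ₁ σ₂ : State} {t₁ t₂ : ℕ}
    (h₁ : Exec c σ t₁ σ₁) (h₂ : Exec c σ t₂ σ₂) : t₁ = t₂ ∧ σ₁ = σ₂ := by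
  induction h₁ generalizing t₂ σ₂ with
  | skip => cases h₂; exact ⟨rfl, rfl⟩
  | setNat => cases h₂; exact ⟨rfl, rfl⟩
  | setReal => cases h₂; exact ⟨rfl, rfl⟩
  | seq _ _ ih₁ ih₂ =>
    cases h₂ with
    | seq a b =>
      obtain ⟨rfl, rfl⟩ := ih₁ a
      obtain ⟨rfl, rfl⟩ := ih₂ b
      exact ⟨rfl, rfl⟩
  | branchTrue hb _ ih =>
    cases h₂ with
    | branchTrue _ a => obtain ⟨rfl, rfl⟩ := ih a; exact ⟨rfl, rfl⟩
    | branchFalse hn _ => exact absurd hb hn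
  | branchFalse hb _ ih =>
    cases h₂ with
    | branchTrue hn _ => exact absurd hn hb
    | branchFalse _ a => obtain ⟨rfl, rfl⟩ := ih a; exact ⟨rfl, rfl⟩
  | loopFalse hb =>
    cases h₂ with
    | loopFalse => exact ⟨rfl, rfl⟩
    | loopTrue hn _ _ => exact absurd hn hb
  | loopTrue hb _ _ ih₁ ih₂ =>
    cases h₂ with
    | loopFalse hn => exact absurd hb hn
    | loopTrue _ a b =>
      obtain ⟨rfl, rfl⟩ := ih₁ a
      obtain ⟨rfl, rfl⟩ := ih₂ b
      exact ⟨rfl, rfl⟩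

/-- A parameterized computational problem on the real RAM: its instances, the initial memory that
encodes an instance, the size and the parameter of an instance, and the final memories that encode
a correct answer. -/
structure ParamProblem where
  Inst : Type
  input : Inst → State
  size : Inst → ℕ
  param : Inst → ℕ
  IsAnswer : Inst → State → Prop

/-- The class XP (slicewise polynomial): one program solves all instances, in at most
`f(param) * size ^ g(param)` steps for computable functions `f` and `g`. -/
def InXP (P : ParamProblem) : Prop :=
  ∃ (c : Program) (f g : ℕ → ℕ), Computable f ∧ Computable g ∧
    ∀ I : P.Inst, ∃ (t : ℕ) (σ : State), Exec c (P.input I) t σ ∧ P.IsAnswer I σ ∧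
      t ≤ f (P.param I) * P.size I ^ g (P.param I)

end RealRAM

/-! ## Minimum monotone spanning trees -/

namespace MMST

/-- The Euclidean plane. -/
abbrev Plane := EuclideanSpace ℝ (Fin 2)

/-- `S` is in `d`-general position: no two points of `S` lie on a line orthogonal to `d`. -/
def InGeneralPosition (d : Plane) (S : Set Plane) : Prop :=
  ∀ x ∈ S, ∀ y ∈ S, x ≠ y → inner ℝ d x ≠ inner ℝ d y

/-- A geometric path, given by its list of vertices, is `d`-monotone: the orthogonal projections of
its vertices on a line directed as `d` are pairwise distinct and, along the path, appear either in
the order of the line or in the opposite order. -/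
def IsMonotonePath (d : Plane) (l : List Plane) : Prop :=
  l.Pairwise (fun x y => inner ℝ d x < inner ℝ d y) ∨
    l.Pairwise (fun x y => inner ℝ d y < inner ℝ d x)

variable {V : Type*}

/-- `T` is a `D`-monotone spanning tree of the point set `{p v | v : V}`, where the vertex `v` is
drawn at the point `p v`. -/
def IsMonotoneSpanningTree (D : Set Plane) (p : V → Plane) (T : SimpleGraph V) : Prop :=
  T.IsTree ∧ ∀ (u v : V) (w : T.Walk u v), u ≠ v → w.IsPath →
    ∃ d ∈ D, IsMonotonePath d (w.support.map p)

open Classical in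
/-- The length of a straight-line drawing: the sum of the Euclidean lengths of its edges. -/
noncomputable def length [Fintype V] (p : V → Plane) (T : SimpleGraph V) : ℝ :=
  ∑ e ∈ T.edgeFinset, Sym2.lift ⟨fun u v => dist (p u) (p v), fun _ _ => dist_comm _ _⟩ e

/-- `T` is a minimum `D`-monotone spanning tree. -/
def IsMinimumMonotoneSpanningTree [Fintype V] (D : Set Plane) (p : V → Plane)
    (T : SimpleGraph V) : Prop :=
  IsMonotoneSpanningTree D p T ∧
    ∀ T' : SimpleGraph V, IsMonotoneSpanningTree D p T' → length p T ≤ length p T'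

/-- An instance: `n ≥ 1` distinct points and `k ≥ 1` distinct pairwise non-opposite directions (unit
vectors), listed in any order, such that the point set is in general position for each of the
directions. -/
structure Instance where
  n : ℕ
  k : ℕ
  n_pos : 0 < n
  k_pos : 0 < k
  pt : Fin n → Plane
  dir : Fin k → Plane
  pt_injective : Function.Injective pt
  dir_injective : Function.Injective dir
  dir_norm : ∀ i, ‖dir i‖ = 1
  dir_not_opposite : ∀ i j, dir i ≠ - dir j
  general_position : ∀ i, InGeneralPosition (dir i) (Set.range pt)

/-- The set of directions of an instance. -/
def Instance.directions (I : Instance) : Set Plane := Set.range I.dir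

/-- The initial memory: cells `0` and `1` of the natural number bank `0` hold `n` and `k`; the real
banks `0` and `1` hold the two coordinates of the points, the real banks `2` and `3` those of the
directions; all other cells hold zero. -/
noncomputable def Instance.input (I : Instance) : RealRAM.State where
  nats
    | 0, 0 => I.n
    | 0, 1 => I.k
    | _, _ => 0
  reals
    | 0, i => if h : i < I.n then I.pt ⟨i, h⟩ 0 else 0
    | 1, i => if h : i < I.n then I.pt ⟨i, h⟩ 1 else 0
    | 2, i => if h : i < I.k then I.dir ⟨i, h⟩ 0 else 0
    | 3, i => if h : i < I.k then I.dir ⟨i, h⟩ 1 else 0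
    | _, _ => 0

/-- The graph on `n` points that a final memory encodes as a list of `n - 1` edges: the `i`-th edge
joins the points whose indices are in cell `i` of the natural number banks `1` and `2`. -/
def outputGraph (n : ℕ) (σ : RealRAM.State) : SimpleGraph (Fin n) :=
  SimpleGraph.fromRel fun u v => ∃ i < n - 1, σ.nats 1 i = u ∧ σ.nats 2 i = v

/-- The final memory encodes a minimum monotone spanning tree of the instance. -/
def Instance.IsSolution (I : Instance) (σ : RealRAM.State) : Prop :=
  IsMinimumMonotoneSpanningTree I.directions I.pt (outputGraph I.n σ)

/-- The problem of computing a minimum monotone spanning tree, parameterized by the number of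
directions; the size of an instance is its number of input numbers. -/
noncomputable def problem : RealRAM.ParamProblem where
  Inst := Instance
  input := Instance.input
  size I := 2 * I.n + 2 * I.k + 2
  param := Instance.k
  IsAnswer := Instance.IsSolution

end MMST

/-!
The algorithm is an exhaustive search over descriptions of trees whose number is `n ^ (2 * k - 2)`
times a function of `k`; each description is treated in time `O(n * log n)`, for fixed `k`.

A monotone tree has few leaves and few branching vertices. The edges at two distinct leaves,
directed away from the leaves, lie in different sectors of the plane cut out by the lines orthogonal
to the directions, since otherwise the path between the two leaves would not be monotone. There are
at most `2 * k` sectors (`card_sectors_le`), hence at most `2 * k` leaves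
(`Instance.card_leaves_le`) and at most `2 * k - 2` vertices of degree at least three
(`Instance.card_branching_le`). These vertices and the root, which is the first point, are called
special; they number at most `2 * k - 1`, and all but the root are guessed.

Removing the special vertices leaves paths; these and the single special vertices are the chains.
The path between two points on different chains contains a special point and is monotone, so in one
of the signed directions one of the two points lies ahead of this special point and the other does
not (`Instance.exists_walk_of_sig_eq`). Therefore the chain of a point is determined by its
signature, which tells for each special point and each signed direction whether the point lies ahead
of the special point. The number of signatures depends only on `k`, and so does the number of ways
to assign a chain to each signature, to choose the chain at whose end each chain is attached, and to
choose for each pair of chains a direction in which the path between their ends is monotone. These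
data determine the tree, because every chain is sorted in the direction chosen for the path from the
root to its end (`Special.exists_colouring`, `Instance.exists_guess`).

Conversely, an arbitrary guess of such data yields a tree glued from sorted chains. The tree is
accepted if, for each pair of chains, every edge of the path between their ends runs the right way
in the chosen direction; the colours of points, that is, the numbers of their chains, decide whether
an edge lies on such a path. Acceptance implies that the tree is monotone, because every path of the
tree is part of a path between the ends of two chains, where the root is a chain too
(`IsLayout.monotone`). Building the tree needs a merge sort for each chain (`run_sort`); the rest
takes linear time. The guesses are enumerated by an odometer (`run_odometer`), and a shortest
accepted tree is kept (`run_main`).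

The programs are verified by a calculus of total correctness with time bounds (`RealRAM.Run`), whose
frame rule (`RealRAM.Exec.agree`) says that only the banks named in assignments change.
-/

/-! ### Reasoning about real RAM programs -/

namespace RealRAM

/-- The banks of natural numbers that a program may write to. -/
def Program.natWrites : Program → List ℕ
  | .skip => []
  | .setNat b _ _ => [b]
  | .setReal _ _ _ => []
  | .seq c₁ c₂ => c₁.natWrites ++ c₂.natWrites
  | .branch _ c₁ c₂ => c₁.natWrites ++ c₂.natWrites
  | .loop _ c => c.natWrites

/-- The banks of real numbers that a program may write to. -/
def Program.realWrites : Program → List ℕ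
  | .skip => []
  | .setNat _ _ _ => []
  | .setReal b _ _ => [b]
  | .seq c₁ c₂ => c₁.realWrites ++ c₂.realWrites
  | .branch _ c₁ c₂ => c₁.realWrites ++ c₂.realWrites
  | .loop _ c => c.realWrites

/-- The memory `σ'` differs from `σ` at most in the natural number banks `wn` and the real banks
`wr`. -/
def Agree (wn wr : List ℕ) (σ σ' : State) : Prop :=
  (∀ b, b ∉ wn → σ'.nats b = σ.nats b) ∧ (∀ b, b ∉ wr → σ'.reals b = σ.reals b)

theorem Agree.refl (wn wr : List ℕ) (σ : State) : Agree wn wr σ σ :=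
  ⟨fun _ _ => rfl, fun _ _ => rfl⟩

theorem Agree.trans {wn wr : List ℕ} {σ₁ σ₂ σ₃ : State} (h₁ : Agree wn wr σ₁ σ₂)
    (h₂ : Agree wn wr σ₂ σ₃) : Agree wn wr σ₁ σ₃ :=
  ⟨fun b hb => (h₂.1 b hb).trans (h₁.1 b hb), fun b hb => (h₂.2 b hb).trans (h₁.2 b hb)⟩

theorem Agree.mono {wn wr wn' wr' : List ℕ} {σ σ' : State} (h : Agree wn wr σ σ')
    (hn : wn ⊆ wn') (hr : wr ⊆ wr') : Agree wn' wr' σ σ' :=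
  ⟨fun b hb => h.1 b fun hb' => hb (hn hb'), fun b hb => h.2 b fun hb' => hb (hr hb')⟩

@[simp] theorem storeNat_nats (σ : State) (b i v b' : ℕ) :
    (σ.storeNat b i v).nats b' =
      if b' = b then Function.update (σ.nats b) i v else σ.nats b' := by
  simp only [State.storeNat, Function.update_apply]

@[simp] theorem storeNat_reals (σ : State) (b i v : ℕ) :
    (σ.storeNat b i v).reals = σ.reals := rfl

@[simp] theorem storeReal_nats (σ : State) (b i : ℕ) (v : ℝ) :
    (σ.storeReal b i v).nats = σ.nats := rfl

@[simp] theorem storeReal_reals (σ : State) (b i : ℕ) (v : ℝ) (b' : ℕ) :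
    (σ.storeReal b i v).reals b' =
      if b' = b then Function.update (σ.reals b) i v else σ.reals b' := by
  simp only [State.storeReal, Function.update_apply]

theorem agree_storeNat (σ : State) (b i v : ℕ) (wn wr : List ℕ) (hb : b ∈ wn) :
    Agree wn wr σ (σ.storeNat b i v) := by
  refine ⟨fun b' hb' => ?_, fun _ _ => rfl⟩
  rw [storeNat_nats, if_neg]
  rintro rfl
  exact hb' hb

/-- The frame rule: a run changes only the banks that occur as targets of assignments. -/
theorem Exec.agree {c : Program} {σ σ' : State} {t : ℕ} (h : Exec c σ t σ') :
    Agree c.natWrites c.realWrites σ σ' := by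
  induction h with
  | skip => exact Agree.refl _ _ _
  | setNat σ b i e => exact agree_storeNat _ _ _ _ _ _ (by simp [Program.natWrites])
  | setReal σ b i e =>
    refine ⟨fun _ _ => rfl, fun b' hb' => ?_⟩
    rw [storeReal_reals, if_neg]
    rintro rfl
    exact hb' (by simp [Program.realWrites])
  | seq _ _ h₁ h₂ =>
    exact (h₁.mono (by simp [Program.natWrites]) (by simp [Program.realWrites])).trans
      (h₂.mono (by simp [Program.natWrites]) (by simp [Program.realWrites]))
  | branchTrue _ _ h => exact h.mono (by simp [Program.natWrites]) (by simp [Program.realWrites])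
  | branchFalse _ _ h => exact h.mono (by simp [Program.natWrites]) (by simp [Program.realWrites])
  | loopFalse => exact Agree.refl _ _ _
  | loopTrue _ _ _ h₁ h₂ => exact Agree.trans h₁ h₂

/-- Total correctness with a time bound: from `σ` the program halts after at most `T` steps in a
memory that satisfies `Q`. -/
def Run (c : Program) (σ : State) (T : ℕ) (Q : State → Prop) : Prop :=
  ∃ (t : ℕ) (σ' : State), Exec c σ t σ' ∧ t ≤ T ∧ Q σ'

theorem Run.mono {c : Program} {σ : State} {T T' : ℕ} {Q Q' : State → Prop} (h : Run c σ T Q)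
    (hT : T ≤ T') (hQ : ∀ σ', Q σ' → Q' σ') : Run c σ T' Q' := by
  obtain ⟨t, σ', h₁, h₂, h₃⟩ := h
  exact ⟨t, σ', h₁, h₂.trans hT, hQ _ h₃⟩

theorem Run.agree {c : Program} {σ : State} {T : ℕ} {Q : State → Prop} (h : Run c σ T Q) :
    Run c σ T (fun σ' => Agree c.natWrites c.realWrites σ σ' ∧ Q σ') := by
  obtain ⟨t, σ', h₁, h₂, h₃⟩ := h
  exact ⟨t, σ', h₁, h₂, h₁.agree, h₃⟩

theorem Run.seq {c₁ c₂ : Program} {σ : State} {T₁ T₂ : ℕ} {Q : State → Prop}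
    (h : Run c₁ σ T₁ (fun σ' => Run c₂ σ' T₂ Q)) : Run (.seq c₁ c₂) σ (T₁ + T₂) Q := by
  obtain ⟨t₁, σ₁, h₁, h₂, t₂, σ₂, h₃, h₄, h₅⟩ := h
  exact ⟨_, _, h₁.seq h₃, Nat.add_le_add h₂ h₄, h₅⟩

/-- Sequencing of two runs, where the second may use that the first has changed only the banks that
it writes to. -/
theorem Run.seqAgree {c₁ c₂ : Program} {σ : State} {T₁ T₂ : ℕ} {Q Q' : State → Prop}
    (h : Run c₁ σ T₁ Q')
    (h' : ∀ σ', Agree c₁.natWrites c₁.realWrites σ σ' → Q' σ' → Run c₂ σ' T₂ Q) :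
    Run (.seq c₁ c₂) σ (T₁ + T₂) Q :=
  Run.seq (h.agree.mono le_rfl fun σ' hσ' => h' σ' hσ'.1 hσ'.2)

/-- Whether a program contains no loop. -/
def Program.loopFree : Program → Bool
  | .seq c₁ c₂ => c₁.loopFree && c₂.loopFree
  | .branch _ c₁ c₂ => c₁.loopFree && c₂.loopFree
  | .loop _ _ => false
  | _ => true

/-- An upper bound for the number of steps of a loop-free program. -/
def Program.cost : Program → ℕ
  | .skip => 1
  | .setNat _ i e => i.cost + e.cost + 1
  | .setReal _ i e => i.cost + e.cost + 1
  | .seq c₁ c₂ => c₁.cost + c₂.cost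
  | .branch b c₁ c₂ => b.cost + 1 + (c₁.cost + c₂.cost)
  | .loop _ _ => 0

open Classical in
/-- The memory after a run of a loop-free program. -/
noncomputable def Program.step : Program → State → State
  | .skip, σ => σ
  | .setNat b i e, σ => σ.storeNat b (i.eval σ) (e.eval σ)
  | .setReal b i e, σ => σ.storeReal b (i.eval σ) (e.eval σ)
  | .seq c₁ c₂, σ => c₂.step (c₁.step σ)
  | .branch b c₁ c₂, σ => if b.Holds σ then c₁.step σ else c₂.step σ
  | .loop _ _, σ => σ

theorem exec_step (c : Program) (hc : c.loopFree = true) (σ : State) :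
    ∃ t ≤ c.cost, Exec c σ t (c.step σ) := by
  induction c generalizing σ with
  | skip => exact ⟨_, le_rfl, .skip σ⟩
  | setNat b i e => exact ⟨_, le_rfl, .setNat σ b i e⟩
  | setReal b i e => exact ⟨_, le_rfl, .setReal σ b i e⟩
  | seq c₁ c₂ h₁ h₂ =>
    simp only [Program.loopFree, Bool.and_eq_true] at hc
    obtain ⟨t₁, ht₁, e₁⟩ := h₁ hc.1 σ
    obtain ⟨t₂, ht₂, e₂⟩ := h₂ hc.2 (c₁.step σ)
    exact ⟨_, Nat.add_le_add ht₁ ht₂, e₁.seq e₂⟩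
  | branch b c₁ c₂ h₁ h₂ =>
    simp only [Program.loopFree, Bool.and_eq_true] at hc
    by_cases hb : b.Holds σ
    · obtain ⟨t₁, ht₁, e₁⟩ := h₁ hc.1 σ
      refine ⟨_, ?_, by simpa [Program.step, hb] using Exec.branchTrue (c₂ := c₂) hb e₁⟩
      simp only [Program.cost]; omega
    · obtain ⟨t₁, ht₁, e₁⟩ := h₂ hc.2 σ
      refine ⟨_, ?_, by simpa [Program.step, hb] using Exec.branchFalse (c₁ := c₁) hb e₁⟩
      simp only [Program.cost]; omega
  | loop b c => simp [Program.loopFree] at hc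

theorem run_of_loopFree {c : Program} {σ : State} {Q : State → Prop} (hc : c.loopFree = true)
    (h : Q (c.step σ)) : Run c σ c.cost Q := by
  obtain ⟨t, ht, e⟩ := exec_step c hc σ
  exact ⟨t, _, e, ht, h⟩

/-- A loop that makes at most `N` rounds of at most `B` steps each. The invariant is indexed by the
number of completed rounds. -/
theorem Run.loop {b : Test} {c : Program} {B N : ℕ} {Inv : ℕ → State → Prop} {σ₀ : State}
    (h₀ : Inv 0 σ₀)
    (hstep : ∀ i σ, Agree c.natWrites c.realWrites σ₀ σ → Inv i σ → b.Holds σ →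
      i < N ∧ Run c σ B (Inv (i + 1))) :
    Run (.loop b c) σ₀ (N * (B + b.cost + 1) + b.cost + 1)
      (fun σ' => ∃ i, Inv i σ' ∧ ¬ b.Holds σ') := by
  have key : ∀ m i σ, N - i = m → Agree c.natWrites c.realWrites σ₀ σ → Inv i σ →
      Run (.loop b c) σ (m * (B + b.cost + 1) + b.cost + 1)
        (fun σ' => ∃ i, Inv i σ' ∧ ¬ b.Holds σ') := by
    intro m
    induction m with
    | zero =>
      intro i σ hm hag hi
      by_cases hb : b.Holds σ
      · exact absurd (hstep i σ hag hi hb).1 (by omega)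
      · exact ⟨_, _, .loopFalse hb, by omega, i, hi, hb⟩
    | succ m ih =>
      intro i σ hm hag hi
      by_cases hb : b.Holds σ
      · obtain ⟨t, σ', e, ht, hi'⟩ := (hstep i σ hag hi hb).2
        obtain ⟨t', σ'', e', ht', hQ⟩ := ih (i + 1) σ' (by omega) (hag.trans e.agree) hi'
        refine ⟨_, _, .loopTrue hb e e', ?_, hQ⟩
        rw [Nat.succ_mul]; omega
      · exact ⟨_, _, .loopFalse hb, by omega, i, hi, hb⟩
  refine (key (N - 0) 0 σ₀ rfl (Agree.refl _ _ _) h₀).mono ?_ fun _ h => h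
  simp

/-- The scalar variable kept in cell `0` of bank `b`. -/
abbrev rd (b : ℕ) : NatExpr := .read b (.const 0)

/-- Assignment to the scalar variable kept in cell `0` of bank `b`. -/
abbrev put (b : ℕ) (e : NatExpr) : Program := .setNat b (.const 0) e

/-- `for b := 0, …, N - 1 do c`, the counter being cell `0` of bank `b`. -/
def forLoop (b : ℕ) (N : NatExpr) (c : Program) : Program :=
  .seq (put b (.const 0))
    (.loop (.natLt (rd b) N) (.seq c (put b (.plus (rd b) (.const 1)))))

/-- A bound for the number of steps of a `for` loop of `N` rounds of at most `B` steps, when the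
evaluation of the upper limit costs `e`. -/
def forTime (N B e : ℕ) : ℕ := 3 + (N * (B + 6 + (e + 3) + 1) + (e + 3) + 1)

theorem Run.forLoop {ctr : ℕ} {E : NatExpr} {c : Program} {σ₀ : State} {B N : ℕ}
    {Inv : ℕ → State → Prop} {Q : State → Prop}
    (hctr : ctr ∉ c.natWrites)
    (hE : ∀ σ, Agree (ctr :: c.natWrites) c.realWrites σ₀ σ → E.eval σ = N)
    (hInv : ∀ i σ v, Inv i σ → Inv i (σ.storeNat ctr 0 v))
    (h₀ : Inv 0 σ₀)
    (hstep : ∀ i σ, i < N → Agree (ctr :: c.natWrites) c.realWrites σ₀ σ → σ.nats ctr 0 = i →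
      Inv i σ → Run c σ B (Inv (i + 1)))
    (hQ : ∀ σ, Agree (ctr :: c.natWrites) c.realWrites σ₀ σ → Inv N σ → Q σ) :
    Run (forLoop ctr E c) σ₀ (forTime N B E.cost) Q := by
  have hag₀ : Agree (ctr :: c.natWrites) c.realWrites σ₀ (σ₀.storeNat ctr 0 0) :=
    agree_storeNat _ _ _ _ _ _ (by simp)
  have hsub : (Program.seq c (put ctr (.plus (rd ctr) (.const 1)))).natWrites ⊆
      ctr :: c.natWrites := by
    intro x
    simp only [Program.natWrites, List.mem_append, List.mem_cons, List.not_mem_nil, or_false]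
    tauto
  have hsub' : (Program.seq c (put ctr (.plus (rd ctr) (.const 1)))).realWrites ⊆
      c.realWrites := by
    intro x
    simp [Program.realWrites]
  have hmain := Run.loop (b := .natLt (rd ctr) E)
    (c := .seq c (put ctr (.plus (rd ctr) (.const 1)))) (B := B + 6) (N := N)
    (σ₀ := σ₀.storeNat ctr 0 0)
    (Inv := fun i σ => i ≤ N ∧ σ.nats ctr 0 = i ∧ Inv i σ) ⟨Nat.zero_le _, by simp, hInv _ _ _ h₀⟩
    (by
      rintro i σ hag ⟨_, hi, hI⟩ hb
      have hag' := hag₀.trans (hag.mono hsub hsub')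
      have hlt : i < N := by
        simpa [Test.Holds, NatExpr.eval, hi, hE σ hag'] using hb
      refine ⟨hlt, Run.seq ?_⟩
      refine (hstep i σ hlt hag' hi hI).agree.mono le_rfl ?_
      rintro σ' ⟨hag'', hI'⟩
      refine (run_of_loopFree (c := put ctr (.plus (rd ctr) (.const 1))) rfl ?_).mono
        (le_of_eq rfl) fun _ h => h
      have h1 : σ'.nats ctr 0 = i := by rw [hag''.1 ctr hctr, hi]
      exact ⟨hlt, by simp [Program.step, NatExpr.eval, h1], hInv _ _ _ hI'⟩)
  obtain ⟨t, σ', e, ht, i, ⟨hi, hi', hI⟩, hb⟩ := hmain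
  have hag := hag₀.trans (e.agree.mono hsub hsub')
  have : i = N := by
    have : ¬ i < N := by simpa [Test.Holds, NatExpr.eval, hi', hE σ' hag] using hb
    omega
  subst this
  refine ⟨_, σ', .seq (.setNat _ _ _ _) e, ?_, hQ _ hag hI⟩
  have hc : 1 + 1 + E.cost + 1 = E.cost + 3 := by omega
  simp only [NatExpr.cost, Test.cost, forTime, hc] at ht ⊢
  omega

end RealRAM

/-! ### Rooted trees given by parent functions -/

namespace MMST

section Ancestors

variable {V : Type*} {f : V → V} {x y v : V}

/-- `x` is reached from `v` by iterating `f`; when `f` maps a vertex of a rooted tree to its parent,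
`x` is an ancestor of `v` or `v` itself. -/
def Anc (f : V → V) (x v : V) : Prop := ∃ i : ℕ, f^[i] v = x

theorem Anc.refl (f : V → V) (x : V) : Anc f x x := ⟨0, rfl⟩

theorem Anc.of_apply (h : Anc f x (f v)) : Anc f x v := by
  obtain ⟨i, hi⟩ := h
  exact ⟨i + 1, by simpa [Function.iterate_succ_apply] using hi⟩

theorem anc_iff : Anc f x v ↔ v = x ∨ Anc f x (f v) := by
  constructor
  · rintro ⟨i, hi⟩
    cases i with
    | zero => exact Or.inl hi
    | succ i => exact Or.inr ⟨i, by simpa [Function.iterate_succ_apply] using hi⟩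
  · rintro (rfl | h)
    · exact Anc.refl _ _
    · exact h.of_apply

theorem Anc.trans (h : Anc f x y) (h' : Anc f y v) : Anc f x v := by
  obtain ⟨i, rfl⟩ := h
  obtain ⟨j, rfl⟩ := h'
  exact ⟨i + j, Function.iterate_add_apply f i j v⟩

end Ancestors

section ParentGraph

variable {V : Type*} {r : V} {par : V → V}

/-- The function `par` describes a tree with root `r`: from every vertex the root is reached by
passing to the parent again and again. -/
structure Rooted (r : V) (par : V → V) : Prop where
  root : par r = r
  reach : ∀ v, Anc par r v

/-- The graph in which every vertex other than `r` is joined to its parent. -/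
def parentGraph (r : V) (par : V → V) : SimpleGraph V :=
  SimpleGraph.fromRel fun u v => u ≠ r ∧ par u = v

theorem anc_root_iff (h : par r = r) {x : V} : Anc par x r ↔ x = r := by
  constructor
  · rintro ⟨i, rfl⟩
    exact Function.iterate_fixed h i
  · rintro rfl
    exact Anc.refl _ _

open Classical in
/-- The distance of a vertex from the root. -/
noncomputable def Rooted.depth (h : Rooted r par) (v : V) : ℕ := Nat.find (h.reach v)

theorem Rooted.depth_par (h : Rooted r par) {v : V} (hv : v ≠ r) :
    h.depth (par v) + 1 = h.depth v := by
  classical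
  exact (Nat.find_comp_succ (h.reach v) (h.reach (par v)) (by simpa using hv)).symm

theorem Rooted.par_ne (h : Rooted r par) {v : V} (hv : v ≠ r) : par v ≠ v := by
  intro hp
  have := h.depth_par hv
  rw [hp] at this
  omega

theorem Rooted.depth_le (h : Rooted r par) {x v : V} (hx : Anc par x v) :
    h.depth x ≤ h.depth v := by
  obtain ⟨i, rfl⟩ := hx
  induction i generalizing v with
  | zero => exact le_rfl
  | succ i ih =>
    rw [Function.iterate_succ_apply]
    refine ih.trans ?_
    by_cases hv : v = r
    · rw [hv, h.root]
    · have := h.depth_par hv; omega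

theorem Rooted.not_anc_par (h : Rooted r par) {v : V} (hv : v ≠ r) : ¬ Anc par v (par v) := by
  intro h'
  have h1 := h.depth_le h'
  have h2 := h.depth_par hv
  omega

theorem Rooted.adj_iff (h : Rooted r par) {u v : V} :
    (parentGraph r par).Adj u v ↔ (u ≠ r ∧ par u = v) ∨ (v ≠ r ∧ par v = u) := by
  simp only [parentGraph, SimpleGraph.fromRel_adj, and_iff_right_iff_imp]
  rintro (⟨hu, rfl⟩ | ⟨hv, rfl⟩)
  · exact (h.par_ne hu).symm
  · exact h.par_ne hv

theorem Rooted.adj_par (h : Rooted r par) {v : V} (hv : v ≠ r) :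
    (parentGraph r par).Adj v (par v) := h.adj_iff.2 (Or.inl ⟨hv, rfl⟩)

/-- The only edge that leaves the subtree of `x` joins `x` to its parent. -/
theorem Rooted.eq_of_adj_of_anc (h : Rooted r par) {u v x : V} (huv : (parentGraph r par).Adj u v)
    (hu : Anc par x u) (hv : ¬ Anc par x v) : u = x ∧ v = par x ∧ x ≠ r := by
  rcases h.adj_iff.1 huv with ⟨hur, rfl⟩ | ⟨hvr, rfl⟩
  · rcases anc_iff.1 hu with rfl | h'
    · exact ⟨rfl, rfl, hur⟩
    · exact absurd h' hv
  · exact absurd hu.of_apply hv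

theorem Rooted.reachable (h : Rooted r par) (v : V) : (parentGraph r par).Reachable v r := by
  obtain ⟨i, hi⟩ := h.reach v
  induction i generalizing v with
  | zero => rw [← hi]; rfl
  | succ i ih =>
    by_cases hv : v = r
    · rw [hv]
    · exact (h.adj_par hv).reachable.trans (ih _ (by simpa [Function.iterate_succ_apply] using hi))

theorem Rooted.edgeSet_eq (h : Rooted r par) :
    (parentGraph r par).edgeSet = (fun v => s(v, par v)) '' {v | v ≠ r} := by
  ext e
  induction e with
  | _ u v =>
    simp only [SimpleGraph.mem_edgeSet, h.adj_iff, Set.mem_image, Set.mem_ofPred_eq, Sym2.eq_iff]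
    constructor
    · rintro (⟨hu, rfl⟩ | ⟨hv, rfl⟩)
      · exact ⟨u, hu, Or.inl ⟨rfl, rfl⟩⟩
      · exact ⟨v, hv, Or.inr ⟨rfl, rfl⟩⟩
    · rintro ⟨x, hx, ⟨rfl, rfl⟩ | ⟨rfl, rfl⟩⟩
      · exact Or.inl ⟨hx, rfl⟩
      · exact Or.inr ⟨hx, rfl⟩

theorem Rooted.injOn_edge (h : Rooted r par) :
    Set.InjOn (fun v => s(v, par v)) {v | v ≠ r} := by
  intro u hu v hv huv
  rcases Sym2.eq_iff.1 huv with ⟨h1, _⟩ | ⟨h1, h2⟩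
  · exact h1
  · have h3 := h.depth_par hu
    have h4 := h.depth_par hv
    rw [← h1] at h4
    rw [h2] at h3
    omega

theorem Rooted.isTree [Finite V] (h : Rooted r par) : (parentGraph r par).IsTree := by
  rw [SimpleGraph.isTree_iff_connected_and_card]
  refine ⟨?_, ?_⟩
  · have : Nonempty V := ⟨r⟩
    exact ⟨fun u v => (h.reachable u).trans (h.reachable v).symm⟩
  · rw [Nat.card_coe_set_eq, h.edgeSet_eq, h.injOn_edge.ncard_image]
    have h1 := Set.ncard_add_ncard_compl ({r} : Set V)
    rw [Set.ncard_singleton] at h1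
    have h2 : {v | v ≠ r} = ({r} : Set V)ᶜ := by ext; simp
    rw [h2]
    omega

theorem walk_darts_fst_snd_mem {G : SimpleGraph V} {u v : V} (p : G.Walk u v) (d : G.Dart)
    (hd : d ∈ p.darts) : d.fst ∈ p.support ∧ d.snd ∈ p.support :=
  ⟨p.dart_fst_mem_support_of_mem_darts hd, p.dart_snd_mem_support_of_mem_darts hd⟩

/-- A walk that starts in the subtree of `x` and ends outside runs along the edge from `x` to its
parent. -/
theorem Rooted.exists_dart (h : Rooted r par) {u v x : V} (w : (parentGraph r par).Walk u v)
    (hu : Anc par x u) (hv : ¬ Anc par x v) :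
    ∃ d ∈ w.darts, d.fst = x ∧ d.snd = par x := by
  obtain ⟨d, hd, h1, h2⟩ := w.exists_boundary_dart {y | Anc par x y} hu hv
  obtain ⟨h3, h4, _⟩ := h.eq_of_adj_of_anc d.adj h1 h2
  exact ⟨d, hd, h3, h4⟩

theorem Rooted.exists_dart' (h : Rooted r par) {u v x : V} (w : (parentGraph r par).Walk u v)
    (hu : ¬ Anc par x u) (hv : Anc par x v) :
    ∃ d ∈ w.darts, d.fst = par x ∧ d.snd = x := by
  obtain ⟨d, hd, h1, h2⟩ := h.exists_dart w.reverse hv hu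
  rw [SimpleGraph.Walk.darts_reverse, List.mem_reverse, List.mem_map] at hd
  obtain ⟨d', hd', rfl⟩ := hd
  exact ⟨d', hd', h2, h1⟩

/-- A path that runs along the edge from `x` to its parent starts in the subtree of `x` and ends
outside. -/
theorem Rooted.anc_of_dart (h : Rooted r par) {u v x : V} (w : (parentGraph r par).Walk u v)
    (hw : w.IsPath) (hx : x ≠ r) {d : (parentGraph r par).Dart} (hd : d ∈ w.darts)
    (h1 : d.fst = x) (h2 : d.snd = par x) : Anc par x u ∧ ¬ Anc par x v := by
  induction w with
  | nil => simp at hd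
  | @cons u u' v huu' p ih =>
    rw [SimpleGraph.Walk.cons_isPath_iff] at hw
    rw [SimpleGraph.Walk.darts_cons, List.mem_cons] at hd
    rcases hd with rfl | hd
    · simp only at h1 h2
      subst h1 h2
      refine ⟨Anc.refl _ _, fun hv => hw.2 ?_⟩
      obtain ⟨d, hd, _, h4⟩ := h.exists_dart' p (h.not_anc_par hx) hv
      exact h4 ▸ (walk_darts_fst_snd_mem p d hd).2
    · obtain ⟨h3, h4⟩ := ih hw.1 hd
      refine ⟨?_, h4⟩
      by_contra hu
      obtain ⟨_, h5, _⟩ := h.eq_of_adj_of_anc huu'.symm h3 hu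
      refine hw.2 ?_
      rw [h5, ← h2]
      exact (walk_darts_fst_snd_mem p d hd).2

theorem Rooted.anc_of_dart' (h : Rooted r par) {u v x : V} (w : (parentGraph r par).Walk u v)
    (hw : w.IsPath) (hx : x ≠ r) {d : (parentGraph r par).Dart} (hd : d ∈ w.darts)
    (h1 : d.fst = par x) (h2 : d.snd = x) : ¬ Anc par x u ∧ Anc par x v := by
  have := h.anc_of_dart w.reverse hw.reverse hx (d := d.symm) ?_ h2 h1
  · exact this.symm
  · rw [SimpleGraph.Walk.darts_reverse, List.mem_reverse, List.mem_map]
    exact ⟨d, hd, rfl⟩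

/-- A sequence of vertices along a walk is increasing if every step is. -/
theorem pairwise_support_of_darts {G : SimpleGraph V} {f : V → ℝ} {u v : V} (w : G.Walk u v)
    (h : ∀ d ∈ w.darts, f d.fst < f d.snd) :
    w.support.Pairwise (fun x y => f x < f y) ∧ ∀ y ∈ w.support, f u ≤ f y := by
  induction w with
  | nil => simp
  | @cons u u' v huu' p ih =>
    have h0 : f u < f u' := h ⟨(u, u'), huu'⟩ (by simp)
    obtain ⟨h1, h2⟩ := ih fun d hd => h d (by simp [hd])
    rw [SimpleGraph.Walk.support_cons]
    refine ⟨List.pairwise_cons.2 ⟨fun y hy => h0.trans_le (h2 y hy), h1⟩, ?_⟩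
    intro y hy
    rcases List.mem_cons.1 hy with rfl | hy
    · exact le_rfl
    · exact h0.le.trans (h2 y hy)

theorem darts_of_pairwise_support {G : SimpleGraph V} {f : V → ℝ} {u v : V} (w : G.Walk u v)
    (h : w.support.Pairwise (fun x y => f x < f y)) : ∀ d ∈ w.darts, f d.fst < f d.snd := by
  induction w with
  | nil => simp
  | @cons u u' v huu' p ih =>
    rw [SimpleGraph.Walk.support_cons, List.pairwise_cons] at h
    intro d hd
    rw [SimpleGraph.Walk.darts_cons, List.mem_cons] at hd
    rcases hd with rfl | hd
    · exact h.1 _ p.start_mem_support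
    · exact ih h.2 d hd

end ParentGraph

section TreeToParent

variable {V : Type*} [DecidableEq V]

/-- Every tree is the graph of a parent function, for any choice of the root. -/
theorem exists_rooted {T : SimpleGraph V} (hT : T.IsTree) (r : V) :
    ∃ par : V → V, Rooted r par ∧ parentGraph r par = T := by
  choose q hq huniq using fun v => hT.existsUnique_path v r
  have hlen : ∀ v, ∀ p : T.Walk v r, p.IsPath → p = q v := fun v p hp => huniq v p hp
  have hr : q r = SimpleGraph.Walk.nil := (hlen r _ SimpleGraph.Walk.IsPath.nil).symm
  -- the tail of the path to the root is again such a path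
  have hadj : ∀ v, v ≠ r → T.Adj v (q v).snd ∧ (q (q v).snd).length + 1 = (q v).length := by
    intro v hv
    have hnil : ¬ (q v).Nil := SimpleGraph.Walk.not_nil_of_ne hv
    refine ⟨(q v).adj_snd hnil, ?_⟩
    rw [← hlen _ _ (hq v).tail]
    exact SimpleGraph.Walk.length_tail_add_one hnil
  have hroot : (q r).snd = r := by rw [hr]; rfl
  have hR : Rooted r (fun v => (q v).snd) := by
    refine ⟨hroot, ?_⟩
    have : ∀ m v, (q v).length = m → Anc (fun v => (q v).snd) r v := by
      intro m
      induction m with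
      | zero =>
        intro v hv
        rw [SimpleGraph.Walk.eq_of_length_eq_zero hv]
        exact Anc.refl _ _
      | succ m ih =>
        intro v hv
        by_cases hvr : v = r
        · rw [hvr]; exact Anc.refl _ _
        · exact Anc.of_apply (ih _ (by have := (hadj v hvr).2; omega))
    exact fun v => this _ v rfl
  refine ⟨fun v => (q v).snd, hR, ?_⟩
  ext u v
  rw [hR.adj_iff]
  constructor
  · rintro (⟨hu, rfl⟩ | ⟨hv, rfl⟩)
    · exact (hadj u hu).1
    · exact (hadj v hv).1.symm
  · intro huv
    by_cases hu : u ∈ (q v).support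
    · right
      -- the path from `v` to the root passes through `u`, hence starts with the edge to `u`
      have h1 : (q v).takeUntil u hu = SimpleGraph.Walk.cons huv.symm SimpleGraph.Walk.nil := by
        refine (hT.existsUnique_path v u).unique ((hq v).takeUntil hu) ?_
        simp [huv.ne']
      have hvr : v ≠ r := by
        rintro rfl
        rw [hr] at hu
        exact huv.ne (by simpa using hu)
      refine ⟨hvr, ?_⟩
      have h2 : (q v) = (SimpleGraph.Walk.cons huv.symm SimpleGraph.Walk.nil).append
          ((q v).dropUntil u hu) := by rw [← h1, SimpleGraph.Walk.take_spec]
      rw [h2]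
      simp
    · left
      have h1 : SimpleGraph.Walk.cons huv (q v) = q u := by
        refine hlen u _ ?_
        rw [SimpleGraph.Walk.cons_isPath_iff]
        exact ⟨hq v, hu⟩
      refine ⟨?_, by rw [← h1]; simp⟩
      rintro rfl
      rw [hr] at h1
      simp at h1

end TreeToParent

end MMST

/-! ### Layouts: trees glued from monotone chains -/

namespace MMST

section Layout

variable {V : Type*}

/-- Every vertex of the list `l` has its predecessor in `t :: l` as its parent, and `z` is the last
vertex of `t :: l`. -/
def Linked (par : V → V) : V → List V → V → Prop
  | t, [], z => z = t
  | t, x :: l, z => par x = t ∧ Linked par x l z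

variable {par : V → V}

theorem Linked.congr {par' : V → V} {t z : V} {l : List V} (h : Linked par t l z)
    (hl : ∀ x ∈ l, par' x = par x) : Linked par' t l z := by
  induction l generalizing t with
  | nil => exact h
  | cons x l ih =>
    exact ⟨(hl x (by simp)).trans h.1, ih h.2 fun y hy => hl y (by simp [hy])⟩

theorem Linked.concat {t z v : V} {l : List V} (h : Linked par t l z) (hv : par v = z) :
    Linked par t (l ++ [v]) v := by
  induction l generalizing t with
  | nil => exact ⟨hv.trans h, rfl⟩
  | cons x l ih => exact ⟨h.1, ih h.2⟩

theorem Linked.last_mem {t z : V} {l : List V} (h : Linked par t l z) : z = t ∨ z ∈ l := by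
  induction l generalizing t with
  | nil => exact Or.inl h
  | cons x l ih =>
    rcases ih h.2 with h' | h' <;> simp [h']

theorem Linked.par_mem {t z x : V} {l : List V} (h : Linked par t l z) (hx : x ∈ l) :
    par x = t ∨ par x ∈ l := by
  induction l generalizing t with
  | nil => simp at hx
  | cons y l ih =>
    rcases List.mem_cons.1 hx with rfl | hx
    · exact Or.inl h.1
    · rcases ih h.2 hx with h' | h' <;> simp [h']

theorem Linked.anc_top {t z : V} {l : List V} (h : Linked par t l z) :
    Anc par t z ∧ ∀ x ∈ l, Anc par t x := by
  induction l generalizing t with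
  | nil => rw [h]; exact ⟨Anc.refl _ _, by simp⟩
  | cons y l ih =>
    obtain ⟨h1, h2⟩ := ih h.2
    have h3 : Anc par t y := Anc.of_apply (h.1 ▸ Anc.refl _ _)
    refine ⟨h3.trans h1, fun x hx => ?_⟩
    rcases List.mem_cons.1 hx with rfl | hx
    · exact h3
    · exact h3.trans (h2 x hx)

theorem Linked.anc_last {t z x : V} {l : List V} (h : Linked par t l z) (hx : x ∈ l) :
    Anc par x z := by
  induction l generalizing t with
  | nil => simp at hx
  | cons y l ih =>
    rcases List.mem_cons.1 hx with rfl | hx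
    · exact h.2.anc_top.1
    · exact ih h.2 hx

theorem Linked.anc_total {t z x y : V} {l : List V} (h : Linked par t l z) (hx : x ∈ l)
    (hy : y ∈ l) : Anc par x y ∨ Anc par y x := by
  induction l generalizing t with
  | nil => simp at hx
  | cons a l ih =>
    rcases List.mem_cons.1 hx with rfl | hx' <;> rcases List.mem_cons.1 hy with rfl | hy'
    · exact Or.inl (Anc.refl _ _)
    · exact Or.inl (h.2.anc_top.2 _ hy')
    · exact Or.inr (h.2.anc_top.2 _ hx')
    · exact ih h.2 hx' hy'

/-- `par` is the parent function of the tree that is glued from chains as follows. The vertices of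
colour `a`, for `1 ≤ a ≤ Q`, form a chain in the order of increasing `key a`, and this chain is
attached to the end of the chain of the colour `up a`; the vertex `r` alone is the chain of colour
`0`. An empty chain passes on the end of the chain that it is attached to. -/
def IsLayout (r : V) (col : V → ℕ) (up : ℕ → ℕ) (key : ℕ → V → ℝ) (Q : ℕ) (par : V → V) : Prop :=
  ∃ L : ℕ → V, L 0 = r ∧ ∀ a, 1 ≤ a → a ≤ Q → ∃ l : List V, (∀ v, v ∈ l ↔ col v = a) ∧
    l.Pairwise (fun x y => key a x ≤ key a y) ∧ l.Nodup ∧ Linked par (L (up a)) l (L a)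

/-- The conditions that certify the monotonicity of a layout. The path between the ends of the
chains of colours `a` and `a'` passes, upwards, through the chains of colours above `a` but not
above `a'`, and then, downwards, through those above `a'` but not above `a`; the function
`val a a'` has to increase along it. -/
def Passes (r : V) (col : V → ℕ) (up : ℕ → ℕ) (val : ℕ → ℕ → V → ℝ) (Q : ℕ) (par : V → V) :
    Prop :=
  ∀ a ≤ Q, ∀ a' ≤ Q, ∀ v, v ≠ r →
    (Anc up (col v) a → ¬ Anc up (col v) a' → val a a' v < val a a' (par v)) ∧
    (¬ Anc up (col v) a → Anc up (col v) a' → val a a' (par v) < val a a' v)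

variable {r : V} {col : V → ℕ} {up : ℕ → ℕ} {key : ℕ → V → ℝ} {Q : ℕ} {val : ℕ → ℕ → V → ℝ}

/-- The assumptions on colours: `r` is the only vertex of colour `0`, and chains are attached to
chains of smaller colours. -/
structure Colouring (r : V) (col : V → ℕ) (up : ℕ → ℕ) (Q : ℕ) : Prop where
  root : col r = 0
  pos : ∀ v, v ≠ r → 1 ≤ col v
  le : ∀ v, col v ≤ Q
  up_zero : up 0 = 0
  up_lt : ∀ a, 1 ≤ a → up a < a

theorem Colouring.anc_zero (hc : Colouring r col up Q) (a : ℕ) : Anc up 0 a := by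
  induction a using Nat.strong_induction_on with
  | _ a ih =>
    rcases Nat.eq_zero_or_pos a with rfl | ha
    · exact Anc.refl _ _
    · exact (ih _ (hc.up_lt a ha)).of_apply

theorem Colouring.eq_root (hc : Colouring r col up Q) {v : V} (hv : col v = 0) : v = r := by
  by_contra h
  have := hc.pos v h
  omega

theorem Colouring.anc_last (hc : Colouring r col up Q) {L : ℕ → V} (h0 : L 0 = r)
    (hL : ∀ a, 1 ≤ a → a ≤ Q → ∃ l : List V, (∀ v, v ∈ l ↔ col v = a) ∧
      l.Pairwise (fun x y => key a x ≤ key a y) ∧ l.Nodup ∧ Linked par (L (up a)) l (L a))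
    (a : ℕ) (ha : a ≤ Q) : Anc up (col (L a)) a ∧ ∀ w, Anc up (col w) a → Anc par w (L a) := by
  induction a using Nat.strong_induction_on with
  | _ a ih =>
    rcases Nat.eq_zero_or_pos a with rfl | hpos
    · refine ⟨by rw [h0, hc.root]; exact Anc.refl _ _, fun w hw => ?_⟩
      rw [anc_root_iff hc.up_zero] at hw
      rw [hc.eq_root hw, h0]
      exact Anc.refl _ _
    · obtain ⟨l, hl, _, _, hlink⟩ := hL a hpos ha
      have hlt := hc.up_lt a hpos
      obtain ⟨ih1, ih2⟩ := ih _ hlt (hlt.le.trans ha)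
      constructor
      · rcases hlink.last_mem with h' | h'
        · rw [h']; exact ih1.of_apply
        · rw [(hl _).1 h']; exact Anc.refl _ _
      · intro w hw
        rcases anc_iff.1 hw with h' | h'
        · exact hlink.anc_last ((hl w).2 h'.symm)
        · exact (ih2 w h').trans hlink.anc_top.1

theorem IsLayout.anc_col_par (h : IsLayout r col up key Q par) (hc : Colouring r col up Q) {v : V}
    (hv : v ≠ r) : Anc up (col (par v)) (col v) := by
  obtain ⟨L, h0, hL⟩ := h
  obtain ⟨l, hl, _, _, hlink⟩ := hL (col v) (hc.pos v hv) (hc.le v)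
  rcases hlink.par_mem ((hl v).2 rfl) with h' | h'
  · rw [h']
    exact (hc.anc_last h0 hL _ ((hc.up_lt _ (hc.pos v hv)).le.trans (hc.le v))).1.of_apply
  · rw [(hl _).1 h']; exact Anc.refl _ _

/-- In a layout, two vertices are comparable as soon as their colours are. -/
theorem IsLayout.anc_total (h : IsLayout r col up key Q par) (hc : Colouring r col up Q) {x v : V}
    (hx : Anc up (col x) (col v)) : Anc par x v ∨ Anc par v x := by
  obtain ⟨L, h0, hL⟩ := h
  by_cases hv : v = r
  · subst hv
    rw [hc.root, anc_root_iff hc.up_zero] at hx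
    rw [hc.eq_root hx]
    exact Or.inl (Anc.refl _ _)
  · obtain ⟨l, hl, _, _, hlink⟩ := hL (col v) (hc.pos v hv) (hc.le v)
    rcases anc_iff.1 hx with h' | h'
    · exact hlink.anc_total ((hl x).2 h'.symm) ((hl v).2 rfl)
    · refine Or.inl (Anc.trans ?_ (hlink.anc_top.2 v ((hl v).2 rfl)))
      exact (hc.anc_last h0 hL _ ((hc.up_lt _ (hc.pos v hv)).le.trans (hc.le v))).2 x h'

theorem IsLayout.rooted (h : IsLayout r col up key Q par) (hc : Colouring r col up Q)
    (hr : par r = r) : Rooted r par := by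
  refine ⟨hr, fun v => ?_⟩
  rcases h.anc_total hc (x := r) (v := v) (by rw [hc.root]; exact hc.anc_zero _) with h' | h'
  · exact h'
  · rw [(anc_root_iff hr).1 h']; exact Anc.refl _ _

theorem IsLayout.anc_col (h : IsLayout r col up key Q par) (hc : Colouring r col up Q)
    (hr : par r = r) {x v : V} (hx : Anc par x v) : Anc up (col x) (col v) := by
  obtain ⟨i, rfl⟩ := hx
  induction i generalizing v with
  | zero => exact Anc.refl _ _
  | succ i ih =>
    rw [Function.iterate_succ_apply]
    refine ih.trans ?_
    by_cases hv : v = r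
    · rw [hv, hr]; exact Anc.refl _ _
    · exact h.anc_col_par hc hv

/-- In a layout that passes the test, every path is monotone. For two vertices neither of which is
an ancestor of the other the test for their colours applies; for comparable vertices, the test for
the colour of the lower one and the colour of the root. -/
theorem IsLayout.monotone (h : IsLayout r col up key Q par) (hc : Colouring r col up Q)
    (hr : par r = r) (hp : Passes r col up val Q par) {u v : V} (w : (parentGraph r par).Walk u v)
    (hw : w.IsPath) :
    ∃ a ≤ Q, ∃ a' ≤ Q, w.support.Pairwise (fun x y => val a a' x < val a a' y) := by
  have hR := h.rooted hc hr
  -- it suffices to treat the edges of the path, which run up to a parent or down from one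
  suffices hs : ∃ a ≤ Q, ∃ a' ≤ Q, ∀ x, x ≠ r →
      (Anc par x u → ¬ Anc par x v → val a a' x < val a a' (par x)) ∧
      (¬ Anc par x u → Anc par x v → val a a' (par x) < val a a' x) by
    obtain ⟨a, ha, a', ha', hs⟩ := hs
    refine ⟨a, ha, a', ha', (pairwise_support_of_darts w fun d hd => ?_).1⟩
    rcases hR.adj_iff.1 d.adj with ⟨hx, hx'⟩ | ⟨hx, hx'⟩
    · obtain ⟨h1, h2⟩ := hR.anc_of_dart w hw hx hd rfl hx'.symm
      rw [← hx']
      exact (hs _ hx).1 h1 h2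
    · obtain ⟨h1, h2⟩ := hR.anc_of_dart' w hw hx hd hx'.symm rfl
      rw [← hx']
      exact (hs _ hx).2 h1 h2
  by_cases huv : Anc par u v
  · refine ⟨0, Nat.zero_le _, col v, hc.le v, fun x hx => ⟨fun h1 h2 => ?_, fun _ h2 => ?_⟩⟩
    · exact absurd (h1.trans huv) h2
    · refine (hp 0 (Nat.zero_le _) _ (hc.le v) x hx).2 (fun h' => ?_) (h.anc_col hc hr h2)
      rw [anc_root_iff hc.up_zero] at h'
      exact hx (hc.eq_root h')
  by_cases hvu : Anc par v u
  · refine ⟨col u, hc.le u, 0, Nat.zero_le _, fun x hx => ⟨fun h1 _ => ?_, fun h1 h2 => ?_⟩⟩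
    · refine (hp _ (hc.le u) 0 (Nat.zero_le _) x hx).1 (h.anc_col hc hr h1) (fun h' => ?_)
      rw [anc_root_iff hc.up_zero] at h'
      exact hx (hc.eq_root h')
    · exact absurd (h2.trans hvu) h1
  refine ⟨col u, hc.le u, col v, hc.le v, fun x hx => ⟨fun h1 h2 => ?_, fun h1 h2 => ?_⟩⟩
  · refine (hp _ (hc.le u) _ (hc.le v) x hx).1 (h.anc_col hc hr h1) (fun h' => ?_)
    rcases h.anc_total hc h' with h3 | h3
    · exact h2 h3
    · exact hvu (h3.trans h1)
  · refine (hp _ (hc.le u) _ (hc.le v) x hx).2 (fun h' => ?_) (h.anc_col hc hr h2)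
    rcases h.anc_total hc h' with h3 | h3
    · exact h1 h3
    · exact huv (h3.trans h2)

end Layout

end MMST

/-! ### The chains of a rooted tree -/

namespace MMST

section Chains

variable {V : Type*} {r : V} {par : V → V} {Sp : Set V}

/-- A rooted tree and a set `Sp` of special vertices that contains the root and all branching
vertices. -/
structure Special (r : V) (par : V → V) (Sp : Set V) : Prop where
  rooted : Rooted r par
  root_mem : r ∈ Sp
  child_unique : ∀ x, x ∉ Sp → ∀ p q, p ≠ r → q ≠ r → par p = x → par q = x → p = q

theorem Special.exists_top (h : Special r par Sp) (v : V) :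
    ∃ i, par^[i] v ∈ Sp ∨ par (par^[i] v) ∈ Sp := by
  obtain ⟨i, hi⟩ := h.rooted.reach v
  exact ⟨i, Or.inl (hi ▸ h.root_mem)⟩

open Classical in
/-- The vertices are divided into chains: every special vertex forms a chain of its own, and two
adjacent vertices that are not special belong to the same chain. This is the vertex closest to the
root in the chain of `v`. -/
noncomputable def Special.top (h : Special r par Sp) (v : V) : V :=
  par^[Nat.find (h.exists_top v)] v

variable {p q x y v : V}

theorem Special.top_spec (h : Special r par Sp) (v : V) : h.top v ∈ Sp ∨ par (h.top v) ∈ Sp := by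
  classical
  exact Nat.find_spec (h.exists_top v)

theorem Special.top_eq (h : Special r par Sp) (hv : v ∈ Sp ∨ par v ∈ Sp) : h.top v = v := by
  classical
  rw [Special.top, (Nat.find_eq_zero (h.exists_top v)).2 hv, Function.iterate_zero_apply]

theorem Special.top_par (h : Special r par Sp) (hv : ¬ (v ∈ Sp ∨ par v ∈ Sp)) :
    h.top (par v) = h.top v := by
  classical
  rw [Special.top, Special.top,
    Nat.find_comp_succ (h.exists_top v) (h.exists_top (par v)) (by simpa using hv),
    Function.iterate_succ_apply]
  rfl

theorem Special.top_par' (h : Special r par Sp) (hv : h.top v ≠ v) : h.top (par v) = h.top v :=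
  h.top_par fun h' => hv (h.top_eq h')

theorem Special.top_top (h : Special r par Sp) (v : V) : h.top (h.top v) = h.top v :=
  h.top_eq (h.top_spec v)

theorem Special.anc_top (h : Special r par Sp) (v : V) : Anc par (h.top v) v := ⟨_, rfl⟩

theorem Special.ne_root (h : Special r par Sp) (hv : v ∉ Sp) : v ≠ r :=
  fun hr => hv (hr ▸ h.root_mem)

theorem Special.top_notMem (h : Special r par Sp) (hv : v ∉ Sp) : h.top v ∉ Sp := by
  have : ∀ m v, h.rooted.depth v = m → v ∉ Sp → h.top v ∉ Sp := by
    intro m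
    induction m with
    | zero =>
      intro v hm hv
      have := h.rooted.depth_par (h.ne_root hv)
      omega
    | succ m ih =>
      intro v hm hv
      by_cases hp : par v ∈ Sp
      · rwa [h.top_eq (Or.inr hp)]
      · rw [← h.top_par (by tauto)]
        refine ih _ ?_ hp
        have := h.rooted.depth_par (h.ne_root hv)
        omega
  exact this _ v rfl hv

theorem Special.top_ne_root (h : Special r par Sp) (hv : v ≠ r) : h.top v ≠ r := by
  by_cases hs : v ∈ Sp
  · rwa [h.top_eq (Or.inl hs)]
  · exact h.ne_root (h.top_notMem hs)

theorem Special.depth_top_le (h : Special r par Sp) (v : V) :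
    h.rooted.depth (h.top v) ≤ h.rooted.depth v := h.rooted.depth_le (h.anc_top v)

/-- A chain contains at most one vertex of each depth. -/
theorem Special.eq_of_depth_eq (h : Special r par Sp) (ht : h.top p = h.top q)
    (hd : h.rooted.depth p = h.rooted.depth q) : p = q := by
  have aux : ∀ p q, h.top p = h.top q → h.rooted.depth p = h.rooted.depth q → h.top p = p →
      p = q := by
    intro p q ht hd hp
    by_contra hne
    have hq : h.top q ≠ q := fun hq => hne (by rw [← hp, ht, hq])
    have hqr : q ≠ r := by
      rintro rfl
      exact hq (h.top_eq (Or.inl h.root_mem))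
    have h1 := h.top_par' hq
    have h2 := h.depth_top_le (par q)
    have h3 := h.rooted.depth_par hqr
    rw [h1, ← ht, hp] at h2
    omega
  have : ∀ m p q, h.rooted.depth p = m → h.top p = h.top q →
      h.rooted.depth p = h.rooted.depth q → p = q := by
    intro m
    induction m with
    | zero =>
      intro p q hm ht hd
      refine aux p q ht hd ?_
      by_contra hp
      have := h.rooted.depth_par (v := p) (by
        rintro rfl
        exact hp (h.top_eq (Or.inl h.root_mem)))
      omega
    | succ m ih =>
      intro p q hm ht hd
      by_cases hp : h.top p = p
      · exact aux p q ht hd hp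
      by_cases hq : h.top q = q
      · exact (aux q p ht.symm hd.symm hq).symm
      have hp' : ¬ (p ∈ Sp ∨ par p ∈ Sp) := fun h' => hp (h.top_eq h')
      have hq' : ¬ (q ∈ Sp ∨ par q ∈ Sp) := fun h' => hq (h.top_eq h')
      have hpr := h.ne_root (v := p) (by tauto)
      have hqr := h.ne_root (v := q) (by tauto)
      have h1 := h.rooted.depth_par hpr
      have h2 := h.rooted.depth_par hqr
      have h3 : par p = par q :=
        ih _ _ (by omega) (by rw [h.top_par hp', h.top_par hq', ht]) (by omega)
      exact h.child_unique (par p) (by tauto) p q hpr hqr rfl h3.symm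
  exact this _ p q rfl ht hd

theorem Special.top_ne_of_depth_lt (h : Special r par Sp) (ht : h.top p = h.top q)
    (hd : h.rooted.depth p < h.rooted.depth q) : h.top q ≠ q := by
  intro hq
  have := h.depth_top_le p
  rw [ht, hq] at this
  omega

theorem Special.exists_child (h : Special r par Sp) (ht : h.top p = h.top q)
    (hd : h.rooted.depth p < h.rooted.depth q) :
    ∃ c, par c = p ∧ h.top c ≠ c ∧ Anc par c q := by
  obtain ⟨m, hm⟩ : ∃ m, h.rooted.depth q = h.rooted.depth p + 1 + m :=
    ⟨_, (Nat.add_sub_of_le hd).symm⟩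
  induction m generalizing q with
  | zero =>
    have hq := h.top_ne_of_depth_lt ht hd
    have h1 := h.rooted.depth_par (v := q) (h.ne_root fun h' => hq (h.top_eq (Or.inl h')))
    exact ⟨q, h.eq_of_depth_eq (by rw [h.top_par' hq, ht]) (by omega), hq, Anc.refl _ _⟩
  | succ m ih =>
    have hq := h.top_ne_of_depth_lt ht hd
    have h1 := h.rooted.depth_par (v := q) (h.ne_root fun h' => hq (h.top_eq (Or.inl h')))
    obtain ⟨c, h2, h3, h4⟩ := ih (q := par q) (by rw [h.top_par' hq, ht]) (by omega) (by omega)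
    exact ⟨c, h2, h3, h4.of_apply⟩

theorem Special.anc_of_depth_le (h : Special r par Sp) (ht : h.top p = h.top q)
    (hd : h.rooted.depth p ≤ h.rooted.depth q) : Anc par p q := by
  rcases hd.eq_or_lt with hd | hd
  · rw [h.eq_of_depth_eq ht hd]; exact Anc.refl _ _
  · obtain ⟨c, rfl, _, h2⟩ := h.exists_child ht hd
    exact Anc.trans (Anc.of_apply (Anc.refl _ _)) h2

/-- Vertices that are joined by a path without special vertices belong to the same chain. -/
theorem Special.top_eq_of_walk (h : Special r par Sp) (w : (parentGraph r par).Walk p q)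
    (hw : ∀ x ∈ w.support, x ∉ Sp) : h.top p = h.top q := by
  induction w with
  | nil => rfl
  | @cons u u' v huu' w ih =>
    have h1 := ih fun x hx => hw x (by simp [hx])
    rw [← h1]
    have hu : u ∉ Sp := hw u (by simp)
    have hu' : u' ∉ Sp := hw u' (by simp)
    rcases h.rooted.adj_iff.1 huu' with ⟨_, rfl⟩ | ⟨_, rfl⟩
    · exact (h.top_par (by tauto)).symm
    · exact h.top_par (by tauto)

theorem exists_numbering (S : Finset V) (d : V → ℕ) :
    ∃ num : V → ℕ, Set.InjOn num S ∧ (∀ t ∈ S, 1 ≤ num t ∧ num t ≤ S.card) ∧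
      ∀ t ∈ S, ∀ t' ∈ S, d t < d t' → num t < num t' := by
  classical
  induction S using Finset.induction_on_max_value d with
  | empty => exact ⟨fun _ => 0, by simp, by simp, by simp⟩
  | insert a s ha hmax ih =>
    obtain ⟨num, h1, h2, h3⟩ := ih
    have hne : ∀ t ∈ s, t ≠ a := fun t ht => by rintro rfl; exact ha ht
    have hs : ∀ t ∈ s, Function.update num a (s.card + 1) t = num t := fun t ht =>
      Function.update_of_ne (hne t ht) _ _
    refine ⟨Function.update num a (s.card + 1), ?_, ?_, ?_⟩
    · intro t ht t' ht' htt
      rw [Finset.mem_coe, Finset.mem_insert] at ht ht'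
      rcases ht with rfl | ht <;> rcases ht' with rfl | ht'
      · rfl
      · rw [hs t' ht', Function.update_self] at htt
        have := (h2 t' ht').2
        omega
      · rw [hs t ht, Function.update_self] at htt
        have := (h2 t ht).2
        omega
      · rw [hs t ht, hs t' ht'] at htt
        exact h1 ht ht' htt
    · intro t ht
      rw [Finset.card_insert_of_notMem ha]
      rcases Finset.mem_insert.1 ht with rfl | ht
      · simp
      · rw [hs t ht]
        have := h2 t ht
        omega
    · intro t ht t' ht' hd
      rcases Finset.mem_insert.1 ht with rfl | h4 <;> rcases Finset.mem_insert.1 ht' with rfl | h5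
      · omega
      · have := hmax t' h5; omega
      · rw [hs t h4, Function.update_self]
        have := (h2 t h4).2
        omega
      · rw [hs t h4, hs t' h5]
        exact h3 t h4 t' h5 hd

theorem Linked.last_mem_of_mem {t z x : V} {l : List V} (h : Linked par t l z) (hx : x ∈ l) :
    z ∈ l := by
  cases l with
  | nil => simp at hx
  | cons y l =>
    rcases Linked.last_mem h.2 with h' | h' <;> simp [h']

/-- A list of vertices of a rooted tree, sorted by depth and closed under passing to the parent
until `t` is reached, is a downward path in the tree. -/
theorem Linked.eq_par {par' : V → V} {d : V → ℕ} {t z : V} {l : List V} (h : Linked par' t l z)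
    (hs : l.Pairwise (fun x y => d x < d y)) (hd : ∀ x ∈ l, d (par x) + 1 = d x)
    (hp : ∀ x ∈ l, par x = t ∨ par x ∈ l) :
    (∀ x ∈ l, par' x = par x) ∧ ∀ x ∈ l, d x ≤ d z := by
  induction l generalizing t with
  | nil => simp
  | cons a l ih =>
    rw [List.pairwise_cons] at hs
    have ha : par a = t := by
      rcases hp a (by simp) with h' | h'
      · exact h'
      · have h1 := hd a (by simp)
        rcases List.mem_cons.1 h' with h2 | h2
        · rw [h2] at h1; omega
        · have := hs.1 _ h2; omega
    have hl : ∀ x ∈ l, par x = a ∨ par x ∈ l := by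
      intro x hx
      rcases hp x (by simp [hx]) with h' | h'
      · have h1 := hd a (by simp)
        have h2 := hd x (by simp [hx])
        have h3 := hs.1 x hx
        rw [h'] at h2
        rw [ha] at h1
        omega
      · simpa using h'
    obtain ⟨h1, h2⟩ := ih h.2 hs.2 (fun x hx => hd x (by simp [hx])) hl
    refine ⟨fun x hx => ?_, fun x hx => ?_⟩
    · rcases List.mem_cons.1 hx with rfl | hx
      · rw [h.1, ha]
      · exact h1 x hx
    · rcases List.mem_cons.1 hx with rfl | hx
      · rcases h.2.last_mem with h3 | h3
        · rw [h3]
        · exact (hs.1 _ h3).le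
      · exact h2 x hx

end Chains

end MMST

/-! ### Monotone trees as layouts -/

namespace MMST

section Completeness

variable {V : Type*} {r : V} {par : V → V} {Sp : Set V}

/-- A monotone tree is the only layout for a suitable colouring, and it passes the test. The colour
of a vertex is the number of its chain, where the chains are numbered by increasing depth; it is a
function `F` of the signature `sig`, since the signature determines the chain. -/
theorem Special.exists_colouring [Fintype V] (h : Special r par Sp) {sig : V → ℕ} {Q J : ℕ}
    (hQ : ∀ v, sig v < Q)
    (hsig : ∀ p q, sig p = sig q → p = q ∨
      ∃ w : (parentGraph r par).Walk p q, ∀ x ∈ w.support, x ∉ Sp)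
    {κ : ℕ → V → ℝ}
    (hmono : ∀ u v, ∃ j < J, ∀ w : (parentGraph r par).Walk u v, w.IsPath →
      w.support.Pairwise (fun x y => κ j x < κ j y)) :
    ∃ (F : ℕ → ℕ) (up : ℕ → ℕ) (cert : ℕ → ℕ → ℕ), (∀ s, F s < Q) ∧ up 0 = 0 ∧
      (∀ a, 1 ≤ a → up a < a) ∧ (∀ a, Q < a → up a = 0) ∧ (∀ a a', cert a a' < J) ∧
      ∀ col : V → ℕ, col r = 0 → (∀ v, v ≠ r → col v = 1 + F (sig v)) →
        ∀ par', IsLayout r col up (fun a => κ (cert 0 a)) Q par' →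
          (∀ x, x ≠ r → par' x = par x) ∧ Passes r col up (fun a a' => κ (cert a a')) Q par := by
  classical
  have hR := h.rooted
  -- the tops of the chains and their numbers
  set S : Finset V := (Finset.univ.filter (· ≠ r)).image h.top with hS
  have hSmem : ∀ v, v ≠ r → h.top v ∈ S := fun v hv =>
    Finset.mem_image.2 ⟨v, by simpa using hv, rfl⟩
  have hStop : ∀ t ∈ S, h.top t = t ∧ t ≠ r := by
    intro t ht
    obtain ⟨v, hv, rfl⟩ := Finset.mem_image.1 ht
    exact ⟨h.top_top v, h.top_ne_root (by simpa using hv)⟩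
  have htop : ∀ p q, sig p = sig q → h.top p = h.top q := by
    intro p q hpq
    rcases hsig p q hpq with rfl | ⟨w, hw⟩
    · rfl
    · exact h.top_eq_of_walk w hw
  have hScard : S.card ≤ Q := by
    refine (Finset.card_le_card_of_injOn sig (t := Finset.range Q) (fun v _ => by simpa using hQ v)
      ?_).trans (by simp)
    intro t ht t' ht' htt
    rw [← (hStop t ht).1, ← (hStop t' ht').1, htop t t' htt]
  obtain ⟨num, num_inj, num_le, num_lt⟩ := exists_numbering S hR.depth
  set c : V → ℕ := fun v => if v = r then 0 else num (h.top v) with hcdef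
  have c_root : c r = 0 := by simp [hcdef]
  have c_ne : ∀ v, v ≠ r → c v = num (h.top v) := fun v hv => by simp [hcdef, hv]
  have c_pos : ∀ v, v ≠ r → 1 ≤ c v := fun v hv => by
    rw [c_ne v hv]; exact (num_le _ (hSmem v hv)).1
  have c_ne0 : ∀ v, v ≠ r → c v ≠ 0 := fun v hv => Nat.one_le_iff_ne_zero.1 (c_pos v hv)
  have c_le : ∀ v, v ≠ r → c v ≤ Q := fun v hv => by
    rw [c_ne v hv]; exact (num_le _ (hSmem v hv)).2.trans hScard
  have c_inj : ∀ u v, u ≠ r → v ≠ r → c u = c v → h.top u = h.top v := by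
    intro u v hu hv huv
    rw [c_ne u hu, c_ne v hv] at huv
    exact num_inj (hSmem u hu) (hSmem v hv) huv
  have c_par : ∀ v, h.top v ≠ v → par v ≠ r ∧ c (par v) = c v := by
    intro v hv
    have hv' : ¬ (v ∈ Sp ∨ par v ∈ Sp) := fun h' => hv (h.top_eq h')
    have h1 := h.ne_root (v := par v) (by tauto)
    have h2 := h.ne_root (v := v) (by tauto)
    exact ⟨h1, by rw [c_ne _ h1, c_ne _ h2, h.top_par hv']⟩
  -- the colour above
  have hup : ∀ a, ∃ b, (∀ v, v ≠ r → c v = a → b = c (par (h.top v))) ∧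
      ((∀ v, v ≠ r → c v ≠ a) → b = 0) := by
    intro a
    by_cases ha : ∃ v, v ≠ r ∧ c v = a
    · obtain ⟨v, hv, hva⟩ := ha
      refine ⟨c (par (h.top v)), fun u hu hua => ?_, fun h' => absurd hva (h' v hv)⟩
      rw [c_inj u v hu hv (hua.trans hva.symm)]
    · push Not at ha
      exact ⟨0, fun v hv hva => absurd hva (ha v hv), fun _ => rfl⟩
  choose up hup1 hup2 using hup
  have up_zero : up 0 = 0 := hup2 0 fun v hv => c_ne0 v hv
  have up_big : ∀ a, Q < a → up a = 0 := fun a ha => hup2 a fun v hv => by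
    have := c_le v hv
    omega
  have up_lt : ∀ a, 1 ≤ a → up a < a := by
    intro a ha
    by_cases hex : ∃ v, v ≠ r ∧ c v = a
    · obtain ⟨v, hv, rfl⟩ := hex
      rw [hup1 _ v hv rfl]
      have htr := h.top_ne_root hv
      by_cases hp : par (h.top v) = r
      · rw [hp, c_root]; exact ha
      · rw [c_ne _ hp, c_ne v hv]
        refine num_lt _ (hSmem _ hp) _ (hSmem v hv) ?_
        have h1 := h.depth_top_le (par (h.top v))
        have h2 := hR.depth_par htr
        omega
    · push Not at hex
      rw [hup2 a hex]
      exact ha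
  -- the last vertex of each chain
  have hz : ∀ a, ∃ z, (∀ v, v ≠ r → c v = a → z ≠ r ∧ c z = a ∧ hR.depth v ≤ hR.depth z) ∧
      ((∀ v, v ≠ r → c v ≠ a) → z = r) := by
    intro a
    by_cases ha : ∃ v, v ≠ r ∧ c v = a
    · obtain ⟨z, hz, hmax⟩ := Finset.exists_max_image
        (Finset.univ.filter fun v => v ≠ r ∧ c v = a) hR.depth (by
          obtain ⟨v, hv⟩ := ha
          exact ⟨v, by simpa using hv⟩)
      simp only [Finset.mem_filter, Finset.mem_univ, true_and] at hz hmax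
      exact ⟨z, fun v hv hva => ⟨hz.1, hz.2, hmax v ⟨hv, hva⟩⟩,
        fun h' => absurd hz.2 (h' z hz.1)⟩
    · push Not at ha
      exact ⟨r, fun v hv hva => absurd hva (ha v hv), fun _ => rfl⟩
  choose z hz1 hz2 using hz
  have z_zero : z 0 = r := hz2 0 fun v hv => c_ne0 v hv
  -- chains are attached at ends of chains
  have z_par : ∀ v, v ≠ r → z (c (par (h.top v))) = par (h.top v) := by
    intro v hv
    have htr := h.top_ne_root hv
    set t := h.top v with ht
    by_cases hp : par t = r
    · rw [hp, c_root, z_zero]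
    obtain ⟨h1, h2, h3⟩ := hz1 (c (par t)) (par t) hp rfl
    have h4 := c_inj _ _ hp h1 h2.symm
    rcases h3.eq_or_lt with h5 | h5
    · exact (h.eq_of_depth_eq h4 h5).symm
    · obtain ⟨x, hx1, hx2, _⟩ := h.exists_child h4 h5
      have hx3 : ¬ (x ∈ Sp ∨ par x ∈ Sp) := fun h' => hx2 (h.top_eq h')
      have h6 : t = x := h.child_unique (par t) (by rw [← hx1]; tauto) t x htr
        (h.ne_root (by tauto)) rfl hx1
      rw [← h6, ht, h.top_top] at hx2
      exact absurd rfl hx2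
  choose cert hcert1 hcert2 using fun a a' => hmono (z a) (z a')
  have anc_z : ∀ v, v ≠ r → Anc par v (z (c v)) := by
    intro v hv
    obtain ⟨h1, h2, h3⟩ := hz1 (c v) v hv rfl
    exact h.anc_of_depth_le (c_inj _ _ hv h1 h2.symm) h3
  -- the ancestors of the end of a chain have colours above that of the chain, and conversely
  have anc_col_par : ∀ v, v ≠ r → Anc up (c (par v)) (c v) := by
    intro v hv
    by_cases ht : h.top v = v
    · have := hup1 (c v) v hv rfl
      rw [ht] at this
      exact Anc.of_apply (this ▸ Anc.refl _ _)
    · rw [(c_par v ht).2]; exact Anc.refl _ _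
  have anc_col : ∀ x v, Anc par x v → Anc up (c x) (c v) := by
    rintro x v ⟨i, rfl⟩
    induction i generalizing v with
    | zero => exact Anc.refl _ _
    | succ i ih =>
      rw [Function.iterate_succ_apply]
      refine (ih _).trans ?_
      by_cases hv : v = r
      · rw [hv, hR.root]; exact Anc.refl _ _
      · exact anc_col_par v hv
  have up_anc_zero : ∀ a, Anc up 0 a := by
    intro a
    induction a using Nat.strong_induction_on with
    | _ a ih =>
      rcases Nat.eq_zero_or_pos a with rfl | ha
      · exact Anc.refl _ _
      · exact (ih _ (up_lt a ha)).of_apply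
  have G1 : ∀ a x, x ≠ r → Anc up (c x) a → Anc par x (z a) := by
    intro a
    induction a using Nat.strong_induction_on with
    | _ a ih =>
      intro x hx hxa
      rcases anc_iff.1 hxa with rfl | h'
      · exact anc_z x hx
      rcases Nat.eq_zero_or_pos a with rfl | ha
      · rw [anc_root_iff up_zero] at hxa
        exact absurd hxa (c_ne0 x hx)
      by_cases hex : ∃ v, v ≠ r ∧ c v = a
      · obtain ⟨v, hv, rfl⟩ := hex
        have h1 := ih _ (up_lt _ ha) x hx h'
        rw [hup1 _ v hv rfl, z_par v hv] at h1
        exact (h1.of_apply).trans ((h.anc_top v).trans (anc_z v hv))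
      · push Not at hex
        rw [hup2 a hex, anc_root_iff up_zero] at h'
        exact absurd h' (c_ne0 x hx)
  have G2 : ∀ a x, Anc par x (z a) → Anc up (c x) a := by
    intro a x hx
    by_cases hex : ∃ v, v ≠ r ∧ c v = a
    · obtain ⟨v, hv, hva⟩ := hex
      have := anc_col _ _ hx
      rwa [(hz1 a v hv hva).2.1] at this
    · push Not at hex
      rw [hz2 a hex, anc_root_iff hR.root] at hx
      rw [hx, c_root]
      exact up_anc_zero a
  have hpath : ∀ u v, ∃ w : (parentGraph r par).Walk u v, w.IsPath := fun u v =>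
    ((hR.reachable u).trans (hR.reachable v).symm).exists_isPath
  have E1 : ∀ a a' x, x ≠ r → Anc par x (z a) → ¬ Anc par x (z a') →
      κ (cert a a') x < κ (cert a a') (par x) := by
    intro a a' x _ h1 h2
    obtain ⟨w, hw⟩ := hpath (z a) (z a')
    obtain ⟨d, hd, h3, h4⟩ := hR.exists_dart w h1 h2
    have := darts_of_pairwise_support w (hcert2 a a' w hw) d hd
    rwa [h3, h4] at this
  have E2 : ∀ a a' x, x ≠ r → ¬ Anc par x (z a) → Anc par x (z a') →
      κ (cert a a') (par x) < κ (cert a a') x := by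
    intro a a' x _ h1 h2
    obtain ⟨w, hw⟩ := hpath (z a) (z a')
    obtain ⟨d, hd, h3, h4⟩ := hR.exists_dart' w h1 h2
    have := darts_of_pairwise_support w (hcert2 a a' w hw) d hd
    rwa [h3, h4] at this
  -- along a chain the key increases with the depth
  have M : ∀ a x y, Anc par x y → Anc par y (z a) → x ≠ y → κ (cert 0 a) x < κ (cert 0 a) y := by
    have M' : ∀ a i y, Anc par y (z a) → κ (cert 0 a) (par^[i] y) ≤ κ (cert 0 a) y ∧
        (par^[i] y ≠ y → κ (cert 0 a) (par^[i] y) < κ (cert 0 a) y) := by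
      intro a i
      induction i with
      | zero => exact fun y _ => ⟨le_rfl, fun h' => absurd rfl h'⟩
      | succ i ih =>
        intro y hy
        by_cases hyr : y = r
        · have : par^[i + 1] y = y := by rw [hyr]; exact Function.iterate_fixed hR.root _
          rw [this]
          exact ⟨le_rfl, fun h' => absurd rfl h'⟩
        · have h1 := (ih (par y) (Anc.trans (Anc.of_apply (Anc.refl _ _)) hy)).1
          have h2 := E2 0 a y hyr (by rw [z_zero, anc_root_iff hR.root]; exact hyr) hy
          rw [Function.iterate_succ_apply]
          exact ⟨(h1.trans_lt h2).le, fun _ => h1.trans_lt h2⟩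
    rintro a x y ⟨i, rfl⟩ hy hne
    exact (M' a i y hy).2 hne
  -- the colour as a function of the signature
  have hF : ∀ s, ∃ b < Q, ∀ v, v ≠ r → sig v = s → c v = 1 + b := by
    intro s
    by_cases hs : ∃ v, v ≠ r ∧ sig v = s
    · obtain ⟨v, hv, rfl⟩ := hs
      have h1 := c_pos v hv
      have h2 := c_le v hv
      refine ⟨c v - 1, by omega, fun u hu hus => ?_⟩
      have : c u = c v := by rw [c_ne u hu, c_ne v hv, htop u v hus]
      omega
    · push Not at hs
      exact ⟨0, Nat.zero_lt_of_lt (hQ r), fun v hv hvs => absurd hvs (hs v hv)⟩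
  choose F hF1 hF2 using hF
  refine ⟨F, up, cert, hF1, up_zero, up_lt, up_big, hcert1, ?_⟩
  intro col hcol1 hcol2 par' hlay
  obtain rfl : col = c := by
    funext v
    by_cases hv : v = r
    · rw [hv, hcol1, c_root]
    · rw [hcol2 v hv, hF2 _ v hv rfl]
  refine ⟨?_, fun a _ a' _ v hv => ⟨fun h1 h2 => ?_, fun h1 h2 => ?_⟩⟩
  · obtain ⟨L, hL0, hL⟩ := hlay
    have main : ∀ a, (a = 0 ∨ ∃ v, v ≠ r ∧ c v = a) →
        L a = z a ∧ ∀ x, x ≠ r → c x = a → par' x = par x := by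
      intro a
      induction a using Nat.strong_induction_on with
      | _ a ih =>
        rintro ha
        rcases Nat.eq_zero_or_pos a with rfl | hpos
        · exact ⟨by rw [hL0, z_zero], fun x hx hx0 => absurd hx0 (c_ne0 x hx)⟩
        obtain ⟨v, hv, rfl⟩ := ha.resolve_left hpos.ne'
        obtain ⟨l, hl, hsort, hnodup, hlink⟩ := hL (c v) hpos (c_le v hv)
        have hmem : ∀ x, x ∈ l ↔ x ≠ r ∧ h.top x = h.top v := by
          intro x
          rw [hl]
          constructor
          · intro hx
            have hxr : x ≠ r := by rintro rfl; omega
            exact ⟨hxr, c_inj x v hxr hv hx⟩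
          · rintro ⟨hx, hxt⟩
            rw [c_ne x hx, c_ne v hv, hxt]
        have hLup : L (up (c v)) = par (h.top v) := by
          have hb := hup1 (c v) v hv rfl
          rw [(ih _ (up_lt _ hpos) ?_).1, hb, z_par v hv]
          rw [hb]
          by_cases hp : par (h.top v) = r
          · exact Or.inl (by rw [hp, c_root])
          · exact Or.inr ⟨_, hp, rfl⟩
        rw [hLup] at hlink
        have hsort' : l.Pairwise (fun x y => hR.depth x < hR.depth y) := by
          refine List.Pairwise.imp_of_mem ?_ (hsort.and hnodup)
          rintro x y hx hy ⟨hxy, hne⟩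
          obtain ⟨hxr, hxt⟩ := (hmem x).1 hx
          obtain ⟨hyr, hyt⟩ := (hmem y).1 hy
          by_contra hlt
          have h1 := h.anc_of_depth_le (hyt.trans hxt.symm) (not_lt.1 hlt)
          have h2 := M (c v) y x h1 ((hl x).1 hx ▸ anc_z x hxr) (Ne.symm hne)
          exact absurd hxy (not_le.2 h2)
        obtain ⟨h1, h2⟩ := hlink.eq_par hsort'
          (fun x hx => hR.depth_par ((hmem x).1 hx).1)
          (fun x hx => by
            obtain ⟨hxr, hxt⟩ := (hmem x).1 hx
            by_cases ht : h.top x = x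
            · left; rw [← hxt, ht]
            · right
              rw [hmem]
              exact ⟨(c_par x ht).1, (h.top_par' ht).trans hxt⟩)
        refine ⟨?_, fun x hx hxa => h1 x ((hl x).2 hxa)⟩
        have hLl : L (c v) ∈ l := hlink.last_mem_of_mem ((hl v).2 rfl)
        obtain ⟨h3, h4, h5⟩ := hz1 (c v) v hv rfl
        have h6 := h2 _ ((hl _).2 h4)
        obtain ⟨h7, h8⟩ := (hmem _).1 hLl
        obtain ⟨_, h9⟩ := (hmem _).1 ((hl _).2 h4)
        have h10 := (hz1 (c v) _ h7 ((hl _).1 hLl)).2.2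
        exact h.eq_of_depth_eq (h8.trans h9.symm) (le_antisymm h10 h6)
    exact fun x hx => (main (c x) (Or.inr ⟨x, hx, rfl⟩)).2 x hx rfl
  · exact E1 a a' v hv (G1 a v hv h1) fun h3 => h2 (G2 a' v h3)
  · exact E2 a a' v hv (fun h3 => h1 (G2 a v h3)) (G1 a' v hv h2)

end Completeness

end MMST

/-! ### The number of branching vertices of a monotone tree -/

namespace MMST

theorem inner_plane (x y : Plane) : inner ℝ x y = x 0 * y 0 + x 1 * y 1 := by
  simp only [PiLp.inner_apply, Fin.sum_univ_two, RCLike.inner_apply, conj_trivial]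
  ring

/-- The lines orthogonal to `k` directions divide the plane into at most `2 * k` open sectors. With
respect to the basis of `d 0` and a vector orthogonal to it, a vector is described by the sign of
its first coordinate and by the ratio `t` of the coordinates, and the lines that are passed when
`t` grows from `-∞` form a set that is determined by its number of elements. -/
theorem card_sectors_le {ι : Type*} {k : ℕ} (hk : 0 < k) (d : Fin k → Plane) (hd : ∀ i, d i ≠ 0)
    (X : Finset ι) (x : ι → Plane) (hx : ∀ a ∈ X, ∀ i, inner ℝ (d i) (x a) ≠ 0)
    (hinj : ∀ a ∈ X, ∀ b ∈ X,
      (∀ i, 0 < inner ℝ (d i) (x a) ↔ 0 < inner ℝ (d i) (x b)) → a = b) :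
    X.card ≤ 2 * k := by
  classical
  set i₀ : Fin k := ⟨0, hk⟩
  set N : ℝ := d i₀ 0 * d i₀ 0 + d i₀ 1 * d i₀ 1 with hN
  have hN0 : N ≠ 0 := by
    intro h0
    apply hd i₀
    have h1 : d i₀ 0 = 0 := by nlinarith [mul_self_nonneg (d i₀ 0), mul_self_nonneg (d i₀ 1)]
    have h2 : d i₀ 1 = 0 := by nlinarith [mul_self_nonneg (d i₀ 0), mul_self_nonneg (d i₀ 1)]
    ext i
    fin_cases i <;> simp [h1, h2]
  set f : ι → ℝ := fun a => inner ℝ (d i₀) (x a) with hf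
  set t : ι → ℝ := fun a => (d i₀ 0 * x a 1 - d i₀ 1 * x a 0) / f a with ht
  set α : Fin k → ℝ := fun i => (d i 0 * d i₀ 0 + d i 1 * d i₀ 1) / N with hα
  set β : Fin k → ℝ := fun i => (d i 1 * d i₀ 0 - d i 0 * d i₀ 1) / N with hβ
  have hval : ∀ a ∈ X, ∀ i, inner ℝ (d i) (x a) = f a * (α i + β i * t a) := by
    intro a ha i
    have hfa : f a ≠ 0 := hx a ha i₀
    have : f a * (α i + β i * t a) = α i * f a + β i * (d i₀ 0 * x a 1 - d i₀ 1 * x a 0) := by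
      simp only [ht]; field_simp
    rw [this]
    simp only [hα, hβ, hf, inner_plane]
    field_simp
    rw [hN]
    ring
  set U : ι → Finset (Fin k) := fun a => Finset.univ.filter fun i => 0 < β i * (α i + β i * t a)
    with hU
  have hUmono : ∀ a b, t a ≤ t b → U a ⊆ U b := by
    intro a b hab i
    simp only [hU, Finset.mem_filter, Finset.mem_univ, true_and]
    intro h
    nlinarith [mul_le_mul_of_nonneg_left hab (mul_self_nonneg (β i))]
  have hUcard : ∀ a, (U a).card < k := by
    intro a
    have h0 : i₀ ∉ U a := by simp [hU, hβ, mul_comm]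
    have := Finset.card_lt_univ_of_notMem h0
    simpa using this
  have hcard : X.card ≤ ((Finset.univ : Finset Bool) ×ˢ Finset.range k).card := by
    refine Finset.card_le_card_of_injOn (fun a => (decide (0 < f a), (U a).card)) ?_ ?_
    · intro a _
      simpa [hUcard a] using lt_or_ge 0 (f a)
    · intro a ha b hb hab
      simp only [Prod.mk.injEq, decide_eq_decide] at hab
      obtain ⟨h1, h2⟩ := hab
      have hUab : U a = U b := by
        rcases le_total (t a) (t b) with h | h
        · exact Finset.eq_of_subset_of_card_le (hUmono a b h) h2.ge
        · exact (Finset.eq_of_subset_of_card_le (hUmono b a h) h2.le).symm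
      refine hinj a ha b hb fun i => ?_
      have hxa := hx a ha i
      have hxb := hx b hb i
      rw [hval a ha i] at hxa ⊢
      rw [hval b hb i] at hxb ⊢
      have hfa : f a ≠ 0 := left_ne_zero_of_mul hxa
      have hfb : f b ≠ 0 := left_ne_zero_of_mul hxb
      have hA := right_ne_zero_of_mul hxa
      have hB := right_ne_zero_of_mul hxb
      have hAB : 0 < α i + β i * t a ↔ 0 < α i + β i * t b := by
        by_cases hβi : β i = 0
        · simp [hβi]
        have hmem : 0 < β i * (α i + β i * t a) ↔ 0 < β i * (α i + β i * t b) := by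
          have := congrArg (i ∈ ·) hUab
          simpa [hU] using this
        rcases lt_or_gt_of_ne hβi with hneg | hpos
        · rw [← not_iff_not, not_lt, not_lt]
          have e1 : ∀ y : ℝ, y ≠ 0 → (y ≤ 0 ↔ 0 < β i * y) := fun y hy =>
            ⟨fun h => mul_pos_of_neg_of_neg hneg (lt_of_le_of_ne h hy),
              fun h => (neg_of_mul_pos_right h hneg.le).le⟩
          rw [e1 _ hA, e1 _ hB, hmem]
        · have e1 : ∀ y : ℝ, 0 < y ↔ 0 < β i * y := fun y => (mul_pos_iff_of_pos_left hpos).symm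
          rw [e1, e1 (α i + β i * t b), hmem]
      have e2 : ∀ y z : ℝ, y ≠ 0 → z ≠ 0 → (0 < y * z ↔ (0 < y ↔ 0 < z)) := by
        intro y z hy hz
        rcases lt_or_gt_of_ne hy with h | h <;> rcases lt_or_gt_of_ne hz with h' | h' <;>
          simp [mul_pos_iff, h, h', h.not_gt, h'.not_gt]
      rw [e2 _ _ hfa hA, e2 _ _ hfb hB, h1, hAB]
  simpa using hcard

/-- In a tree with at least two vertices, the vertices of degree at least `3` are outnumbered by the
leaves by at least two. -/
theorem card_branching_add_two_le {V : Type*} [Fintype V] [DecidableEq V] [Nontrivial V]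
    {T : SimpleGraph V} [DecidableRel T.Adj] (hT : T.IsTree) :
    (Finset.univ.filter fun v => 3 ≤ T.degree v).card + 2 ≤
      (Finset.univ.filter fun v => T.degree v = 1).card := by
  have h1 := T.sum_degrees_eq_twice_card_edges
  have h2 := hT.card_edgeFinset
  have hpos : ∀ v, 0 < T.degree v := fun v => hT.1.preconnected.degree_pos_of_nontrivial v
  have h3 : ∑ v : V, (2 + (if 3 ≤ T.degree v then 1 else 0)) ≤
      ∑ v : V, (T.degree v + (if T.degree v = 1 then 1 else 0)) := by
    refine Finset.sum_le_sum fun v _ => ?_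
    have := hpos v
    split_ifs <;> omega
  rw [Finset.sum_add_distrib, Finset.sum_add_distrib, ← Finset.card_filter,
    ← Finset.card_filter] at h3
  simp only [Finset.sum_const, Finset.card_univ, smul_eq_mul] at h3
  omega

namespace Instance

variable (I : Instance)

/-- The root of the trees, the first point. -/
def root : Fin I.n := ⟨0, I.n_pos⟩

/-- The given directions, followed by their opposites, and then by zeros. -/
noncomputable def signedDir (j : ℕ) : Plane :=
  if h : j < I.k then I.dir ⟨j, h⟩ else if h : j - I.k < I.k then - I.dir ⟨j - I.k, h⟩ else 0

/-- The position of a point in direction `j`. -/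
noncomputable def key (j : ℕ) (v : Fin I.n) : ℝ := inner ℝ (I.signedDir j) (I.pt v)

variable {I}

theorem key_of_lt {j : ℕ} (h : j < I.k) (v : Fin I.n) :
    I.key j v = inner ℝ (I.dir ⟨j, h⟩) (I.pt v) := by
  simp [key, signedDir, h]

theorem key_add {j : ℕ} (h : j < I.k) (v : Fin I.n) : I.key (I.k + j) v = - I.key j v := by
  simp [key, signedDir, h, inner_neg_left]

theorem key_of_le {j : ℕ} (h : 2 * I.k ≤ j) (v : Fin I.n) : I.key j v = 0 := by
  have h1 : ¬ j < I.k := by omega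
  have h2 : ¬ j - I.k < I.k := by omega
  simp [key, signedDir, h1, h2]

theorem isMonotonePath_iff (l : List (Fin I.n)) :
    (∃ d ∈ I.directions, IsMonotonePath d (l.map I.pt)) ↔
      ∃ j < 2 * I.k, l.Pairwise (fun x y => I.key j x < I.key j y) := by
  simp only [directions, Set.exists_range_iff, IsMonotonePath, List.pairwise_map]
  constructor
  · rintro ⟨i, h | h⟩
    · refine ⟨i, by omega, ?_⟩
      simpa only [key_of_lt i.2] using h
    · refine ⟨I.k + i, by omega, ?_⟩
      simpa only [key_add i.2, key_of_lt i.2, neg_lt_neg_iff] using h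
  · rintro ⟨j, hj, h⟩
    by_cases hjk : j < I.k
    · refine ⟨⟨j, hjk⟩, Or.inl ?_⟩
      simpa only [key_of_lt hjk] using h
    · obtain ⟨i, rfl⟩ := Nat.exists_eq_add_of_le (not_lt.1 hjk)
      have hi : i < I.k := by omega
      refine ⟨⟨i, hi⟩, Or.inr ?_⟩
      simpa only [key_add hi, key_of_lt hi, neg_lt_neg_iff] using h

variable {T : SimpleGraph (Fin I.n)}

theorem exists_key (hT : IsMonotoneSpanningTree I.directions I.pt T) (u v : Fin I.n) :
    ∃ j < 2 * I.k, ∀ w : T.Walk u v, w.IsPath →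
      w.support.Pairwise (fun x y => I.key j x < I.key j y) := by
  by_cases huv : u = v
  · subst huv
    refine ⟨0, by have := I.k_pos; omega, fun w hw => ?_⟩
    rw [(SimpleGraph.Walk.isPath_iff_nil.1 hw).eq_nil]
    simp
  · obtain ⟨w, hw, hu⟩ := hT.1.existsUnique_path u v
    obtain ⟨j, hj, h⟩ := (isMonotonePath_iff _).1 (hT.2 u v w huv hw)
    refine ⟨j, hj, fun w' hw' => ?_⟩
    rw [hu w' hw']
    exact h

theorem key_ne {j : ℕ} (h : j < I.k) {u v : Fin I.n} (huv : u ≠ v) : I.key j u ≠ I.key j v := by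
  rw [key_of_lt h, key_of_lt h]
  exact I.general_position _ _ ⟨u, rfl⟩ _ ⟨v, rfl⟩ fun h' => huv (I.pt_injective h')

/-- A monotone tree has at most `2 * k` leaves, since the edges at two leaves, directed away from
the leaves, lie in different sectors. -/
theorem card_leaves_le [DecidableRel T.Adj]
    (hT : IsMonotoneSpanningTree I.directions I.pt T) :
    (Finset.univ.filter fun v => T.degree v = 1).card ≤ 2 * I.k := by
  have hnb : ∀ v, ∃ u, T.degree v = 1 → ∀ x, T.Adj v x ↔ x = u := by
    intro v
    by_cases hv : T.degree v = 1
    · obtain ⟨u, hu⟩ := Finset.card_eq_one.1 hv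
      refine ⟨u, fun _ x => ?_⟩
      rw [← SimpleGraph.mem_neighborFinset, hu, Finset.mem_singleton]
    · exact ⟨v, fun h => absurd h hv⟩
  choose nb hnb using hnb
  have hdir0 : ∀ i, I.dir i ≠ 0 := fun i h => by
    have := I.dir_norm i
    simp [h] at this
  have hsub : ∀ i v, inner ℝ (I.dir i) (I.pt (nb v) - I.pt v) = I.key i (nb v) - I.key i v := by
    intro i v
    rw [inner_sub_right, key_of_lt i.2, key_of_lt i.2]
  refine card_sectors_le I.k_pos I.dir hdir0 _ (fun v => I.pt (nb v) - I.pt v) ?_ ?_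
  · intro v hv i
    rw [Finset.mem_filter] at hv
    rw [hsub, sub_ne_zero]
    exact key_ne i.2 ((hnb v hv.2 (nb v)).2 rfl).ne'
  · intro u hu v hv hsame
    rw [Finset.mem_filter] at hu hv
    by_contra huv
    obtain ⟨w, hw, _⟩ := hT.1.existsUnique_path u v
    obtain ⟨j, hj, h⟩ := exists_key hT u v
    have hdart := darts_of_pairwise_support w (h w hw)
    -- the first edge of the path from `u` to `v` and the last one
    obtain ⟨d, hd, h1, h2⟩ := w.exists_boundary_dart {u} rfl (by simpa using Ne.symm huv)
    obtain ⟨d', hd', h1', h2'⟩ := w.exists_boundary_dart {x | x ≠ v} huv (by simp)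
    have h1 : d.fst = u := h1
    have h2' : d'.snd = v := by simpa using h2'
    have e1 : d.snd = nb u := (hnb u hu.2 _).1 (h1 ▸ d.adj)
    have e2 : d'.fst = nb v := (hnb v hv.2 _).1 (h2' ▸ d'.adj.symm)
    have l1 := hdart d hd
    have l2 := hdart d' hd'
    rw [h1, e1] at l1
    rw [h2', e2] at l2
    by_cases hjk : j < I.k
    · have := hsame ⟨j, hjk⟩
      rw [hsub, hsub, sub_pos, sub_pos] at this
      exact absurd (this.1 l1) l2.not_gt
    · obtain ⟨i, rfl⟩ := Nat.exists_eq_add_of_le (not_lt.1 hjk)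
      have hi : i < I.k := by omega
      rw [key_add hi, key_add hi, neg_lt_neg_iff] at l1 l2
      have := hsame ⟨i, hi⟩
      rw [hsub, hsub, sub_pos, sub_pos] at this
      exact absurd (this.2 l2) l1.not_gt

theorem card_branching_le [DecidableRel T.Adj]
    (hT : IsMonotoneSpanningTree I.directions I.pt T) :
    (Finset.univ.filter fun v => 3 ≤ T.degree v).card ≤ 2 * I.k - 2 := by
  rcases subsingleton_or_nontrivial (Fin I.n) with h | h
  · rw [Finset.filter_false_of_mem]
    · simp
    · intro v _
      have := T.degree_lt_card_verts v
      have := Fintype.card_le_one_iff_subsingleton.2 h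
      omega
  · have h1 := card_branching_add_two_le hT.1
    have h2 := card_leaves_le hT
    omega

end Instance

end MMST

/-! ### Guesses and the trees that they describe -/

namespace MMST

/-- The natural number with the binary digits `β 0, …, β (t - 1)`, most significant digit first. -/
def code (β : ℕ → ℕ) : ℕ → ℕ
  | 0 => 0
  | t + 1 => code β t + code β t + β t

theorem code_lt {β : ℕ → ℕ} (hβ : ∀ t, β t ≤ 1) (t : ℕ) : code β t < 2 ^ t := by
  induction t with
  | zero => simp [code]
  | succ t ih =>
    have := hβ t
    rw [code, pow_succ]
    omega

theorem code_inj {β β' : ℕ → ℕ} (hβ : ∀ t, β t ≤ 1) (hβ' : ∀ t, β' t ≤ 1) {T : ℕ}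
    (h : code β T = code β' T) : ∀ t < T, β t = β' t := by
  induction T with
  | zero => simp
  | succ T ih =>
    have h1 := hβ T
    have h2 := hβ' T
    rw [code, code] at h
    intro t ht
    rcases Nat.lt_succ_iff_lt_or_eq.1 ht with ht | rfl
    · exact ih (by omega) t ht
    · omega

/-- The number of signatures. The signature of a point consists of one bit for each of the
`2 * k - 1` special points and each of the `2 * k` signed directions. -/
def sigCount (k : ℕ) : ℕ := 2 ^ ((2 * k - 1) * (2 * k))

/-- Position of the table of colours in a guess, behind the special points. -/
def offF (k : ℕ) : ℕ := 2 * k - 1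

/-- Position of the table of attachments in a guess. -/
def offA (k : ℕ) : ℕ := offF k + sigCount k

/-- Position of the table of directions in a guess. -/
def offC (k : ℕ) : ℕ := offA k + sigCount k + 1

/-- The length of a guess. -/
def guessLen (k : ℕ) : ℕ := offC k + (sigCount k + 1) * (sigCount k + 1)

/-- The number of possible values of the digit at position `i` of a guess. The first special point
is always the root. -/
def radix (n k i : ℕ) : ℕ := if i = 0 then 1 else if i < offF k then n else sigCount k

theorem sigCount_pos (k : ℕ) : 0 < sigCount k := Nat.pow_pos (by norm_num)

theorem two_mul_le_sigCount {k : ℕ} (hk : 0 < k) : 2 * k ≤ sigCount k := by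
  unfold sigCount
  calc 2 * k ≤ 2 ^ (2 * k) := Nat.lt_two_pow_self.le
    _ ≤ _ := Nat.pow_le_pow_right (by norm_num) (Nat.le_mul_of_pos_left _ (by omega))

namespace Instance

variable (I : Instance)

/-- First coordinate of a point. -/
noncomputable def px (v : ℕ) : ℝ := if h : v < I.n then I.pt ⟨v, h⟩ 0 else 0

/-- Second coordinate of a point. -/
noncomputable def py (v : ℕ) : ℝ := if h : v < I.n then I.pt ⟨v, h⟩ 1 else 0

/-- The position of a point in direction `j`, computed from coordinates. -/
noncomputable def val (j v : ℕ) : ℝ := I.signedDir j 0 * I.px v + I.signedDir j 1 * I.py v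

theorem val_eq (j : ℕ) (v : Fin I.n) : I.val j v = I.key j v := by
  simp [val, key, inner_plane, px, py]

/-- A bit of the signature of `v`: whether `v` lies, in a certain signed direction, ahead of a
certain special point of the guess `g`. -/
noncomputable def sigBit (g : ℕ → ℕ) (v t : ℕ) : ℕ :=
  if I.val (t % (2 * I.k)) (g (t / (2 * I.k))) < I.val (t % (2 * I.k)) v then 1 else 0

/-- The signature of a point with respect to the special points of the guess `g`. -/
noncomputable def sig (g : ℕ → ℕ) (v : ℕ) : ℕ := code (I.sigBit g v) ((2 * I.k - 1) * (2 * I.k))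

/-- The colour of a point according to the guess `g`. -/
noncomputable def colour (g : ℕ → ℕ) (v : ℕ) : ℕ :=
  if v = 0 then 0 else 1 + g (offF I.k + I.sig g v)

/-- The colour of the chain that the chain of colour `a` is attached to. -/
def above (g : ℕ → ℕ) (a : ℕ) : ℕ :=
  if a ≤ sigCount I.k then a - 1 - g (offA I.k + a) else 0

/-- The direction of the path from the end of chain `a` to the end of chain `a'`. -/
def cert (g : ℕ → ℕ) (a a' : ℕ) : ℕ := g (offC I.k + (a * (sigCount I.k + 1) + a'))

/-- `par` is a parent function of the layout described by the guess `g`. -/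
def GuessLayout (g par : ℕ → ℕ) : Prop :=
  ∃ L : ℕ → ℕ, L 0 = 0 ∧ ∀ a, 1 ≤ a → a ≤ sigCount I.k → ∃ l : List ℕ,
    (∀ v, v ∈ l ↔ v < I.n ∧ I.colour g v = a) ∧
    l.Pairwise (fun x y => I.val (I.cert g 0 a) x ≤ I.val (I.cert g 0 a) y) ∧ l.Nodup ∧
    Linked par (L (I.above g a)) l (L a)

/-- The test of the guess `g` for the parent function `par`. -/
def GuessPasses (g par : ℕ → ℕ) : Prop :=
  ∀ a ≤ sigCount I.k, ∀ a' ≤ sigCount I.k, ∀ v < I.n, v ≠ 0 →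
    (Anc (I.above g) (I.colour g v) a → ¬ Anc (I.above g) (I.colour g v) a' →
      I.val (I.cert g a a') v < I.val (I.cert g a a') (par v)) ∧
    (¬ Anc (I.above g) (I.colour g v) a → Anc (I.above g) (I.colour g v) a' →
      I.val (I.cert g a a') (par v) < I.val (I.cert g a a') v)

/-- The parent function on points that is given by a function on indices. -/
def parent (par : ℕ → ℕ) (v : Fin I.n) : Fin I.n :=
  if v = I.root then I.root else if h : par v < I.n then ⟨par v, h⟩ else I.root

/-- The graph given by a parent function on indices. -/
def graph (par : ℕ → ℕ) : SimpleGraph (Fin I.n) := parentGraph I.root (I.parent par)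

/-- The length of the graph given by a parent function on indices. -/
noncomputable def treeLength (par : ℕ → ℕ) : ℝ :=
  ∑ i ∈ Finset.range (I.n - 1), Real.sqrt
    ((I.px (i + 1) - I.px (par (i + 1))) * (I.px (i + 1) - I.px (par (i + 1))) +
      (I.py (i + 1) - I.py (par (i + 1))) * (I.py (i + 1) - I.py (par (i + 1))))

variable {I} {g par : ℕ → ℕ}

theorem sigBit_le (v t : ℕ) : I.sigBit g v t ≤ 1 := by
  unfold sigBit; split_ifs <;> omega

theorem sig_lt (v : ℕ) : I.sig g v < sigCount I.k := code_lt (sigBit_le v) _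

theorem ne_root_iff {v : Fin I.n} : v ≠ I.root ↔ (v : ℕ) ≠ 0 := by
  rw [Ne, Fin.ext_iff]; rfl

theorem radix_of_ge {n k i : ℕ} (hk : 0 < k) (h : offF k ≤ i) : radix n k i = sigCount k := by
  have : 0 < offF k := by unfold offF; omega
  unfold radix
  rw [if_neg (by omega), if_neg (by omega)]

theorem colouring (hg : ∀ i < guessLen I.k, g i < radix I.n I.k i) :
    Colouring I.root (fun v => I.colour g v) (I.above g) (sigCount I.k) := by
  have hk := I.k_pos
  have hQ := sigCount_pos I.k
  refine ⟨by simp [root, colour], fun v hv => ?_, fun v => ?_, ?_, fun a ha => ?_⟩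
  · rw [ne_root_iff] at hv
    simp only [colour, if_neg hv]
    omega
  · simp only [colour]
    split_ifs
    · omega
    · have h1 := sig_lt (I := I) (g := g) v
      have h2 := hg (offF I.k + I.sig g v) (by unfold guessLen offC offA; omega)
      rw [radix_of_ge hk (by omega)] at h2
      omega
  · simp [above]
  · unfold above
    split_ifs <;> omega

theorem GuessLayout.lt (h : I.GuessLayout g par)
    (hg : ∀ i < guessLen I.k, g i < radix I.n I.k i) :
    ∃ L : ℕ → ℕ, L 0 = 0 ∧ (∀ a ≤ sigCount I.k, L a < I.n) ∧
      ∀ a, 1 ≤ a → a ≤ sigCount I.k → ∃ l : List ℕ,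
        (∀ v, v ∈ l ↔ v < I.n ∧ I.colour g v = a) ∧
        l.Pairwise (fun x y => I.val (I.cert g 0 a) x ≤ I.val (I.cert g 0 a) y) ∧ l.Nodup ∧
        Linked par (L (I.above g a)) l (L a) := by
  have hc := colouring hg
  obtain ⟨L, h0, hL⟩ := h
  refine ⟨L, h0, fun a => ?_, hL⟩
  induction a using Nat.strong_induction_on with
  | _ a ih =>
    intro ha
    rcases Nat.eq_zero_or_pos a with rfl | hpos
    · rw [h0]; exact I.n_pos
    · obtain ⟨l, hl, _, _, hlink⟩ := hL a hpos ha
      have hlt := hc.up_lt a hpos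
      rcases hlink.last_mem with h' | h'
      · rw [h']; exact ih _ hlt (by omega)
      · exact ((hl _).1 h').1

theorem GuessLayout.par_lt (h : I.GuessLayout g par)
    (hg : ∀ i < guessLen I.k, g i < radix I.n I.k i) {v : ℕ} (hv : v < I.n) (hv0 : v ≠ 0) :
    par v < I.n := by
  have hc := colouring hg
  obtain ⟨L, h0, hlt, hL⟩ := h.lt hg
  have hpos := hc.pos ⟨v, hv⟩ (ne_root_iff.2 hv0)
  have hle := hc.le ⟨v, hv⟩
  obtain ⟨l, hl, _, _, hlink⟩ := hL _ hpos hle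
  have hup := hc.up_lt _ hpos
  rcases hlink.par_mem ((hl v).2 ⟨hv, rfl⟩) with h' | h'
  · rw [h']; exact hlt _ (by omega)
  · exact ((hl _).1 h').1

theorem parent_val (h : ∀ v < I.n, v ≠ 0 → par v < I.n) {v : Fin I.n} (hv : v ≠ I.root) :
    (I.parent par v : ℕ) = par v := by
  unfold parent
  rw [if_neg hv, dif_pos (h v v.2 (ne_root_iff.1 hv))]

theorem parent_root : I.parent par I.root = I.root := by simp [parent]

theorem linked_of_map {V W : Type*} {f : V → V} {f' : W → W} {φ : V → W}
    (hφ : Function.Injective φ) {t z : V} {l : List V} (h : Linked f' (φ t) (l.map φ) (φ z))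
    (hf : ∀ x ∈ l, f' (φ x) = φ (f x)) : Linked f t l z := by
  induction l generalizing t with
  | nil => exact hφ h
  | cons x l ih =>
    refine ⟨hφ ?_, ih h.2 fun y hy => hf y (by simp [hy])⟩
    rw [← hf x (by simp)]
    exact h.1

theorem GuessLayout.isLayout (h : I.GuessLayout g par)
    (hg : ∀ i < guessLen I.k, g i < radix I.n I.k i) :
    IsLayout I.root (fun v => I.colour g v) (I.above g) (fun a => I.key (I.cert g 0 a))
      (sigCount I.k) (I.parent par) := by
  have hc := colouring hg
  obtain ⟨L, h0, hlt, hL⟩ := h.lt hg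
  refine ⟨fun a => if ha : L a < I.n then ⟨L a, ha⟩ else I.root, ?_, fun a ha ha' => ?_⟩
  · simp [h0, I.n_pos, root]
  · obtain ⟨l, hl, hs, hn, hlink⟩ := hL a ha ha'
    have hmem : ∀ v ∈ l, v < I.n := fun v hv => ((hl v).1 hv).1
    have hmap : (l.pmap (fun v hv => (⟨v, hv⟩ : Fin I.n)) hmem).map Fin.val = l := by
      rw [List.map_pmap]
      simp
    set l' := l.pmap (fun v hv => (⟨v, hv⟩ : Fin I.n)) hmem with hl'
    have hl2 : ∀ v : Fin I.n, v ∈ l' ↔ I.colour g v = a := by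
      intro v
      rw [← (List.mem_map_of_injective Fin.val_injective), hmap, hl]
      simp
    refine ⟨l', hl2, ?_, ?_, ?_⟩
    · rw [← hmap, List.pairwise_map] at hs
      simpa only [val_eq] using hs
    · rw [← hmap] at hn
      exact hn.of_map
    · have hup := hc.up_lt a ha
      refine linked_of_map (f' := par) (φ := Fin.val) Fin.val_injective ?_ ?_
      · dsimp only
        rw [hmap, dif_pos (hlt _ (by omega)), dif_pos (hlt a ha')]
        exact hlink
      · intro x hx
        refine (parent_val (fun v hv hv0 => h.par_lt hg hv hv0) ?_).symm
        rintro rfl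
        rw [hl2] at hx
        simp [colour, root] at hx
        omega

theorem passes_iff (h : ∀ v < I.n, v ≠ 0 → par v < I.n) :
    I.GuessPasses g par ↔ Passes I.root (fun v => I.colour g v) (I.above g)
      (fun a a' => I.key (I.cert g a a')) (sigCount I.k) (I.parent par) := by
  have hval : ∀ j (v : Fin I.n), v ≠ I.root → I.key j (I.parent par v) = I.val j (par v) := by
    intro j v hv
    rw [← val_eq, parent_val h hv]
  constructor
  · intro hp a ha a' ha' v hv
    dsimp only
    rw [hval _ v hv, ← val_eq]
    exact hp a ha a' ha' v v.2 (ne_root_iff.1 hv)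
  · intro hp a ha a' ha' v hv hv0
    have hv0' : (⟨v, hv⟩ : Fin I.n) ≠ I.root := ne_root_iff.2 hv0
    have := hp a ha a' ha' ⟨v, hv⟩ hv0'
    dsimp only at this
    rw [hval _ _ hv0', ← val_eq] at this
    exact this

/-- A guess that passes the test describes a monotone spanning tree. -/
theorem GuessLayout.isMonotoneSpanningTree (h : I.GuessLayout g par)
    (hg : ∀ i < guessLen I.k, g i < radix I.n I.k i) (hp : I.GuessPasses g par) :
    IsMonotoneSpanningTree I.directions I.pt (I.graph par) := by
  have hlay := h.isLayout hg
  have hc := colouring hg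
  refine ⟨(hlay.rooted hc parent_root).isTree, fun u v w huv hw => ?_⟩
  rw [passes_iff fun v hv hv0 => h.par_lt hg hv hv0] at hp
  obtain ⟨a, _, a', _, hmono⟩ := hlay.monotone hc parent_root hp w hw
  rw [isMonotonePath_iff]
  refine ⟨I.cert g a a', ?_, hmono⟩
  -- for the other values of the guess the key is constant
  by_contra hj
  obtain ⟨d, hd, _, _⟩ := w.exists_boundary_dart {u} rfl (by simpa using huv.symm)
  have := darts_of_pairwise_support w hmono d hd
  rw [key_of_le (not_lt.1 hj), key_of_le (not_lt.1 hj)] at this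
  exact lt_irrefl _ this

theorem GuessLayout.rooted (h : I.GuessLayout g par)
    (hg : ∀ i < guessLen I.k, g i < radix I.n I.k i) : Rooted I.root (I.parent par) :=
  (h.isLayout hg).rooted (colouring hg) parent_root

/-- The points of a monotone tree that have the same signature with respect to the special points
are joined by a path without special points: otherwise, the path between them passes some special
point, and lies behind it before and ahead of it after, in a direction in which it is monotone. -/
theorem exists_walk_of_sig_eq {T : SimpleGraph (Fin I.n)}
    (hT : IsMonotoneSpanningTree I.directions I.pt T) {b : ℕ → Fin I.n} {p q : Fin I.n}
    (hpq : ∀ i < 2 * I.k - 1, ∀ j < 2 * I.k,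
      (I.key j (b i) < I.key j p ↔ I.key j (b i) < I.key j q)) :
    p = q ∨ ∃ w : T.Walk p q, ∀ x ∈ w.support, ∀ i < 2 * I.k - 1, b i ≠ x := by
  by_cases hne : p = q
  · exact Or.inl hne
  right
  obtain ⟨w, hw, _⟩ := hT.1.existsUnique_path p q
  refine ⟨w, fun x hx i hi hbx => ?_⟩
  have aux : ∀ p q : Fin I.n, (∀ j < 2 * I.k,
      (I.key j (b i) < I.key j p ↔ I.key j (b i) < I.key j q)) → ∀ w : T.Walk p q, w.IsPath →
      x ∈ w.support → x ≠ p → False := by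
    intro p q hpq w hw hx hxp
    obtain ⟨j, hj, h⟩ := exists_key hT q p
    have h1 := h w.reverse hw.reverse
    have h2 := pairwise_support_of_darts w.reverse (darts_of_pairwise_support _ h1)
    have hx' : x ∈ w.reverse.support := by simpa using hx
    have h3 : I.key j q ≤ I.key j x := h2.2 x hx'
    have h4 : I.key j x < I.key j p := by
      have h5 := pairwise_support_of_darts (w.reverse.dropUntil x hx')
        (f := I.key j) fun d hd => darts_of_pairwise_support _ h1 d
          ((w.reverse.darts_dropUntil_suffix_darts hx').subset hd)
      have h6 := h5.1
      rw [← SimpleGraph.Walk.cons_tail_support, List.pairwise_cons] at h6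
      have h7 : p ∈ (w.reverse.dropUntil x hx').support := SimpleGraph.Walk.end_mem_support _
      rw [← SimpleGraph.Walk.cons_tail_support, List.mem_cons] at h7
      exact h6.1 p (h7.resolve_left (Ne.symm hxp))
    have h8 := hpq j hj
    rw [hbx] at h8
    exact absurd (h8.1 h4) h3.not_gt
  by_cases hxp : x = p
  · exact aux q p (fun j hj => (hpq i hi j hj).symm) w.reverse hw.reverse (by simpa using hx)
      (hxp ▸ hne)
  · exact aux p q (fun j hj => hpq i hi j hj) w hw hx hxp

theorem exists_enumeration {V : Type*} (s : Finset V) (r : V) {m : ℕ} (hs : s.card ≤ m) :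
    ∃ b : ℕ → V, b 0 = r ∧ (∀ x ∈ s, ∃ i < m + 1, b i = x) ∧ ∀ i, b i = r ∨ b i ∈ s := by
  classical
  refine ⟨fun i => if h : i - 1 < s.card ∧ i ≠ 0 then s.equivFin.symm ⟨i - 1, h.1⟩ else r, by simp,
    fun x hx => ?_, fun i => ?_⟩
  · have h1 := (s.equivFin ⟨x, hx⟩).2
    refine ⟨s.equivFin ⟨x, hx⟩ + 1, by omega, ?_⟩
    have h2 : (s.equivFin ⟨x, hx⟩ : ℕ) + 1 - 1 < s.card ∧ (s.equivFin ⟨x, hx⟩ : ℕ) + 1 ≠ 0 :=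
      ⟨by omega, by omega⟩
    dsimp only
    rw [dif_pos h2]
    simp
  · by_cases h : i - 1 < s.card ∧ i ≠ 0
    · right; simp [h]
    · left; simp only [dif_neg h]

theorem Rooted.special {T : SimpleGraph (Fin I.n)} [DecidableRel T.Adj]
    {par : Fin I.n → Fin I.n} (hR : Rooted I.root par) (hpar : parentGraph I.root par = T)
    {Sp : Set (Fin I.n)} (hr : I.root ∈ Sp) (hdeg : ∀ x, 3 ≤ T.degree x → x ∈ Sp) :
    Special I.root par Sp := by
  refine ⟨hR, hr, fun x hx p q hp hq hpx hqx => ?_⟩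
  by_contra hpq
  apply hx
  apply hdeg
  have hxr : x ≠ I.root := fun h => hx (h ▸ hr)
  have e1 := hR.depth_par hp
  have e2 := hR.depth_par hq
  have e3 := hR.depth_par hxr
  rw [hpx] at e1
  rw [hqx] at e2
  have hcard : ({p, q, par x} : Finset (Fin I.n)).card = 3 := by
    rw [Finset.card_eq_three]
    refine ⟨p, q, par x, hpq, ?_, ?_, rfl⟩
    · rintro rfl; omega
    · rintro rfl; omega
  rw [← hcard, ← SimpleGraph.card_neighborFinset_eq_degree]
  refine Finset.card_le_card fun y hy => ?_
  rw [SimpleGraph.mem_neighborFinset, ← hpar, hR.adj_iff]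
  simp only [Finset.mem_insert, Finset.mem_singleton] at hy
  rcases hy with rfl | rfl | rfl
  · exact Or.inr ⟨hp, hpx⟩
  · exact Or.inr ⟨hq, hqx⟩
  · exact Or.inl ⟨hxr, rfl⟩

/-- Every monotone spanning tree is described by some guess. -/
theorem exists_guess {T : SimpleGraph (Fin I.n)}
    (hT : IsMonotoneSpanningTree I.directions I.pt T) :
    ∃ g : ℕ → ℕ, (∀ i < guessLen I.k, g i < radix I.n I.k i) ∧ (∀ i, guessLen I.k ≤ i → g i = 0) ∧
      ∀ par, I.GuessLayout g par → I.GuessPasses g par ∧ I.graph par = T := by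
  classical
  have hk := I.k_pos
  have hn := I.n_pos
  have hQ := sigCount_pos I.k
  have hkQ := two_mul_le_sigCount hk
  obtain ⟨tp, hR, htp⟩ := exists_rooted hT.1 I.root
  obtain ⟨b, hb0, hb1, -⟩ := exists_enumeration
    (Finset.univ.filter fun v => 3 ≤ T.degree v) I.root (card_branching_le hT)
  set Sp : Set (Fin I.n) := {x | ∃ i < 2 * I.k - 1, b i = x} with hSp
  have hSpec : Special I.root tp Sp := by
    refine Rooted.special hR htp ⟨0, by omega, hb0⟩ fun x hx => ?_
    obtain ⟨i, hi, hix⟩ := hb1 x (by simpa using hx)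
    exact ⟨i, by omega, hix⟩
  set S : Fin I.n → ℕ := fun v => I.sig (fun i => b i) v with hS
  have hsig : ∀ p q, S p = S q → p = q ∨
      ∃ w : (parentGraph I.root tp).Walk p q, ∀ x ∈ w.support, x ∉ Sp := by
    intro p q hpq
    rw [htp]
    have hbit := code_inj (sigBit_le _) (sigBit_le _) hpq
    have hpq' : ∀ i < 2 * I.k - 1, ∀ j < 2 * I.k,
        (I.key j (b i) < I.key j p ↔ I.key j (b i) < I.key j q) := by
      intro i hi j hj
      have h1 : (i * (2 * I.k) + j) % (2 * I.k) = j := by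
        rw [mul_comm, Nat.mul_add_mod, Nat.mod_eq_of_lt hj]
      have h2 : (i * (2 * I.k) + j) / (2 * I.k) = i := by
        rw [mul_comm, Nat.mul_add_div (by omega), Nat.div_eq_of_lt hj, add_zero]
      have h3 := hbit (i * (2 * I.k) + j) (by
        calc i * (2 * I.k) + j < (i + 1) * (2 * I.k) := by rw [Nat.add_mul i 1]; omega
          _ ≤ _ := Nat.mul_le_mul_right _ (by omega))
      simp only [sigBit, h1, h2, val_eq] at h3
      by_cases c1 : I.key j (b i) < I.key j p <;> by_cases c2 : I.key j (b i) < I.key j q <;>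
        simp [c1, c2] at h3 ⊢
    rcases exists_walk_of_sig_eq hT hpq' with h | ⟨w, hw⟩
    · exact Or.inl h
    · refine Or.inr ⟨w, fun x hx => ?_⟩
      rintro ⟨i, hi, hix⟩
      exact hw x hx i hi hix
  obtain ⟨F, up, cert, hF, hup0, huplt, hupbig, hcert, hmain⟩ := hSpec.exists_colouring
    (Q := sigCount I.k) (J := 2 * I.k) (fun v => sig_lt _) hsig (κ := I.key)
    (by rw [htp]; exact exists_key hT)
  -- the digits of the guess
  set Q := sigCount I.k with hQdef
  set g : ℕ → ℕ := fun i =>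
    if i < offF I.k then (b i : ℕ)
    else if i < offA I.k then F (i - offF I.k)
    else if i < offC I.k then (i - offA I.k) - 1 - up (i - offA I.k)
    else if i < guessLen I.k then cert ((i - offC I.k) / (Q + 1)) ((i - offC I.k) % (Q + 1))
    else 0 with hg
  have hgb : ∀ i < offF I.k, g i = b i := fun i hi => by simp only [hg, if_pos hi]
  have hgF : ∀ s < Q, g (offF I.k + s) = F s := by
    intro s hs
    have h1 : ¬ offF I.k + s < offF I.k := by omega
    have h2 : offF I.k + s < offA I.k := by unfold offA; omega
    simp only [hg, if_neg h1, if_pos h2, Nat.add_sub_cancel_left]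
  have hgA : ∀ a ≤ Q, g (offA I.k + a) = a - 1 - up a := by
    intro a ha
    have h1 : ¬ offA I.k + a < offF I.k := by unfold offA; omega
    have h2 : ¬ offA I.k + a < offA I.k := by omega
    have h3 : offA I.k + a < offC I.k := by unfold offC; omega
    simp only [hg, if_neg h1, if_neg h2, if_pos h3, Nat.add_sub_cancel_left]
  have hgC : ∀ i < (Q + 1) * (Q + 1), g (offC I.k + i) = cert (i / (Q + 1)) (i % (Q + 1)) := by
    intro i hi
    have h4 : offC I.k + i < guessLen I.k := by rw [guessLen, ← hQdef]; omega
    have h1 : ¬ offC I.k + i < offF I.k := by unfold offC offA; omega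
    have h2 : ¬ offC I.k + i < offA I.k := by unfold offC; omega
    have h3 : ¬ offC I.k + i < offC I.k := by omega
    simp only [hg, if_neg h1, if_neg h2, if_neg h3, if_pos h4, Nat.add_sub_cancel_left]
  have hzero : ∀ i, guessLen I.k ≤ i → g i = 0 := by
    intro i hi
    have h3 : ¬ i < offC I.k := by unfold guessLen at hi; omega
    have h2 : ¬ i < offA I.k := by unfold offC at h3; omega
    have h1 : ¬ i < offF I.k := by unfold offA at h2; omega
    simp only [hg, if_neg h1, if_neg h2, if_neg h3, if_neg (not_lt.2 hi)]
  have hrange : ∀ i < guessLen I.k, g i < radix I.n I.k i := by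
    intro i hi
    by_cases h1 : i < offF I.k
    · rw [hgb i h1, radix, if_pos h1]
      split_ifs with h0
      · rw [h0, hb0]; simp [root]
      · exact (b i).2
    rw [radix_of_ge hk (not_lt.1 h1)]
    by_cases h2 : i < offA I.k
    · simp only [hg, if_neg h1, if_pos h2]; exact hF _
    by_cases h3 : i < offC I.k
    · simp only [hg, if_neg h1, if_neg h2, if_pos h3]
      unfold offC at h3
      omega
    · simp only [hg, if_neg h1, if_neg h2, if_neg h3, if_pos hi]
      exact (hcert _ _).trans_le hkQ
  have habove : I.above g = up := by
    funext a
    unfold above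
    split_ifs with ha
    · rw [hgA a ha]
      rcases Nat.eq_zero_or_pos a with rfl | hpos
      · simp [hup0]
      · have := huplt a hpos; omega
    · exact (hupbig a (by omega)).symm
  have hcertg : ∀ a ≤ Q, ∀ a' ≤ Q, I.cert g a a' = cert a a' := by
    intro a ha a' ha'
    have h1 : (a * (Q + 1) + a') % (Q + 1) = a' := by
      rw [mul_comm, Nat.mul_add_mod, Nat.mod_eq_of_lt (by omega)]
    have h2 : (a * (Q + 1) + a') / (Q + 1) = a := by
      rw [mul_comm, Nat.mul_add_div (by omega), Nat.div_eq_of_lt (by omega), add_zero]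
    unfold Instance.cert
    rw [← hQdef, hgC _ (by
      calc a * (Q + 1) + a' < (a + 1) * (Q + 1) := by rw [Nat.add_mul a 1]; omega
        _ ≤ _ := Nat.mul_le_mul_right _ (by omega)), h1, h2]
  have hsigg : ∀ v : Fin I.n, I.sig g v = S v := by
    intro v
    simp only [hS, sig]
    have hcongr : ∀ T ≤ (2 * I.k - 1) * (2 * I.k),
        code (I.sigBit g v) T = code (I.sigBit (fun i => b i) v) T := by
      intro T
      induction T with
      | zero => intro _; rfl
      | succ T ih =>
        intro hT'
        have h1 : T / (2 * I.k) < offF I.k := by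
          rw [Nat.div_lt_iff_lt_mul (by omega)]
          unfold offF
          omega
        rw [code, code, ih (by omega)]
        simp only [sigBit, hgb _ h1]
    exact hcongr _ le_rfl
  refine ⟨g, hrange, hzero, fun par hlay => ?_⟩
  have hlay' := hlay.isLayout hrange
  obtain ⟨hp1, hp2⟩ := hmain (fun v => I.colour g v) (by simp [colour, root])
    (fun v hv => by
      simp only [colour, if_neg (ne_root_iff.1 hv)]
      rw [hsigg, hgF _ (sig_lt _)])
    (I.parent par) (by
      rw [habove] at hlay'
      obtain ⟨L, hL0, hL⟩ := hlay'
      refine ⟨L, hL0, fun a ha ha' => ?_⟩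
      have := hL a ha ha'
      dsimp only at this ⊢
      rwa [hcertg 0 (by omega) a ha'] at this)
  have hpar : I.parent par = tp := by
    funext v
    by_cases hv : v = I.root
    · rw [hv, parent_root, hR.root]
    · exact hp1 v hv
  refine ⟨?_, ?_⟩
  · rw [passes_iff fun v hv hv0 => hlay.par_lt hrange hv hv0, hpar, habove]
    intro a ha a' ha' v hv
    dsimp only
    rw [hcertg a ha a' ha']
    exact hp2 a ha a' ha' v hv
  · rw [graph, hpar, htp]

end Instance

end MMST

/-! ### Lengths, the output, and the existence of a monotone tree -/

namespace MMST

namespace Instance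

variable {I : Instance} {g par : ℕ → ℕ}

theorem length_parentGraph {V : Type*} [Fintype V] [DecidableEq V] {r : V} {par : V → V}
    (hR : Rooted r par) (p : V → Plane) :
    length p (parentGraph r par) = ∑ v ∈ Finset.univ.filter (· ≠ r), dist (p v) (p (par v)) := by
  classical
  have hE : (parentGraph r par).edgeFinset =
      (Finset.univ.filter (· ≠ r)).image fun v => s(v, par v) := by
    ext e
    rw [SimpleGraph.mem_edgeFinset, hR.edgeSet_eq]
    simp
  have hinj : Set.InjOn (fun v => s(v, par v)) (Finset.univ.filter (· ≠ r) : Finset V) := by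
    intro u hu v hv huv
    exact hR.injOn_edge (by simpa using hu) (by simpa using hv) huv
  have h1 : length p (parentGraph r par) = ∑ e ∈ (parentGraph r par).edgeFinset,
      Sym2.lift ⟨fun u v => dist (p u) (p v), fun _ _ => dist_comm _ _⟩ e := by
    unfold length
    congr!
  rw [h1, hE, Finset.sum_image hinj]
  rfl

theorem length_graph (hlt : ∀ v < I.n, v ≠ 0 → par v < I.n) (hR : Rooted I.root (I.parent par)) :
    length I.pt (I.graph par) = I.treeLength par := by
  rw [graph, length_parentGraph hR, treeLength]
  refine Finset.sum_bij (fun v _ => (v : ℕ) - 1) ?_ ?_ ?_ ?_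
  · intro v hv
    have h1 := ne_root_iff.1 (Finset.mem_filter.1 hv).2
    have h2 := v.2
    rw [Finset.mem_range]
    omega
  · intro u hu v hv huv
    have h1 := ne_root_iff.1 (Finset.mem_filter.1 hu).2
    have h2 := ne_root_iff.1 (Finset.mem_filter.1 hv).2
    ext
    omega
  · intro i hi
    rw [Finset.mem_range] at hi
    exact ⟨⟨i + 1, by omega⟩, by simp [ne_root_iff], by simp⟩
  · intro v hv
    have h1 := (Finset.mem_filter.1 hv).2
    have h2 := parent_val hlt h1
    have h3 : (v : ℕ) - 1 + 1 = v := by have := ne_root_iff.1 h1; omega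
    have hp : par v < I.n := hlt v v.2 (ne_root_iff.1 h1)
    have h4 : I.parent par v = ⟨par v, hp⟩ := Fin.ext h2
    rw [h3, h4, EuclideanSpace.dist_eq, Fin.sum_univ_two, Real.dist_eq, Real.dist_eq, sq_abs,
      sq_abs]
    simp [px, py, hp, pow_two]

theorem outputGraph_eq {σ : RealRAM.State} (hlt : ∀ v < I.n, v ≠ 0 → par v < I.n)
    (h1 : ∀ i < I.n - 1, σ.nats 1 i = i + 1) (h2 : ∀ i < I.n - 1, σ.nats 2 i = par (i + 1)) :
    outputGraph I.n σ = I.graph par := by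
  have key : ∀ u v : Fin I.n, (∃ i < I.n - 1, σ.nats 1 i = u ∧ σ.nats 2 i = v) ↔
      (u ≠ I.root ∧ I.parent par u = v) := by
    intro u v
    constructor
    · rintro ⟨i, hi, hu, hv⟩
      rw [h1 i hi] at hu
      rw [h2 i hi, hu] at hv
      have hur : u ≠ I.root := ne_root_iff.2 (by omega)
      exact ⟨hur, Fin.ext ((parent_val hlt hur).trans hv)⟩
    · rintro ⟨hu, rfl⟩
      have h3 := ne_root_iff.1 hu
      have h4 := u.2
      have h5 : (u : ℕ) - 1 + 1 = u := by omega
      refine ⟨u - 1, by omega, ?_, ?_⟩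
      · rw [h1 _ (by omega), h5]
      · rw [h2 _ (by omega), h5, parent_val hlt hu]
  simp only [outputGraph, graph, parentGraph, key]

/-- The path through all points in their order in one of the directions is a monotone tree. -/
theorem exists_monotone (I : Instance) :
    ∃ T, IsMonotoneSpanningTree I.directions I.pt T := by
  classical
  set f : Fin I.n → ℝ := I.key 0 with hf
  have hk := I.k_pos
  have finj : ∀ u v, f u = f v → u = v := by
    intro u v huv
    by_contra h
    exact key_ne hk h huv
  have hne : (Finset.univ : Finset (Fin I.n)).Nonempty := ⟨I.root, Finset.mem_univ _⟩
  obtain ⟨r, -, hr⟩ := Finset.exists_min_image Finset.univ f hne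
  have hpred : ∀ v, ∃ u, (v = r → u = r) ∧ (v ≠ r → f u < f v ∧ ∀ x, f x < f v → f x ≤ f u) := by
    intro v
    by_cases hv : v = r
    · exact ⟨r, fun _ => rfl, fun h => absurd hv h⟩
    · have hlt : f r < f v :=
        lt_of_le_of_ne (hr v (Finset.mem_univ _)) fun h => hv (finj _ _ h).symm
      obtain ⟨u, hu, hmax⟩ := Finset.exists_max_image (Finset.univ.filter fun x => f x < f v) f
        ⟨r, by simpa using hlt⟩
      exact ⟨u, fun h => absurd h hv, fun _ => ⟨by simpa using hu, fun x hx =>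
        hmax x (by simpa using hx)⟩⟩
  choose pr hpr1 hpr2 using hpred
  have hrank : ∀ v, v ≠ r → (Finset.univ.filter fun x => f x < f (pr v)).card <
      (Finset.univ.filter fun x => f x < f v).card := by
    intro v hv
    obtain ⟨h1, _⟩ := hpr2 v hv
    refine Finset.card_lt_card
      (Finset.ssubset_iff_of_subset ?_ |>.2 ⟨pr v, by simpa using h1, by simp⟩)
    intro x hx
    simp only [Finset.mem_filter, Finset.mem_univ, true_and] at hx ⊢
    exact hx.trans h1
  have hanc : ∀ m x v, (Finset.univ.filter fun x => f x < f v).card ≤ m → f x ≤ f v →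
      Anc pr x v := by
    intro m
    induction m with
    | zero =>
      intro x v hm hxv
      by_cases hv : v = r
      · rw [hv] at hxv ⊢
        rw [finj _ _ (le_antisymm hxv (hr x (Finset.mem_univ _)))]
        exact Anc.refl _ _
      · have := hrank v hv; omega
    | succ m ih =>
      intro x v hm hxv
      rcases hxv.eq_or_lt with h | h
      · rw [finj _ _ h]; exact Anc.refl _ _
      · have hv : v ≠ r := by
          rintro rfl
          exact absurd (hr x (Finset.mem_univ _)) (not_le.2 h)
        have := hrank v hv
        exact (ih x (pr v) (by omega) ((hpr2 v hv).2 x h)).of_apply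
  have hR : Rooted r pr :=
    ⟨hpr1 r rfl, fun v => hanc _ r v le_rfl (hr v (Finset.mem_univ _))⟩
  have hup : ∀ u v : Fin I.n, f u ≤ f v → ∀ w : (parentGraph r pr).Walk u v, w.IsPath →
      ∀ d ∈ w.darts, f d.fst < f d.snd := by
    intro u v huv w hw d hd
    rcases hR.adj_iff.1 d.adj with ⟨hx, hx'⟩ | ⟨hx, hx'⟩
    · obtain ⟨h1, h2⟩ := hR.anc_of_dart w hw hx hd rfl hx'.symm
      exact absurd (h1.trans (hanc _ u v le_rfl huv)) h2
    · rw [← hx']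
      exact (hpr2 _ hx).1
  refine ⟨parentGraph r pr, hR.isTree, fun u v w _ hw => ?_⟩
  rw [isMonotonePath_iff]
  rcases le_total (f u) (f v) with h | h
  · exact ⟨0, by omega, (pairwise_support_of_darts w (hup u v h w hw)).1⟩
  · refine ⟨I.k + 0, by omega, ?_⟩
    have h1 := (pairwise_support_of_darts w.reverse (hup v u h w.reverse hw.reverse)).1
    rw [SimpleGraph.Walk.support_reverse, List.pairwise_reverse] at h1
    simpa only [key_add hk, neg_lt_neg_iff] using h1

end Instance

end MMST

/-! ### Merge sort -/

namespace MMST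

open RealRAM

/-- The values of `κ` on `x 0, …, x (n - 1)` increase within each block of length `W`. -/
def BlockSorted (κ : ℕ → ℝ) (x : ℕ → ℕ) (n W : ℕ) : Prop :=
  ∀ s s', s < s' → s' < n → s / W = s' / W → κ (x s) ≤ κ (x s')

/-- Between two blocks of a merging pass: the first `t` entries of `y` contain those of `x`. -/
structure MergeFresh (κ : ℕ → ℝ) (x y : ℕ → ℕ) (n W t : ℕ) : Prop where
  dvd : 2 * W ∣ t ∨ t = n
  cov : ∀ s < t, ∃ t' < t, y t' = x s
  sorted : BlockSorted κ y t (2 * W)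

/-- Inside a block of a merging pass: the runs `lo, …, mid - 1` and `mid, …, hi - 1` of `x` have
been merged into `y` up to the positions `i` and `j`. -/
structure MergeBlock (κ : ℕ → ℝ) (x y : ℕ → ℕ) (n W lo t mid hi i j : ℕ) : Prop where
  dvd : 2 * W ∣ lo
  mid_eq : mid = min (lo + W) n
  hi_eq : hi = min (mid + W) n
  lo_le : lo ≤ i
  i_le : i ≤ mid
  mid_le : mid ≤ j
  j_le : j ≤ hi
  add_eq : i + j = t + mid
  cov : ∀ s, s < i ∨ (mid ≤ s ∧ s < j) → ∃ t' < t, y t' = x s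
  le : ∀ s, lo ≤ s → s < t → ∀ r, (i ≤ r ∧ r < mid) ∨ (j ≤ r ∧ r < hi) → κ (y s) ≤ κ (x r)
  sorted : BlockSorted κ y t (2 * W)

section Merge

variable {κ : ℕ → ℝ} {x y : ℕ → ℕ} {n W lo t mid hi i j : ℕ}

theorem BlockSorted.congr {y' : ℕ → ℕ} (h : BlockSorted κ y n W) (hy : ∀ s < n, y' s = y s) :
    BlockSorted κ y' n W := by
  intro s s' h1 h2 h3
  rw [hy s (h1.trans h2), hy s' h2]
  exact h s s' h1 h2 h3

theorem MergeFresh.start (h : MergeFresh κ x y n W t) (ht : t < n) (hW : 0 < W) :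
    MergeBlock κ x y n W t t (min (t + W) n) (min (min (t + W) n + W) n) t (min (t + W) n) := by
  refine ⟨h.dvd.resolve_right ht.ne, rfl, rfl, le_rfl, by omega, le_rfl, by omega, rfl, ?_, ?_,
    h.sorted⟩
  · intro s hs
    exact h.cov s (by omega)
  · intro s h1 h2
    omega

theorem MergeBlock.finish (h : MergeBlock κ x y n W lo t mid hi i j) (ht : t = hi) :
    MergeFresh κ x y n W t := by
  have h1 := h.mid_eq
  have h2 := h.hi_eq
  have h3 := h.i_le
  have h4 := h.j_le
  have h5 := h.add_eq
  refine ⟨?_, fun s hs => h.cov s (by omega), h.sorted⟩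
  by_cases hn : t = n
  · exact Or.inr hn
  · left
    have : t = lo + 2 * W := by omega
    rw [this]
    exact Nat.dvd_add_self_right.2 h.dvd

theorem div_eq_of_block {W lo s : ℕ} (hW : 0 < W) (h : W ∣ lo) (h1 : lo ≤ s) (h2 : s < lo + W) :
    s / W = lo / W := by
  obtain ⟨q, rfl⟩ := h
  rw [Nat.mul_div_cancel_left q hW]
  exact Nat.div_eq_of_lt_le (by rw [mul_comm]; exact h1)
    (by rw [Nat.add_mul, one_mul, mul_comm q]; exact h2)

theorem same_block {W lo s s' : ℕ} (hW : 0 < W) (h : W ∣ lo) (h1 : lo ≤ s) (h2 : s < lo + W)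
    (h3 : lo ≤ s') (h4 : s' < lo + W) : s / W = s' / W :=
  (div_eq_of_block hW h h1 h2).trans (div_eq_of_block hW h h3 h4).symm

theorem MergeBlock.update_cov (h : MergeBlock κ x y n W lo t mid hi i j) {s₀ : ℕ} {s : ℕ}
    (hs : s = s₀ ∨ (s < i ∨ (mid ≤ s ∧ s < j))) :
    ∃ t' < t + 1, Function.update y t (x s₀) t' = x s := by
  rcases hs with rfl | hs
  · exact ⟨t, by omega, by simp⟩
  · obtain ⟨t', h1, h2⟩ := h.cov s hs
    exact ⟨t', by omega, by rw [Function.update_of_ne (by omega), h2]⟩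

theorem MergeBlock.update_sorted (h : MergeBlock κ x y n W lo t mid hi i j) (hW : 0 < W)
    (ht : t < hi) {s₀ : ℕ} (hs₀ : (i ≤ s₀ ∧ s₀ < mid) ∨ (j ≤ s₀ ∧ s₀ < hi)) :
    BlockSorted κ (Function.update y t (x s₀)) (t + 1) (2 * W) := by
  have h1 := h.mid_eq
  have h2 := h.hi_eq
  have h3 := h.lo_le
  have h4 := h.mid_le
  have h5 := h.add_eq
  intro s s' hs hs' hdiv
  rw [Function.update_of_ne (by omega : s ≠ t)]
  rcases Nat.lt_succ_iff_lt_or_eq.1 hs' with hs' | rfl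
  · rw [Function.update_of_ne hs'.ne]
    exact h.sorted s s' hs hs' hdiv
  · rw [Function.update_self]
    refine h.le s ?_ hs s₀ hs₀
    by_contra hlo
    rw [div_eq_of_block (by omega) h.dvd (by omega : lo ≤ s') (by omega)] at hdiv
    have h6 := Nat.div_mul_le_self s (2 * W)
    obtain ⟨q, hq⟩ := h.dvd
    rw [hq, Nat.mul_div_cancel_left q (by omega)] at hdiv
    have h7 := Nat.lt_mul_div_succ s (by omega : 0 < 2 * W)
    rw [hdiv] at h6
    rw [mul_comm] at h6
    omega

theorem MergeBlock.left (h : MergeBlock κ x y n W lo t mid hi i j) (hW : 0 < W)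
    (hx : BlockSorted κ x n W) (ht : t < hi) (hi' : i < mid) (hj : j < hi → κ (x i) ≤ κ (x j)) :
    MergeBlock κ x (Function.update y t (x i)) n W lo (t + 1) mid hi (i + 1) j := by
  have h1 := h.mid_eq
  have h2 := h.hi_eq
  have h3 := h.lo_le
  have h4 := h.mid_le
  have h5 := h.add_eq
  have hW' : W ∣ lo := (Dvd.intro_left 2 rfl).trans h.dvd
  refine ⟨h.dvd, h.mid_eq, h.hi_eq, by omega, by omega, h.mid_le, h.j_le, by omega,
    fun s hs => h.update_cov (by omega), ?_, h.update_sorted hW ht (Or.inl ⟨le_rfl, hi'⟩)⟩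
  intro s h6 h7 r hr
  rcases Nat.lt_succ_iff_lt_or_eq.1 h7 with h7 | rfl
  · rw [Function.update_of_ne h7.ne]
    exact h.le s h6 h7 r (by omega)
  · rw [Function.update_self]
    rcases hr with hr | hr
    · refine hx i r (by omega) (by omega) ?_
      exact same_block hW hW' h3 (by omega) (by omega) (by omega)
    · refine (hj (by omega)).trans ?_
      rcases hr.1.eq_or_lt with rfl | hlt
      · exact le_rfl
      · have hd : W ∣ lo + W := Nat.dvd_add_self_right.2 hW'
        refine hx j r hlt (by omega) ?_
        exact same_block hW hd (by omega) (by omega) (by omega) (by omega)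

theorem MergeBlock.right (h : MergeBlock κ x y n W lo t mid hi i j) (hW : 0 < W)
    (hx : BlockSorted κ x n W) (ht : t < hi) (hj : j < hi) (hi' : i < mid → κ (x j) ≤ κ (x i)) :
    MergeBlock κ x (Function.update y t (x j)) n W lo (t + 1) mid hi i (j + 1) := by
  have h1 := h.mid_eq
  have h2 := h.hi_eq
  have h3 := h.lo_le
  have h4 := h.mid_le
  have h5 := h.add_eq
  have hW' : W ∣ lo := (Dvd.intro_left 2 rfl).trans h.dvd
  refine ⟨h.dvd, h.mid_eq, h.hi_eq, by omega, h.i_le, by omega, by omega, by omega,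
    fun s hs => h.update_cov (by omega), ?_, h.update_sorted hW ht (Or.inr ⟨le_rfl, hj⟩)⟩
  intro s h6 h7 r hr
  rcases Nat.lt_succ_iff_lt_or_eq.1 h7 with h7 | rfl
  · rw [Function.update_of_ne h7.ne]
    exact h.le s h6 h7 r (by omega)
  · rw [Function.update_self]
    rcases hr with hr | hr
    · refine (hi' (by omega)).trans ?_
      rcases hr.1.eq_or_lt with rfl | hlt
      · exact le_rfl
      · refine hx i r hlt (by omega) ?_
        exact same_block hW hW' h3 (by omega) (by omega) (by omega)
    · have hd : W ∣ lo + W := Nat.dvd_add_self_right.2 hW'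
      refine hx j r (by omega) (by omega) ?_
      exact same_block hW hd (by omega) (by omega) (by omega) (by omega)

end Merge

/-- If position `t` starts a new block, compute the boundaries of its two runs. -/
def blockStart : Program :=
  .branch (.natLt (rd 22) (rd 23)) .skip
    (.seq (put 25 (rd 22))
    (.seq (put 24 (.plus (rd 22) (rd 21)))
    (.seq (.branch (.natLt (rd 0) (rd 24)) (put 24 (rd 0)) .skip)
    (.seq (put 26 (rd 24))
    (.seq (put 23 (.plus (rd 24) (rd 21)))
    (.branch (.natLt (rd 0) (rd 23)) (put 23 (rd 0)) .skip))))))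

/-- Move the smaller of the two first remaining entries of the runs. -/
def mergeOne : Program :=
  .branch (.both (.natLt (rd 25) (rd 24)) (.neg (.both (.natLt (rd 26) (rd 23))
      (.realLt (.read 4 (.read 15 (rd 26))) (.read 4 (.read 15 (rd 25)))))))
    (.seq (.setNat 16 (rd 22) (.read 15 (rd 25))) (put 25 (.plus (rd 25) (.const 1))))
    (.seq (.setNat 16 (rd 22) (.read 15 (rd 26))) (put 26 (.plus (rd 26) (.const 1))))

/-- One pass of merge sort: pairs of adjacent runs of length `W`, the content of bank `21`, in bank
`15` are merged, using bank `16`. -/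
def mergePass : Program :=
  .seq (put 23 (.const 0))
  (.seq (forLoop 22 (rd 0) (.seq blockStart mergeOne))
  (forLoop 22 (rd 0) (.setNat 15 (rd 22) (.read 16 (rd 22)))))

/-- Store in bank `15` the indices of the points in the order of increasing content of the real
bank `4`. -/
def sortProgram : Program :=
  .seq (forLoop 22 (rd 0) (.setNat 15 (rd 22) (rd 22)))
  (.seq (put 21 (.const 1))
  (.loop (.natLt (rd 21) (rd 0)) (.seq mergePass (put 21 (.plus (rd 21) (rd 21))))))

/-- Invariant of a merging pass. -/
def MergeInv (κ : ℕ → ℝ) (x : ℕ → ℕ) (n W t : ℕ) (σ : State) : Prop :=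
  (t = σ.nats 23 0 ∧ t ≤ n ∧ MergeFresh κ x (σ.nats 16) n W t) ∨
    (t < σ.nats 23 0 ∧ ∃ lo, MergeBlock κ x (σ.nats 16) n W lo t (σ.nats 24 0) (σ.nats 23 0)
      (σ.nats 25 0) (σ.nats 26 0))

theorem run_mergeStep {κ : ℕ → ℝ} {x : ℕ → ℕ} {n W t : ℕ} (hW : 0 < W) (hx : BlockSorted κ x n W)
    (ht : t < n) {σ : State} (h0 : σ.nats 0 0 = n) (h15 : σ.nats 15 = x) (h21 : σ.nats 21 0 = W)
    (h22 : σ.nats 22 0 = t) (hκ : σ.reals 4 = κ) (h : MergeInv κ x n W t σ) :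
    Run (.seq blockStart mergeOne) σ (blockStart.cost + mergeOne.cost)
      (MergeInv κ x n W (t + 1)) := by
  refine Run.seqAgree (Q' := fun σ => t < σ.nats 23 0 ∧ ∃ lo, MergeBlock κ x (σ.nats 16) n W lo t
    (σ.nats 24 0) (σ.nats 23 0) (σ.nats 25 0) (σ.nats 26 0))
    (run_of_loopFree rfl ?_) ?_
  · rcases h with ⟨h1, h2, h3⟩ | ⟨h1, h2⟩
    · have hb := h3.start ht hW
      have hlt : ¬ σ.nats 22 0 < σ.nats 23 0 := by omega
      by_cases c1 : n < t + W
      · have m1 : min (t + W) n = n := by omega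
        have m2 : min (n + W) n = n := by omega
        have c2 : n < n + W := by omega
        rw [m1, m2] at hb
        simp only [blockStart, Program.step, Test.Holds, NatExpr.eval, hlt, if_false]
        simp [h0, h21, h22, c1, c2]
        exact ⟨ht, t, hb⟩
      · have m1 : min (t + W) n = t + W := by omega
        rw [m1] at hb
        by_cases c2 : n < t + W + W
        · have m2 : min (t + W + W) n = n := by omega
          rw [m2] at hb
          simp only [blockStart, Program.step, Test.Holds, NatExpr.eval, hlt, if_false]
          simp [h0, h21, h22, c1, c2]
          exact ⟨ht, t, hb⟩
        · have m2 : min (t + W + W) n = t + W + W := by omega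
          rw [m2] at hb
          simp only [blockStart, Program.step, Test.Holds, NatExpr.eval, hlt, if_false]
          simp [h0, h21, h22, c1, c2]
          exact ⟨by omega, t, hb⟩
    · have hlt : σ.nats 22 0 < σ.nats 23 0 := by omega
      simp only [blockStart, Program.step, Test.Holds, NatExpr.eval, hlt, if_true]
      exact ⟨h1, h2⟩
  · rintro σ' hag ⟨h1, lo, hb⟩
    have g15 : σ'.nats 15 = x := by rw [hag.1 15 (by decide), h15]
    have g22 : σ'.nats 22 0 = t := by rw [hag.1 22 (by decide), h22]
    have gκ : σ'.reals 4 = κ := by rw [hag.2 4 (by decide), hκ]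
    refine run_of_loopFree rfl ?_
    have a1 := hb.i_le
    have a2 := hb.j_le
    have a3 := hb.add_eq
    have a4 := hb.hi_eq
    -- after the step the block may be complete
    have fin : ∀ y i j, MergeBlock κ x y n W lo (t + 1) (σ'.nats 24 0) (σ'.nats 23 0) i j →
        (t + 1 = σ'.nats 23 0 ∧ t + 1 ≤ n ∧ MergeFresh κ x y n W (t + 1)) ∨
        (t + 1 < σ'.nats 23 0 ∧ ∃ lo, MergeBlock κ x y n W lo (t + 1) (σ'.nats 24 0)
          (σ'.nats 23 0) i j) := by
      intro y i j hb'
      rcases (Nat.succ_le_of_lt h1).eq_or_lt with h2 | h2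
      · exact Or.inl ⟨h2, by omega, hb'.finish h2⟩
      · exact Or.inr ⟨h2, lo, hb'⟩
    by_cases c : σ'.nats 25 0 < σ'.nats 24 0 ∧ ¬ (σ'.nats 26 0 < σ'.nats 23 0 ∧
        κ (x (σ'.nats 26 0)) < κ (x (σ'.nats 25 0)))
    · have := fin _ _ _ (hb.left hW hx h1 c.1 fun hj => not_lt.1 fun hlt => c.2 ⟨hj, hlt⟩)
      simp only [mergeOne, Program.step, Test.Holds, NatExpr.eval, RealExpr.eval, g15, gκ, c]
      simpa [MergeInv, g15, g22] using this
    · have hj : σ'.nats 26 0 < σ'.nats 23 0 := by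
        by_contra hj
        exact c ⟨by omega, fun h => hj h.1⟩
      have := fin _ _ _ (hb.right hW hx h1 hj fun hi => by
        by_contra hlt
        exact c ⟨hi, fun h => hlt h.2.le⟩)
      simp only [mergeOne, Program.step, Test.Holds, NatExpr.eval, RealExpr.eval, g15, gκ, c,
        if_false]
      simpa [MergeInv, g15, g22] using this

/-- A bound for the number of steps of a merging pass. -/
def mergePassTime (n : ℕ) : ℕ :=
  3 + (forTime n (blockStart.cost + mergeOne.cost) 2 + forTime n 6 2)

/-- `x` lists the numbers below `n`. -/
def Covers (x : ℕ → ℕ) (n : ℕ) : Prop := ∀ v < n, ∃ s < n, x s = v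

theorem run_mergePass {κ : ℕ → ℝ} {x : ℕ → ℕ} {n W : ℕ} (hW : 0 < W) (hx : BlockSorted κ x n W)
    (hcov : Covers x n) {σ : State} (h0 : σ.nats 0 0 = n) (h15 : σ.nats 15 = x)
    (h21 : σ.nats 21 0 = W) (hκ : σ.reals 4 = κ) :
    Run mergePass σ (mergePassTime n) (fun σ' => BlockSorted κ (σ'.nats 15) n (2 * W) ∧
      Covers (σ'.nats 15) n) := by
  refine Run.seqAgree (Q' := fun σ' => σ'.nats 23 0 = 0) (run_of_loopFree rfl ?_) ?_
  · simp [Program.step, NatExpr.eval]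
  intro σ₁ ag₁ h23
  refine Run.seqAgree (Q' := fun σ' => MergeFresh κ x (σ'.nats 16) n W n) (Run.forLoop
    (Inv := MergeInv κ x n W) (N := n) (by decide) ?_ ?_ ?_ ?_ ?_) ?_
  · intro σ' ag
    simp only [NatExpr.eval]
    rw [ag.1 0 (by decide), ag₁.1 0 (by decide), h0]
  · intro t σ' v h
    simpa [MergeInv] using h
  · refine Or.inl ⟨h23.symm, Nat.zero_le _, Or.inl (dvd_zero _), by simp, ?_⟩
    intro s s' h1 h2
    omega
  · intro t σ' ht ag h22 h
    refine run_mergeStep hW hx ht ?_ ?_ ?_ h22 ?_ h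
    · rw [ag.1 0 (by decide), ag₁.1 0 (by decide), h0]
    · rw [ag.1 15 (by decide), ag₁.1 15 (by decide), h15]
    · rw [ag.1 21 (by decide), ag₁.1 21 (by decide), h21]
    · rw [ag.2 4 (by decide), ag₁.2 4 (by decide), hκ]
  · rintro σ' _ (⟨_, _, h⟩ | ⟨h, lo, hb⟩)
    · exact h
    · have := hb.hi_eq
      omega
  intro σ₂ ag₂ hf
  refine Run.forLoop (Inv := fun t σ' => ∀ s < t, σ'.nats 15 s = σ₂.nats 16 s) (N := n)
    (B := 6) (by decide) ?_ ?_ (by simp) ?_ ?_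
  · intro σ' ag
    simp only [NatExpr.eval]
    rw [ag.1 0 (by decide), ag₂.1 0 (by decide), ag₁.1 0 (by decide), h0]
  · intro t σ' v h
    simpa using h
  · intro t σ' ht ag h22 h
    refine (run_of_loopFree (c := .setNat 15 (rd 22) (.read 16 (rd 22))) rfl ?_).mono (by decide)
      fun _ h => h
    have h16 : σ'.nats 16 = σ₂.nats 16 := ag.1 16 (by decide)
    intro s hs
    simp only [Program.step, NatExpr.eval, storeNat_nats, if_true, h22, h16, Function.update_apply]
    split_ifs with hst
    · rw [hst]
    · exact h s (by omega)
  · intro σ' _ h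
    refine ⟨hf.sorted.congr h, fun v hv => ?_⟩
    obtain ⟨s, hs, hsv⟩ := hcov v hv
    obtain ⟨t, ht, hts⟩ := hf.cov s hs
    exact ⟨t, ht, by rw [h t ht, hts, hsv]⟩

/-- A bound for the number of steps of merge sort. -/
def sortTime (n : ℕ) : ℕ :=
  forTime n 5 2 + (3 + ((Nat.log 2 n + 1) * (mergePassTime n + 7 + 5 + 1) + 5 + 1))

theorem run_sort {κ : ℕ → ℝ} {n : ℕ} {σ : State} (h0 : σ.nats 0 0 = n)
    (hκ : σ.reals 4 = κ) :
    Run sortProgram σ (sortTime n) (fun σ' => Covers (σ'.nats 15) n ∧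
      ∀ s s', s < s' → s' < n → κ (σ'.nats 15 s) ≤ κ (σ'.nats 15 s')) := by
  refine Run.seqAgree (Q' := fun σ' => Covers (σ'.nats 15) n) (Run.forLoop
    (Inv := fun t σ' => ∀ s < t, σ'.nats 15 s = s) (N := n) (B := 5) (by decide) ?_ ?_ (by simp)
    ?_ ?_) ?_
  · intro σ' ag
    simp only [NatExpr.eval]
    rw [ag.1 0 (by decide), h0]
  · intro t σ' v h
    simpa using h
  · intro t σ' ht ag h22 h
    refine (run_of_loopFree (c := .setNat 15 (rd 22) (rd 22)) rfl ?_).mono (by decide) fun _ h => h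
    intro s hs
    simp only [Program.step, NatExpr.eval, storeNat_nats, if_true, h22, Function.update_apply]
    split_ifs with hst
    · rw [hst]
    · exact h s (by omega)
  · intro σ' _ h v hv
    exact ⟨v, hv, h v hv⟩
  intro σ₁ ag₁ hcov
  refine Run.seqAgree (Q' := fun σ' => σ'.nats 21 0 = 1) (run_of_loopFree rfl ?_) ?_
  · simp [Program.step, NatExpr.eval]
  intro σ₂ ag₂ h21
  refine (Run.loop (B := mergePassTime n + 7) (N := Nat.log 2 n + 1)
    (Inv := fun r σ' => σ'.nats 21 0 = 2 ^ r ∧ Covers (σ'.nats 15) n ∧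
      BlockSorted κ (σ'.nats 15) n (2 ^ r)) ?_ ?_).agree.mono (by simp [Test.cost, NatExpr.cost]) ?_
  · refine ⟨h21, ?_, ?_⟩
    · rwa [ag₂.1 15 (by decide)]
    · intro s s' h1 h2 h3
      simp at h3
      omega
  · rintro r σ' ag ⟨h1, h2, h3⟩ hb
    have g0 : σ'.nats 0 0 = n := by
      rw [ag.1 0 (by decide), ag₂.1 0 (by decide), ag₁.1 0 (by decide), h0]
    have hlt : 2 ^ r < n := by simpa [Test.Holds, NatExpr.eval, g0, h1] using hb
    refine ⟨?_, ?_⟩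
    · have := Nat.le_log_of_pow_le (by norm_num) hlt.le
      omega
    · refine Run.seqAgree (run_mergePass (Nat.pow_pos (by norm_num)) h3 h2 g0 rfl h1 ?_) ?_
      · rw [ag.2 4 (by decide), ag₂.2 4 (by decide), ag₁.2 4 (by decide), hκ]
      · rintro σ'' ag'' ⟨h4, h5⟩
        refine (run_of_loopFree (c := put 21 (.plus (rd 21) (rd 21))) rfl ?_).mono (by decide)
          fun _ h => h
        have h6 : σ''.nats 21 0 = 2 ^ r := by rw [ag''.1 21 (by decide), h1]
        simp only [Program.step, NatExpr.eval, storeNat_nats, h6]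
        rw [pow_succ']
        exact ⟨by simp; ring, by simpa using h5, by simpa using h4⟩
  · rintro σ' ⟨ag, r, ⟨h1, h2, h3⟩, hb⟩
    refine ⟨h2, fun s s' hs hs' => h3 s s' hs hs' ?_⟩
    have g0 : σ'.nats 0 0 = n := by
      rw [ag.1 0 (by decide), ag₂.1 0 (by decide), ag₁.1 0 (by decide), h0]
    have hge : n ≤ 2 ^ r := by simpa [Test.Holds, NatExpr.eval, g0, h1] using hb
    rw [Nat.div_eq_of_lt (by omega), Nat.div_eq_of_lt (by omega)]

end MMST

/-! ### The treatment of a single guess -/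

namespace RealRAM

theorem Run.branch {b : Test} {c₁ c₂ : Program} {σ : State} {T : ℕ} {Q : State → Prop}
    (h₁ : b.Holds σ → Run c₁ σ T Q) (h₂ : ¬ b.Holds σ → Run c₂ σ T Q) :
    Run (.branch b c₁ c₂) σ (b.cost + 1 + T) Q := by
  by_cases hb : b.Holds σ
  · obtain ⟨t, σ', e, ht, hQ⟩ := h₁ hb
    exact ⟨_, _, .branchTrue hb e, by omega, hQ⟩
  · obtain ⟨t, σ', e, ht, hQ⟩ := h₂ hb
    exact ⟨_, _, .branchFalse hb e, by omega, hQ⟩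

end RealRAM

namespace MMST

open RealRAM

/-- The memory holds the input and the derived quantities that do not depend on the guess. The
natural number banks are used as follows; where only cell `0` matters, the bank is called a
variable. Variables: `3` number of signed directions, `4` number of signatures, `5`, `6`, `7`, `8`
positions in a guess, `11` end of the enumeration, `17` existence of a recorded tree, `18` outcome of the
test, `21` to `26` merge sort, `27` to `37` counters and temporary values. Tables: `9` the guess,
`10` radices, `12` colours, `13` parents, `14` ends of chains, `15` the sorted points, `16` the
target of merging, `19` and `20` marked colours. The real banks `0` and `1` hold the points, `2` and
`3` the signed directions, `4` the sorting keys; the real variables `5` and `6` are the length of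
the current tree and that of the recorded one. -/
structure Ready (I : Instance) (σ : State) : Prop where
  n : σ.nats 0 0 = I.n
  K : σ.nats 3 0 = 2 * I.k
  Q : σ.nats 4 0 = sigCount I.k
  offF : σ.nats 5 0 = offF I.k
  offA : σ.nats 6 0 = offA I.k
  offC : σ.nats 7 0 = offC I.k
  len : σ.nats 8 0 = guessLen I.k
  radix : ∀ i < guessLen I.k, σ.nats 10 i = radix I.n I.k i
  px : σ.reals 0 = I.px
  py : σ.reals 1 = I.py
  dx : σ.reals 2 = fun j => I.signedDir j 0
  dy : σ.reals 3 = fun j => I.signedDir j 1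

theorem Ready.agree {I : Instance} {σ σ' : State} (h : Ready I σ) {wn wr : List ℕ}
    (hag : Agree wn wr σ σ') (hn : ∀ b ∈ [0, 3, 4, 5, 6, 7, 8, 10], b ∉ wn)
    (hr : ∀ b ∈ [0, 1, 2, 3], b ∉ wr) : Ready I σ' := by
  have e : ∀ b ∈ [0, 3, 4, 5, 6, 7, 8, 10], σ'.nats b = σ.nats b := fun b hb => hag.1 b (hn b hb)
  have e' : ∀ b ∈ [0, 1, 2, 3], σ'.reals b = σ.reals b := fun b hb => hag.2 b (hr b hb)
  constructor
  · rw [e 0 (by decide)]; exact h.n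
  · rw [e 3 (by decide)]; exact h.K
  · rw [e 4 (by decide)]; exact h.Q
  · rw [e 5 (by decide)]; exact h.offF
  · rw [e 6 (by decide)]; exact h.offA
  · rw [e 7 (by decide)]; exact h.offC
  · rw [e 8 (by decide)]; exact h.len
  · rw [e 10 (by decide)]; exact h.radix
  · rw [e' 0 (by decide)]; exact h.px
  · rw [e' 1 (by decide)]; exact h.py
  · rw [e' 2 (by decide)]; exact h.dx
  · rw [e' 3 (by decide)]; exact h.dy

/-- The position of a point in a signed direction. -/
def valExpr (j v : NatExpr) : RealExpr :=
  .plus (.times (.read 2 j) (.read 0 v)) (.times (.read 3 j) (.read 1 v))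

theorem Ready.eval_valExpr {I : Instance} {σ : State} (h : Ready I σ) (j v : NatExpr) :
    (valExpr j v).eval σ = I.val (j.eval σ) (v.eval σ) := by
  simp only [valExpr, RealExpr.eval, h.px, h.py, h.dx, h.dy, Instance.val]

variable {I : Instance} {g : ℕ → ℕ} {σ : State}

/-- Append a bit to the signature of the current point: whether it lies ahead of the special point
at position `35` of the guess, in the signed direction `36`. -/
def bitStep : Program :=
  .seq (put 32 (.plus (rd 32) (rd 32)))
    (.branch (.realLt (valExpr (rd 36) (.read 9 (rd 35))) (valExpr (rd 36) (rd 29)))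
      (put 32 (.plus (rd 32) (.const 1))) .skip)

/-- Compute the signature of the current point. -/
def sigProgram : Program :=
  .seq (put 32 (.const 0)) (forLoop 35 (rd 5) (forLoop 36 (rd 3) bitStep))

/-- Compute the colours of all points. -/
def colourProgram : Program :=
  .seq (forLoop 29 (rd 0) (.seq sigProgram
    (.setNat 12 (rd 29) (.plus (.const 1) (.read 9 (.plus (rd 5) (rd 32)))))))
  (.setNat 12 (.const 0) (.const 0))

/-- A bound for the number of steps of the computation of a signature. -/
def sigTime (k : ℕ) : ℕ := 3 + forTime (offF k) (forTime (2 * k) bitStep.cost 2) 2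

theorem run_sig (hR : Ready I σ) (hg : σ.nats 9 = g) :
    Run sigProgram σ (sigTime I.k) (fun σ' => σ'.nats 32 0 = I.sig g (σ.nats 29 0)) := by
  have hk := I.k_pos
  set β := I.sigBit g (σ.nats 29 0) with hβ
  refine Run.seqAgree (Q' := fun σ' => σ'.nats 32 0 = 0) (run_of_loopFree rfl ?_) ?_
  · simp [Program.step, NatExpr.eval]
  intro σ₁ ag₁ h32
  refine Run.forLoop (Inv := fun i σ' => σ'.nats 32 0 = code β (i * (2 * I.k))) (N := offF I.k)
    (by decide) ?_ ?_ ?_ ?_ ?_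
  · intro σ' ag
    exact ((hR.agree ag₁ (by decide) (by decide)).agree ag (by decide) (by decide)).offF
  · intro i σ' v h
    simpa using h
  · simpa [code] using h32
  · intro i σ₂ hi ag₂ h35 h
    have agσ₂ : Agree sigProgram.natWrites sigProgram.realWrites σ σ₂ :=
      (ag₁.mono (by decide) (by decide)).trans (ag₂.mono (by decide) (by decide))
    refine Run.forLoop (Inv := fun j σ' => σ'.nats 32 0 = code β (i * (2 * I.k) + j))
      (N := 2 * I.k) (by decide) ?_ ?_ ?_ ?_ ?_
    · intro σ' ag
      exact ((hR.agree agσ₂ (by decide) (by decide)).agree ag (by decide) (by decide)).K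
    · intro j σ' v h
      simpa using h
    · simpa using h
    · intro j σ₃ hj ag₃ h36 h'
      have hR₃ := (hR.agree agσ₂ (by decide) (by decide)).agree ag₃ (by decide) (by decide)
      refine run_of_loopFree rfl ?_
      have g9 : σ₃.nats 9 = g := by rw [ag₃.1 9 (by decide), agσ₂.1 9 (by decide), hg]
      have g35 : σ₃.nats 35 0 = i := by rw [ag₃.1 35 (by decide), h35]
      have g29 : σ₃.nats 29 0 = σ.nats 29 0 := by
        rw [ag₃.1 29 (by decide), agσ₂.1 29 (by decide)]
      have h1 : (i * (2 * I.k) + j) % (2 * I.k) = j := by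
        rw [mul_comm, Nat.mul_add_mod, Nat.mod_eq_of_lt hj]
      have h2 : (i * (2 * I.k) + j) / (2 * I.k) = i := by
        rw [mul_comm, Nat.mul_add_div (by omega), Nat.div_eq_of_lt hj, add_zero]
      have hR₄ : Ready I (σ₃.storeNat 32 0 (σ₃.nats 32 0 + σ₃.nats 32 0)) :=
        hR₃.agree (agree_storeNat _ _ _ _ [32] [] (by simp)) (by decide) (by decide)
      have hbit : β (i * (2 * I.k) + j) =
          if I.val j (g i) < I.val j (σ.nats 29 0) then 1 else 0 := by
        rw [hβ, Instance.sigBit, h1, h2]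
      have htest : (Test.realLt (valExpr (rd 36) (.read 9 (rd 35))) (valExpr (rd 36) (rd 29))).Holds
          (σ₃.storeNat 32 0 (σ₃.nats 32 0 + σ₃.nats 32 0)) ↔
          I.val j (g i) < I.val j (σ.nats 29 0) := by
        rw [Test.Holds, hR₄.eval_valExpr, hR₄.eval_valExpr]
        simp [NatExpr.eval, h36, g9, g35, g29]
      rw [← add_assoc, code, hbit, ← h']
      simp only [bitStep, Program.step, NatExpr.eval, htest]
      split_ifs <;> simp
    · intro σ' _ h'
      rw [h', Nat.add_mul, one_mul]
  · intro σ' _ h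
    exact h

/-- A bound for the number of steps of the computation of all colours. -/
def colourTime (n k : ℕ) : ℕ := forTime n (sigTime k + 11) 2 + 3

theorem run_colour (hR : Ready I σ) (hg : σ.nats 9 = g) :
    Run colourProgram σ (colourTime I.n I.k)
      (fun σ' => ∀ v < I.n, σ'.nats 12 v = I.colour g v) := by
  refine Run.seqAgree (Q' := fun σ' => ∀ v < I.n, σ'.nats 12 v = 1 + g (offF I.k + I.sig g v))
    (Run.forLoop (Inv := fun i σ' => ∀ v < i, σ'.nats 12 v = 1 + g (offF I.k + I.sig g v))
      (N := I.n) (by decide) ?_ ?_ (by simp) ?_ (fun _ _ h => h)) ?_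
  · intro σ' ag
    exact (hR.agree ag (by decide) (by decide)).n
  · intro i σ' v h
    simpa using h
  · intro i σ₁ hi ag₁ h29 h
    have hR₁ := hR.agree ag₁ (by decide) (by decide)
    refine Run.seqAgree (run_sig hR₁ (by rw [ag₁.1 9 (by decide), hg])) ?_
    intro σ₂ ag₂ h32
    refine run_of_loopFree (c := .setNat 12 (rd 29) (.plus (.const 1) (.read 9 (.plus (rd 5)
      (rd 32))))) rfl ?_
    have g9 : σ₂.nats 9 = g := by rw [ag₂.1 9 (by decide), ag₁.1 9 (by decide), hg]
    have g29 : σ₂.nats 29 0 = i := by rw [ag₂.1 29 (by decide), h29]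
    have g12 : σ₂.nats 12 = σ₁.nats 12 := ag₂.1 12 (by decide)
    have g5 : σ₂.nats 5 0 = offF I.k := (hR₁.agree ag₂ (by decide) (by decide)).offF
    rw [h29] at h32
    intro v hv
    simp only [Program.step, NatExpr.eval, storeNat_nats, if_true, g29, g9, g5, h32, g12,
      Function.update_apply]
    split_ifs with hvi
    · rw [hvi]
    · exact h v (by omega)
  · intro σ' _ h
    refine run_of_loopFree (c := .setNat 12 (.const 0) (.const 0)) rfl ?_
    intro v hv
    simp only [Program.step, NatExpr.eval, storeNat_nats, if_true, Function.update_apply,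
      Instance.colour]
    split_ifs
    · rfl
    · exact h v hv

theorem Covers.perm {x : ℕ → ℕ} {n : ℕ} (h : Covers x n) :
    (List.range n).Perm ((List.range n).map x) := by
  refine List.Subperm.perm_of_length_le (List.nodup_range.subperm fun v hv => ?_) (by simp)
  obtain ⟨s, hs, hsv⟩ := h v (List.mem_range.1 hv)
  exact List.mem_map.2 ⟨s, List.mem_range.2 hs, hsv⟩

/-- Store the positions of all points in the current direction. -/
def keyProgram : Program := forLoop 29 (rd 0) (.setReal 4 (rd 29) (valExpr (rd 36) (rd 29)))

/-- Extend the current chain by the next point in sorted order, if it has the right colour. -/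
def linkStep : Program :=
  .branch (.natEq (.read 12 (.read 15 (rd 29))) (rd 37))
    (.seq (.setNat 13 (.read 15 (rd 29)) (rd 30)) (put 30 (.read 15 (rd 29)))) .skip

/-- Build the chain of the colour that follows the content of bank `27`. -/
def chainProgram : Program :=
  .seq (.seq (put 37 (.plus (rd 27) (.const 1))) (put 36 (.read 9 (.plus (rd 7) (rd 37)))))
  (.seq keyProgram
  (.seq sortProgram
  (.seq (put 30 (.read 14 (.minus (.minus (rd 37) (.const 1)) (.read 9 (.plus (rd 6) (rd 37))))))
  (.seq (forLoop 29 (rd 0) linkStep)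
  (.setNat 14 (rd 37) (rd 30))))))

/-- Build all chains. -/
def layoutProgram : Program :=
  .seq (.setNat 14 (.const 0) (.const 0)) (forLoop 27 (rd 4) chainProgram)

theorem run_link {κ : ℕ → ℝ} {x col par : ℕ → ℕ} {n a z : ℕ} (hx : Covers x n)
    (hs : ∀ s s', s < s' → s' < n → κ (x s) ≤ κ (x s')) (h0 : σ.nats 0 0 = n)
    (h15 : σ.nats 15 = x) (h12 : σ.nats 12 = col) (h37 : σ.nats 37 0 = a)
    (h30 : σ.nats 30 0 = z) (h13 : σ.nats 13 = par) :
    Run (forLoop 29 (rd 0) linkStep) σ (forTime n linkStep.cost 2) (fun σ' =>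
      (∀ v, col v ≠ a → σ'.nats 13 v = par v) ∧
      ∃ l : List ℕ, (∀ v, v ∈ l ↔ v < n ∧ col v = a) ∧ l.Pairwise (fun u v => κ u ≤ κ v) ∧
        l.Nodup ∧ Linked (σ'.nats 13) z l (σ'.nats 30 0)) := by
  refine Run.forLoop (N := n) (Inv := fun i σ' => (∀ v, col v ≠ a → σ'.nats 13 v = par v) ∧
    Linked (σ'.nats 13) z (((List.range i).map x).filter fun v => col v = a) (σ'.nats 30 0))
    (by decide) ?_ ?_ ?_ ?_ ?_
  · intro σ' ag
    simp only [NatExpr.eval]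
    rw [ag.1 0 (by decide), h0]
  · intro i σ' v h
    simpa using h
  · refine ⟨fun v _ => by rw [h13], ?_⟩
    simp [Linked, h30]
  · rintro i σ' hi ag h29 ⟨h1, h2⟩
    refine run_of_loopFree rfl ?_
    have g15 : σ'.nats 15 = x := by rw [ag.1 15 (by decide), h15]
    have g12 : σ'.nats 12 = col := by rw [ag.1 12 (by decide), h12]
    have g37 : σ'.nats 37 0 = a := by rw [ag.1 37 (by decide), h37]
    have hnd : x i ∉ (List.range i).map x := by
      have h3 : ((List.range n).map x).Nodup := hx.perm.nodup_iff.1 List.nodup_range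
      rintro hmem
      obtain ⟨s, hs1, hs2⟩ := List.mem_map.1 hmem
      have hs1 := List.mem_range.1 hs1
      have := List.inj_on_of_nodup_map h3 (List.mem_range.2 (hs1.trans hi))
        (List.mem_range.2 hi) hs2
      omega
    rw [List.range_succ, List.map_append, List.filter_append, List.map_singleton]
    by_cases hc : col (x i) = a
    · simp only [linkStep, Program.step, Test.Holds, NatExpr.eval, h29, g15, g12, g37, hc, if_true]
      refine ⟨fun v hv => ?_, ?_⟩
      · have hne : v ≠ x i := by rintro rfl; exact hv hc
        simp [hne, h1 v hv]
      · have hl : (([x i] : List ℕ).filter fun v => col v = a) = [x i] := by simp [hc]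
        rw [hl]
        simp only [storeNat_nats]
        simp only [Nat.reduceEqDiff, if_true, if_false, Function.update_self]
        simp only [g15, h29]
        refine (h2.congr fun v hv => ?_).concat (by simp)
        rw [Function.update_of_ne]
        rintro rfl
        exact hnd (List.mem_filter.1 hv).1
    · have hl : (([x i] : List ℕ).filter fun v => col v = a) = [] := by simp [hc]
      rw [hl, List.append_nil]
      simp only [linkStep, Program.step, Test.Holds, NatExpr.eval, h29, g15, g12, g37, hc, if_false]
      exact ⟨h1, h2⟩
  · rintro σ' _ ⟨h1, h2⟩
    refine ⟨h1, _, fun v => ?_, ?_, ?_, h2⟩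
    · rw [List.mem_filter, ← hx.perm.mem_iff, List.mem_range]
      simp
    · refine List.Pairwise.filter _ ?_
      rw [List.pairwise_map]
      exact List.pairwise_lt_range.imp_of_mem fun _ hb hlt => hs _ _ hlt (List.mem_range.1 hb)
    · exact (hx.perm.nodup_iff.1 List.nodup_range).filter _

end MMST

namespace MMST

open RealRAM

variable {I : Instance} {g : ℕ → ℕ} {σ : State}

theorem run_key (hR : Ready I σ) :
    Run keyProgram σ (forTime I.n 18 2)
      (fun σ' => ∀ v < I.n, σ'.reals 4 v = I.val (σ.nats 36 0) v) := by
  refine Run.forLoop (N := I.n) (B := 18)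
    (Inv := fun i σ' => ∀ v < i, σ'.reals 4 v = I.val (σ.nats 36 0) v)
    (by decide) ?_ ?_ (by simp) ?_ (fun _ _ h => h)
  · intro σ' ag
    exact (hR.agree ag (by decide) (by decide)).n
  · intro i σ' v h
    simpa using h
  · intro i σ' hi ag h29 h
    refine (run_of_loopFree (c := .setReal 4 (rd 29) (valExpr (rd 36) (rd 29))) rfl ?_).mono
      (by decide) fun _ h => h
    have g36 : σ'.nats 36 = σ.nats 36 := ag.1 36 (by decide)
    intro v hv
    simp only [Program.step, (hR.agree ag (by decide) (by decide)).eval_valExpr, NatExpr.eval, h29,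
      g36, storeReal_reals, if_true, Function.update_apply]
    split_ifs with hvi
    · rw [hvi]
    · exact h v (by omega)

/-- The chain of colour `a` has been built: its vertices, sorted, are linked by `par`. -/
def ChainBuilt (I : Instance) (g par L : ℕ → ℕ) (a : ℕ) : Prop :=
  ∃ l : List ℕ, (∀ v, v ∈ l ↔ v < I.n ∧ I.colour g v = a) ∧
    l.Pairwise (fun x y => I.val (I.cert g 0 a) x ≤ I.val (I.cert g 0 a) y) ∧ l.Nodup ∧
    Linked par (L (I.above g a)) l (L a)

/-- A bound for the number of steps of the construction of a chain. -/
def chainTime (n : ℕ) : ℕ :=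
  3 + 5 + 4 + 8 + (forTime n 18 2 + (sortTime n + (14 + (forTime n linkStep.cost 2 + 5))))

theorem run_chain (hR : Ready I σ) (hg : σ.nats 9 = g)
    (hcol : ∀ v < I.n, σ.nats 12 v = I.colour g v) {c : ℕ} (hc : c < sigCount I.k)
    (h27 : σ.nats 27 0 = c) :
    Run chainProgram σ (chainTime I.n) (fun σ' =>
      (∀ v < I.n, I.colour g v ≠ c + 1 → σ'.nats 13 v = σ.nats 13 v) ∧
      (∀ a, a ≠ c + 1 → σ'.nats 14 a = σ.nats 14 a) ∧
      ChainBuilt I g (σ'.nats 13) (σ'.nats 14) (c + 1)) := by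
  have habove : I.above g (c + 1) = c + 1 - 1 - g (offA I.k + (c + 1)) := by
    rw [Instance.above, if_pos (by omega)]
  refine Run.seqAgree (T₁ := 3 + 5 + 4 + 8) (Q' := fun σ' => σ'.nats 37 0 = c + 1 ∧
    σ'.nats 36 0 = I.cert g 0 (c + 1))
    ((run_of_loopFree rfl ?_).mono (by decide) fun _ h => h) ?_
  · simp [Program.step, NatExpr.eval, h27, hg, hR.offC, Instance.cert]
  rintro σ₁ ag₁ ⟨a37, a36⟩
  have hR₁ := hR.agree ag₁ (by decide) (by decide)
  refine Run.seqAgree (run_key hR₁) ?_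
  intro σ₂ ag₂ hkey
  have hR₂ := hR₁.agree ag₂ (by decide) (by decide)
  refine Run.seqAgree (run_sort hR₂.n rfl) ?_
  rintro σ₃ ag₃ ⟨hcov, hsort⟩
  have hR₃ := hR₂.agree ag₃ (by decide) (by decide)
  have ag13 : Agree chainProgram.natWrites chainProgram.realWrites σ σ₃ :=
    ((ag₁.mono (by decide) (by decide)).trans (ag₂.mono (by decide) (by decide))).trans
      (ag₃.mono (by decide) (by decide))
  have b37 : σ₃.nats 37 0 = c + 1 := by rw [ag₃.1 37 (by decide), ag₂.1 37 (by decide), a37]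
  have b9 : σ₃.nats 9 = g := by rw [ag13.1 9 (by decide), hg]
  have b12 : σ₃.nats 12 = σ.nats 12 := ag13.1 12 (by decide)
  have b13 : σ₃.nats 13 = σ.nats 13 := by
    rw [ag₃.1 13 (by decide), ag₂.1 13 (by decide), ag₁.1 13 (by decide)]
  have b14 : σ₃.nats 14 = σ.nats 14 := by
    rw [ag₃.1 14 (by decide), ag₂.1 14 (by decide), ag₁.1 14 (by decide)]
  refine Run.seqAgree (T₁ := 14) (Q' := fun σ' => σ'.nats 30 0 = σ.nats 14 (I.above g (c + 1)))
    ((run_of_loopFree rfl ?_).mono (by decide) fun _ h => h) ?_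
  · simp [Program.step, NatExpr.eval, b37, b9, b14, hR₃.offA, habove]
  intro σ₄ ag₄ h30
  have c37 : σ₄.nats 37 0 = c + 1 := by rw [ag₄.1 37 (by decide), b37]
  have c12 : σ₄.nats 12 = σ.nats 12 := by rw [ag₄.1 12 (by decide), b12]
  have c13 : σ₄.nats 13 = σ.nats 13 := by rw [ag₄.1 13 (by decide), b13]
  have c14 : σ₄.nats 14 = σ.nats 14 := by rw [ag₄.1 14 (by decide), b14]
  have c15 : σ₄.nats 15 = σ₃.nats 15 := ag₄.1 15 (by decide)
  have hR₄ := hR₃.agree ag₄ (by decide) (by decide)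
  refine Run.seqAgree (run_link hcov hsort hR₄.n c15 c12 c37 h30 c13) ?_
  rintro σ₅ ag₅ ⟨hpar, l, hl, hlsort, hnodup, hlink⟩
  refine (run_of_loopFree (c := .setNat 14 (rd 37) (rd 30)) rfl ?_).mono (by decide) fun _ h => h
  have d37 : σ₅.nats 37 0 = c + 1 := by rw [ag₅.1 37 (by decide), c37]
  have d14 : σ₅.nats 14 = σ.nats 14 := by rw [ag₅.1 14 (by decide), c14]
  have e13 : ((Program.setNat 14 (rd 37) (rd 30)).step σ₅).nats 13 = σ₅.nats 13 := by
    simp [Program.step]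
  have e14 : ((Program.setNat 14 (rd 37) (rd 30)).step σ₅).nats 14 =
      Function.update (σ.nats 14) (c + 1) (σ₅.nats 30 0) := by
    simp [Program.step, NatExpr.eval, d37, d14]
  rw [e13, e14]
  refine ⟨fun v hv hva => hpar v (by rw [hcol v hv]; exact hva), fun a ha => ?_, l, ?_, ?_, hnodup,
    ?_⟩
  · rw [Function.update_of_ne ha]
  · intro v
    rw [hl]
    exact and_congr_right fun hv => by rw [hcol v hv]
  · refine hlsort.imp_of_mem fun {u v} hu hv h => ?_
    rw [hkey u ((hl u).1 hu).1, hkey v ((hl v).1 hv).1, a36] at h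
    exact h
  · rw [Function.update_self, Function.update_of_ne (by omega)]
    exact hlink

/-- A bound for the number of steps of the construction of all chains. -/
def layoutTime (n k : ℕ) : ℕ := 3 + forTime (sigCount k) (chainTime n) 2

theorem run_layout (hR : Ready I σ) (hg : σ.nats 9 = g)
    (hcol : ∀ v < I.n, σ.nats 12 v = I.colour g v) :
    Run layoutProgram σ (layoutTime I.n I.k) (fun σ' => I.GuessLayout g (σ'.nats 13)) := by
  refine Run.seqAgree (Q' := fun σ' => σ'.nats 14 0 = 0) (run_of_loopFree rfl ?_) ?_
  · simp [Program.step, NatExpr.eval]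
  intro σ₁ ag₁ h14
  have hR₁ := hR.agree ag₁ (by decide) (by decide)
  refine Run.forLoop (N := sigCount I.k) (Inv := fun c σ' => σ'.nats 14 0 = 0 ∧
    ∀ a, 1 ≤ a → a ≤ c → ChainBuilt I g (σ'.nats 13) (σ'.nats 14) a) (by decide) ?_ ?_ ?_ ?_ ?_
  · intro σ' ag
    exact (hR₁.agree ag (by decide) (by decide)).Q
  · intro i σ' v h
    simpa using h
  · exact ⟨h14, fun a h1 h2 => by omega⟩
  · rintro c σ' hc ag h27 ⟨h1, h2⟩
    refine (run_chain (hR₁.agree ag (by decide) (by decide)) (g := g) ?_ ?_ hc h27).mono le_rfl ?_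
    · rw [ag.1 9 (by decide), ag₁.1 9 (by decide), hg]
    · rw [ag.1 12 (by decide), ag₁.1 12 (by decide)]
      exact hcol
    · rintro σ'' ⟨h3, h4, h5⟩
      refine ⟨by rw [h4 0 (by omega), h1], fun a ha ha' => ?_⟩
      rcases ha'.eq_or_lt with rfl | hlt
      · exact h5
      · obtain ⟨l, hl, hs, hn, hlink⟩ := h2 a ha (by omega)
        have hab : I.above g a < a := by
          unfold Instance.above
          split_ifs <;> omega
        refine ⟨l, hl, hs, hn, ?_⟩
        rw [h4 a (by omega), h4 _ (by omega)]
        refine hlink.congr fun v hv => h3 v ((hl v).1 hv).1 ?_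
        rw [((hl v).1 hv).2]
        omega
  · rintro σ' _ ⟨h1, h2⟩
    exact ⟨_, h1, h2⟩

/-- Mark, in the bank `b`, the colours above the one in the bank `src`. -/
def markProgram (b src : ℕ) : Program :=
  .seq (forLoop 34 (.plus (rd 4) (.const 1)) (.setNat b (rd 34) (.const 0)))
  (.seq (put 33 (rd src))
  (forLoop 34 (.plus (rd 4) (.const 1)) (.seq (.setNat b (rd 33) (.const 1))
    (put 33 (.minus (.minus (rd 33) (.const 1)) (.read 9 (.plus (rd 6) (rd 33))))))))

/-- A bound for the number of steps of the marking of colours. -/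
def markTime (k : ℕ) : ℕ :=
  forTime (sigCount k + 1) 4 4 + (4 + forTime (sigCount k + 1) 18 4)

theorem iterate_above_le (g : ℕ → ℕ) (a i : ℕ) : (I.above g)^[i] a ≤ a - i := by
  induction i with
  | zero => simp
  | succ i ih =>
    rw [Function.iterate_succ_apply']
    have : I.above g ((I.above g)^[i] a) ≤ (I.above g)^[i] a - 1 := by
      unfold Instance.above
      split_ifs <;> omega
    omega

theorem anc_above_iff (g : ℕ → ℕ) {a e : ℕ} (ha : a ≤ sigCount I.k) :
    Anc (I.above g) e a ↔ ∃ i < sigCount I.k + 1, (I.above g)^[i] a = e := by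
  constructor
  · rintro ⟨i, rfl⟩
    by_cases hi : i < sigCount I.k + 1
    · exact ⟨i, hi, rfl⟩
    · refine ⟨sigCount I.k, by omega, ?_⟩
      have h1 := iterate_above_le (I := I) g a i
      have h2 := iterate_above_le (I := I) g a (sigCount I.k)
      omega
  · rintro ⟨i, _, h⟩
    exact ⟨i, h⟩

theorem run_mark (hR : Ready I σ) (hg : σ.nats 9 = g) {b src a : ℕ}
    (hb : b ∉ [0, 3, 4, 5, 6, 7, 8, 9, 10, 33, 34, src]) (hsrc : src ∉ [33, 34])
    (ha : σ.nats src 0 = a) (haQ : a ≤ sigCount I.k) :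
    Run (markProgram b src) σ (markTime I.k) (fun σ' => ∀ e ≤ sigCount I.k,
      (σ'.nats b e = 1 ↔ Anc (I.above g) e a)) := by
  simp only [List.mem_cons, List.not_mem_nil, or_false, not_or] at hb hsrc
  obtain ⟨b0, b3, b4, b5, b6, b7, b8, b9, b10, b33, b34, bs⟩ := hb
  obtain ⟨s33, s34⟩ := hsrc
  have hW : ∀ x ∈ [0, 3, 4, 5, 6, 7, 8, 10], x ∉ [33, 34, b] := by
    intro x hx
    simp only [List.mem_cons, List.not_mem_nil, or_false, not_or] at hx ⊢
    omega
  have hW' : ∀ x ∈ [0, 1, 2, 3], x ∉ ([] : List ℕ) := by simp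
  refine Run.seqAgree (Q' := fun σ' => ∀ e < sigCount I.k + 1, σ'.nats b e = 0)
    (Run.forLoop (N := sigCount I.k + 1) (B := 4) (Inv := fun i σ' => ∀ e < i, σ'.nats b e = 0)
      ?_ ?_ ?_ (by simp) ?_ (fun _ _ h => h)) ?_
  · simpa [Program.natWrites] using Ne.symm b34
  · intro σ' ag
    have := (hR.agree (ag.mono (wn' := [33, 34, b]) (wr' := []) (by simp [Program.natWrites])
      (by simp [Program.realWrites])) hW hW').Q
    simp [NatExpr.eval, this]
  · intro i σ' v h
    simpa [b34] using h
  · intro i σ' hi ag h34 h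
    refine (run_of_loopFree (c := .setNat b (rd 34) (.const 0)) rfl ?_).mono le_rfl fun _ h => h
    intro e he
    simp only [Program.step, NatExpr.eval, h34, storeNat_nats, if_true, Function.update_apply]
    split_ifs with hei
    · rfl
    · exact h e (by omega)
  intro σ₁ ag₁ h0
  have ag₁' : Agree [33, 34, b] [] σ σ₁ := ag₁.mono
    (by simp [forLoop, Program.natWrites]) (by simp [forLoop, Program.realWrites])
  refine Run.seqAgree (Q' := fun σ' => σ'.nats 33 0 = a) (run_of_loopFree rfl ?_) ?_
  · have : σ₁.nats src 0 = a := by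
      rw [ag₁'.1 src (by simp [s33, s34, Ne.symm bs]), ha]
    simp [Program.step, NatExpr.eval, this]
  intro σ₂ ag₂ h33
  have ag₂' : Agree [33, 34, b] [] σ σ₂ := ag₁'.trans (ag₂.mono
    (by simp [Program.natWrites]) (by simp [Program.realWrites]))
  refine Run.forLoop (N := sigCount I.k + 1) (B := 18) (Inv := fun i σ' =>
    σ'.nats 33 0 = (I.above g)^[i] a ∧
    ∀ e ≤ sigCount I.k, (σ'.nats b e = 1 ↔ ∃ i' < i, (I.above g)^[i'] a = e)) ?_ ?_ ?_ ?_ ?_ ?_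
  · simpa [Program.natWrites] using Ne.symm b34
  · intro σ' ag
    have := (hR.agree (ag₂'.trans (ag.mono (by simp [Program.natWrites])
      (by simp [Program.realWrites]))) hW hW').Q
    simp [NatExpr.eval, this]
  · intro i σ' v h
    simpa [b34] using h
  · refine ⟨h33, fun e he => ?_⟩
    rw [ag₂.1 b (by simpa [Program.natWrites] using b33), h0 e (by omega)]
    simp
  · rintro i σ' hi ag _ ⟨h1, h2⟩
    have ag' : Agree [33, 34, b] [] σ σ' := ag₂'.trans (ag.mono (by simp [Program.natWrites])
      (by simp [Program.realWrites]))
    have hR' := hR.agree ag' hW hW'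
    have g9 : σ'.nats 9 = g := by rw [ag'.1 9 (by simp [Ne.symm b9]), hg]
    refine (run_of_loopFree (c := .seq (.setNat b (rd 33) (.const 1))
      (put 33 (.minus (.minus (rd 33) (.const 1)) (.read 9 (.plus (rd 6) (rd 33)))))) rfl ?_).mono
      (by simp [Program.cost, NatExpr.cost]) fun _ h => h
    have hle : (I.above g)^[i] a ≤ sigCount I.k := by
      have := iterate_above_le (I := I) g a i
      omega
    constructor
    · rw [Function.iterate_succ_apply']
      simp [Program.step, NatExpr.eval, h1, g9, hR'.offA, Ne.symm b33, Ne.symm b9, Ne.symm b6]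
      rw [Instance.above, if_pos hle]
    · intro e he
      have hb' : ∀ e, ((Program.seq (.setNat b (rd 33) (.const 1)) (put 33 (.minus (.minus (rd 33)
          (.const 1)) (.read 9 (.plus (rd 6) (rd 33)))))).step σ').nats b e =
          if e = (I.above g)^[i] a then 1 else σ'.nats b e := by
        intro e
        simp [Program.step, NatExpr.eval, h1, b33, Function.update_apply]
      rw [hb']
      by_cases hei : e = (I.above g)^[i] a
      · rw [if_pos hei]
        exact ⟨fun _ => ⟨i, by omega, hei.symm⟩, fun _ => rfl⟩
      · rw [if_neg hei, h2 e he]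
        constructor
        · rintro ⟨i', hi', h⟩
          exact ⟨i', by omega, h⟩
        · rintro ⟨i', hi', h⟩
          refine ⟨i', ?_, h⟩
          rcases Nat.lt_succ_iff_lt_or_eq.1 hi' with h' | rfl
          · exact h'
          · exact absurd h.symm hei
  · rintro σ' _ ⟨_, h⟩ e he
    rw [h e he, anc_above_iff g haQ]

end MMST

/-! ### The test of a guess and the length of its tree -/

namespace RealRAM

theorem agree_step {c : Program} (hc : c.loopFree = true) (σ : State) :
    Agree c.natWrites c.realWrites σ (c.step σ) := by
  obtain ⟨_, _, e⟩ := exec_step c hc σ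
  exact e.agree

end RealRAM

namespace MMST

open RealRAM

variable {I : Instance} {g par : ℕ → ℕ} {σ : State}

/-- Whether the colour of the current point is marked in bank `b` and not in bank `b'`, and the
point `u` does not precede the point `w` in the current direction. -/
def edgeTest (b b' : ℕ) (u w : NatExpr) : Test :=
  .both (.both (.natLt (.const 0) (rd 29)) (.natEq (.read b (.read 12 (rd 29))) (.const 1)))
    (.both (.neg (.natEq (.read b' (.read 12 (rd 29))) (.const 1)))
      (.neg (.realLt (valExpr (.read 9 (rd 31)) u) (valExpr (.read 9 (rd 31)) w))))

/-- Invalidate the guess if the edge from the current point to its parent runs the wrong way on a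
path from the end of chain `a` to the end of chain `a'`. The path climbs this edge if the colour of
the point is above `a` but not above `a'`, and descends it if it is above `a'` but not above `a`. -/
def checkEdge : Program :=
  .seq (.branch (edgeTest 19 20 (rd 29) (.read 13 (rd 29))) (put 18 (.const 0)) .skip)
    (.branch (edgeTest 20 19 (.read 13 (rd 29)) (rd 29)) (put 18 (.const 0)) .skip)

/-- Check all edges for the current pair of chains. -/
def checkPair : Program :=
  .seq (markProgram 20 28) (.seq (forLoop 29 (rd 0) checkEdge) (put 31 (.plus (rd 31) (.const 1))))

/-- Test the guess; the variable in bank `18` tells the result, the one in bank `31` runs through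
the table of directions. -/
def checkProgram : Program :=
  .seq (.seq (put 18 (.const 1)) (put 31 (rd 7)))
  (forLoop 27 (.plus (rd 4) (.const 1))
    (.seq (markProgram 19 27) (forLoop 28 (.plus (rd 4) (.const 1)) checkPair)))

/-- The part of the test of a guess that concerns one edge and one pair of chains. -/
def PassesAt (I : Instance) (g par : ℕ → ℕ) (a a' v : ℕ) : Prop :=
  v ≠ 0 →
    (Anc (I.above g) (I.colour g v) a → ¬ Anc (I.above g) (I.colour g v) a' →
      I.val (I.cert g a a') v < I.val (I.cert g a a') (par v)) ∧
    (¬ Anc (I.above g) (I.colour g v) a → Anc (I.above g) (I.colour g v) a' →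
      I.val (I.cert g a a') (par v) < I.val (I.cert g a a') v)

theorem step_check {t : Test} :
    ((Program.branch t (put 18 (.const 0)) .skip).step σ).nats 18 0 = 1 ↔
      σ.nats 18 0 = 1 ∧ ¬ t.Holds σ := by
  by_cases h : t.Holds σ <;> simp [Program.step, NatExpr.eval, h]

theorem holds_edgeTest (hR : Ready I σ) {b b' : ℕ} {u w : NatExpr} {A B : Prop} {v j : ℕ}
    (hv : σ.nats 29 0 = v) (hj : σ.nats 9 (σ.nats 31 0) = j)
    (hb : σ.nats b (σ.nats 12 v) = 1 ↔ A) (hb' : σ.nats b' (σ.nats 12 v) = 1 ↔ B) :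
    ¬ (edgeTest b b' u w).Holds σ ↔
      (v ≠ 0 → A → ¬ B → I.val j (u.eval σ) < I.val j (w.eval σ)) := by
  simp only [edgeTest, Test.Holds, hR.eval_valExpr, NatExpr.eval, hv, hj, hb, hb',
    Nat.pos_iff_ne_zero]
  tauto

theorem step_checkEdge (hR : Ready I σ) {a a' v : ℕ} (hv : σ.nats 29 0 = v)
    (hg : σ.nats 9 = g) (hpar : σ.nats 13 = par)
    (hj : σ.nats 31 0 = offC I.k + (a * (sigCount I.k + 1) + a'))
    (h19 : σ.nats 19 (σ.nats 12 v) = 1 ↔ Anc (I.above g) (I.colour g v) a)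
    (h20 : σ.nats 20 (σ.nats 12 v) = 1 ↔ Anc (I.above g) (I.colour g v) a') :
    (checkEdge.step σ).nats 18 0 = 1 ↔ σ.nats 18 0 = 1 ∧ PassesAt I g par a a' v := by
  set c := Program.branch (edgeTest 19 20 (rd 29) (.read 13 (rd 29))) (put 18 (.const 0)) .skip
    with hc
  have ag : Agree [18] [] σ (c.step σ) := (agree_step rfl σ).mono (by decide) (by decide)
  have hcert : σ.nats 9 (σ.nats 31 0) = I.cert g a a' := by rw [hj, hg, Instance.cert]
  have e : ∀ b, b ≠ 18 → (c.step σ).nats b = σ.nats b := fun b hb => ag.1 b (by simpa using hb)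
  rw [checkEdge, ← hc, Program.step, step_check, holds_edgeTest (hR.agree ag (by decide)
    (by decide)) (v := v) (j := I.cert g a a') (A := Anc (I.above g) (I.colour g v) a')
    (B := Anc (I.above g) (I.colour g v) a), hc, step_check,
    holds_edgeTest hR hv hcert h19 h20, ← hc]
  · simp only [NatExpr.eval, e 29 (by decide), e 13 (by decide), hv, hpar, PassesAt]
    tauto
  · rw [e 29 (by decide), hv]
  · rw [e 9 (by decide), e 31 (by decide), hcert]
  · rw [e 20 (by decide), e 12 (by decide), h20]
  · rw [e 19 (by decide), e 12 (by decide), h19]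

/-- A bound for the number of steps of the check of all edges for a pair of chains. -/
def pairTime (n k : ℕ) : ℕ := markTime k + (forTime n checkEdge.cost 2 + 6)

theorem run_checkPair (hR : Ready I σ) {a a' : ℕ} (hg : σ.nats 9 = g) (hpar : σ.nats 13 = par)
    (hcol : ∀ v < I.n, σ.nats 12 v = I.colour g v) (hle : ∀ v < I.n, I.colour g v ≤ sigCount I.k)
    (h28 : σ.nats 28 0 = a') (ha' : a' ≤ sigCount I.k)
    (hj : σ.nats 31 0 = offC I.k + (a * (sigCount I.k + 1) + a'))
    (h19 : ∀ e ≤ sigCount I.k, (σ.nats 19 e = 1 ↔ Anc (I.above g) e a)) :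
    Run checkPair σ (pairTime I.n I.k) (fun σ' =>
      (σ'.nats 18 0 = 1 ↔ σ.nats 18 0 = 1 ∧ ∀ v < I.n, PassesAt I g par a a' v) ∧
      σ'.nats 31 0 = offC I.k + (a * (sigCount I.k + 1) + (a' + 1))) := by
  refine Run.seqAgree (run_mark hR hg (by decide) (by decide) h28 ha') ?_
  intro σ₁ ag₁ h20
  have hR₁ := hR.agree ag₁ (by decide) (by decide)
  refine Run.seqAgree (Q' := fun σ' => (σ'.nats 18 0 = 1 ↔ σ.nats 18 0 = 1 ∧
    ∀ v < I.n, PassesAt I g par a a' v))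
    (Run.forLoop (N := I.n) (Inv := fun i σ' => (σ'.nats 18 0 = 1 ↔ σ.nats 18 0 = 1 ∧
      ∀ v < i, PassesAt I g par a a' v)) (by decide) ?_ ?_ ?_ ?_ (fun _ _ h => h)) ?_
  · intro σ' ag
    exact (hR₁.agree ag (by decide) (by decide)).n
  · intro i σ' v h
    simpa using h
  · rw [ag₁.1 18 (by decide)]
    simp
  · intro i σ' hi ag h29 h
    refine run_of_loopFree rfl ?_
    have e : ∀ b ∈ [9, 12, 13, 19, 31], σ'.nats b = σ.nats b := by
      intro b hb
      rw [ag.1 b (by revert b; decide), ag₁.1 b (by revert b; decide)]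
    rw [step_checkEdge (hR₁.agree ag (by decide) (by decide)) h29 (by rw [e 9 (by decide), hg])
      (by rw [e 13 (by decide), hpar]) (by rw [e 31 (by decide), hj]), h, and_assoc]
    · refine and_congr_right fun _ => ⟨fun h v hv => ?_, fun h => ⟨fun v hv => h v (by omega),
        h i (by omega)⟩⟩
      rcases Nat.lt_succ_iff_lt_or_eq.1 hv with h' | rfl
      · exact h.1 v h'
      · exact h.2
    · rw [e 12 (by decide), e 19 (by decide), hcol i hi, h19 _ (hle i hi)]
    · rw [e 12 (by decide), ag.1 20 (by decide), hcol i hi, h20 _ (hle i hi)]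
  · intro σ₂ ag₂ h
    refine (run_of_loopFree (c := put 31 (.plus (rd 31) (.const 1))) rfl ?_).mono
      (le_of_eq (by rfl)) fun _ h => h
    refine ⟨?_, ?_⟩
    · simpa [Program.step] using h
    · have : σ₂.nats 31 0 = offC I.k + (a * (sigCount I.k + 1) + a') := by
        rw [ag₂.1 31 (by decide), ag₁.1 31 (by decide), hj]
      simp [Program.step, NatExpr.eval, this]
      omega

/-- A bound for the number of steps of the test of a guess. -/
def checkTime (n k : ℕ) : ℕ :=
  3 + 4 + forTime (sigCount k + 1) (markTime k + forTime (sigCount k + 1) (pairTime n k) 4) 4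

theorem run_check (hR : Ready I σ) (hg : σ.nats 9 = g) (hpar : σ.nats 13 = par)
    (hcol : ∀ v < I.n, σ.nats 12 v = I.colour g v)
    (hle : ∀ v < I.n, I.colour g v ≤ sigCount I.k) :
    Run checkProgram σ (checkTime I.n I.k) (fun σ' => σ'.nats 18 0 = 1 ↔ I.GuessPasses g par) := by
  refine Run.seqAgree (T₁ := 3 + 4) (Q' := fun σ' => σ'.nats 18 0 = 1 ∧ σ'.nats 31 0 = offC I.k)
    ((run_of_loopFree rfl ?_).mono (by decide) fun _ h => h) ?_
  · simp [Program.step, NatExpr.eval, hR.offC]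
  rintro σ₁ ag₁ ⟨h18, h31⟩
  have hR₁ := hR.agree ag₁ (by decide) (by decide)
  refine Run.forLoop (N := sigCount I.k + 1) (Inv := fun a σ' =>
    (σ'.nats 18 0 = 1 ↔ ∀ b < a, ∀ a' < sigCount I.k + 1, ∀ v < I.n, PassesAt I g par b a' v) ∧
    σ'.nats 31 0 = offC I.k + a * (sigCount I.k + 1)) (by decide) ?_ ?_ ?_ ?_ ?_
  · intro σ' ag
    simp [NatExpr.eval, (hR₁.agree ag (by decide) (by decide)).Q]
  · intro i σ' v h
    simpa using h
  · simp [h18, h31]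
  · rintro a σ₂ ha ag₂ h27 ⟨hok, hj⟩
    have hR₂ := hR₁.agree ag₂ (by decide) (by decide)
    have e : ∀ b ∈ [9, 12, 13], σ₂.nats b = σ.nats b := by
      intro b hb
      rw [ag₂.1 b (by revert b; decide), ag₁.1 b (by revert b; decide)]
    refine Run.seqAgree (run_mark hR₂ (by rw [e 9 (by decide), hg]) (by decide) (by decide)
      h27 (by omega)) ?_
    intro σ₃ ag₃ h19
    have hR₃ := hR₂.agree ag₃ (by decide) (by decide)
    refine Run.forLoop (N := sigCount I.k + 1) (Inv := fun a' σ' =>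
      (σ'.nats 18 0 = 1 ↔ σ₂.nats 18 0 = 1 ∧ ∀ b' < a', ∀ v < I.n, PassesAt I g par a b' v) ∧
      σ'.nats 31 0 = offC I.k + (a * (sigCount I.k + 1) + a')) (by decide) ?_ ?_ ?_ ?_ ?_
    · intro σ' ag
      simp [NatExpr.eval, (hR₃.agree ag (by decide) (by decide)).Q]
    · intro i σ' v h
      simpa using h
    · rw [ag₃.1 18 (by decide), ag₃.1 31 (by decide)]
      simp [hj]
    · rintro a' σ₄ ha' ag₄ h28 ⟨hok', hj'⟩
      have e' : ∀ b ∈ [9, 12, 13], σ₄.nats b = σ.nats b := by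
        intro b hb
        rw [ag₄.1 b (by revert b; decide), ag₃.1 b (by revert b; decide), e b hb]
      refine (run_checkPair (hR₃.agree ag₄ (by decide) (by decide)) (g := g) (par := par) ?_ ?_ ?_
        hle h28 (by omega) hj' ?_).mono le_rfl ?_
      · rw [e' 9 (by decide), hg]
      · rw [e' 13 (by decide), hpar]
      · rw [e' 12 (by decide)]; exact hcol
      · rw [ag₄.1 19 (by decide)]; exact h19
      · rintro σ' ⟨h1, h2⟩
        refine ⟨?_, h2⟩
        rw [h1, hok', and_assoc]
        refine and_congr_right fun _ => ⟨fun h b hb => ?_, fun h => ⟨fun v hv => h v (by omega),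
          h a' (by omega)⟩⟩
        rcases Nat.lt_succ_iff_lt_or_eq.1 hb with h' | rfl
        · exact h.1 b h'
        · exact h.2
    · rintro σ' _ ⟨h1, h2⟩
      refine ⟨?_, by rw [h2, Nat.add_mul a 1, one_mul]⟩
      rw [h1, hok]
      refine ⟨fun h b hb => ?_, fun h => ⟨fun v hv => h v (by omega), h a (by omega)⟩⟩
      rcases Nat.lt_succ_iff_lt_or_eq.1 hb with h' | rfl
      · exact h.1 b h'
      · exact h.2
  · rintro σ' _ ⟨h, _⟩
    rw [h]
    simp only [Nat.lt_succ_iff, Instance.GuessPasses, PassesAt]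

theorem forTime_pred_le (n B e : ℕ) : forTime (n - 1) B e ≤ forTime n B e := by
  have := Nat.mul_le_mul_right (B + 6 + (e + 3) + 1) (Nat.sub_le n 1)
  unfold forTime
  omega

/-- Compute the length of the tree of the guess. -/
def lengthProgram : Program :=
  .seq (.setReal 5 (.const 0) (.const 0))
  (forLoop 29 (.minus (rd 0) (.const 1)) (.setReal 5 (.const 0)
    (.plus (.read 5 (.const 0)) (.sqrt (.plus
      (.times (.minus (.read 0 (.plus (rd 29) (.const 1)))
          (.read 0 (.read 13 (.plus (rd 29) (.const 1)))))
        (.minus (.read 0 (.plus (rd 29) (.const 1)))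
          (.read 0 (.read 13 (.plus (rd 29) (.const 1))))))
      (.times (.minus (.read 1 (.plus (rd 29) (.const 1)))
          (.read 1 (.read 13 (.plus (rd 29) (.const 1)))))
        (.minus (.read 1 (.plus (rd 29) (.const 1)))
          (.read 1 (.read 13 (.plus (rd 29) (.const 1)))))))))))

/-- A bound for the number of steps of the computation of the length. -/
def lengthTime (n : ℕ) : ℕ := 3 + forTime n 60 4

theorem run_length (hR : Ready I σ) (hpar : σ.nats 13 = par) :
    Run lengthProgram σ (lengthTime I.n) (fun σ' => σ'.reals 5 0 = I.treeLength par) := by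
  refine Run.seqAgree (Q' := fun σ' => σ'.reals 5 0 = 0) (run_of_loopFree rfl ?_) ?_
  · simp [Program.step, RealExpr.eval, NatExpr.eval]
  intro σ₁ ag₁ h5
  have hR₁ := hR.agree ag₁ (by decide) (by decide)
  refine Run.mono ?_ (forTime_pred_le _ _ _) fun _ h => h
  refine Run.forLoop (N := I.n - 1) (B := 60) (Inv := fun i σ' => σ'.reals 5 0 =
    ∑ i ∈ Finset.range i, Real.sqrt
      ((I.px (i + 1) - I.px (par (i + 1))) * (I.px (i + 1) - I.px (par (i + 1))) +
      (I.py (i + 1) - I.py (par (i + 1))) * (I.py (i + 1) - I.py (par (i + 1)))))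
    (by decide) ?_ ?_ ?_ ?_ (fun _ _ h => h)
  · intro σ' ag
    simp [NatExpr.eval, (hR₁.agree ag (by decide) (by decide)).n]
  · intro i σ' v h
    simpa using h
  · simp [h5]
  · intro i σ' hi ag h29 h
    refine (run_of_loopFree rfl ?_).mono (by decide) fun _ h => h
    have hR' := hR₁.agree ag (by decide) (by decide)
    have e : σ'.nats 13 = par := by rw [ag.1 13 (by decide), ag₁.1 13 (by decide), hpar]
    rw [Finset.sum_range_succ, ← h]
    simp [Program.step, RealExpr.eval, NatExpr.eval, h29, e, hR'.px, hR'.py]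

/-- Record the tree of the guess if it is the best so far. -/
def recordProgram : Program :=
  .branch (.both (.natEq (rd 18) (.const 1)) (.neg (.both (.natEq (rd 17) (.const 1))
      (.neg (.realLt (.read 5 (.const 0)) (.read 6 (.const 0)))))))
    (.seq (.seq (.setReal 6 (.const 0) (.read 5 (.const 0))) (put 17 (.const 1)))
      (forLoop 29 (.minus (rd 0) (.const 1)) (.seq
        (.setNat 1 (rd 29) (.plus (rd 29) (.const 1)))
        (.setNat 2 (rd 29) (.read 13 (.plus (rd 29) (.const 1)))))))
    .skip

/-- Some tree with parent function `par` is recorded in the memory, with its length. -/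
def Recorded (I : Instance) (σ : State) (par : ℕ → ℕ) : Prop :=
  σ.nats 17 0 = 1 ∧ σ.reals 6 0 = I.treeLength par ∧
    (∀ i < I.n - 1, σ.nats 1 i = i + 1) ∧ ∀ i < I.n - 1, σ.nats 2 i = par (i + 1)

theorem Recorded.congr {σ' : State} (h : Recorded I σ par) (h17 : σ'.nats 17 = σ.nats 17)
    (h1 : σ'.nats 1 = σ.nats 1) (h2 : σ'.nats 2 = σ.nats 2) (h6 : σ'.reals 6 = σ.reals 6) :
    Recorded I σ' par := by
  unfold Recorded
  rw [h17, h1, h2, h6]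
  exact h

/-- A bound for the number of steps of the recording of a tree. -/
def recordTime (n : ℕ) : ℕ := 20 + (10 + forTime n 20 4)

open Classical in
theorem run_record (hR : Ready I σ) (hpar : σ.nats 13 = par) {P : Prop}
    (hok : σ.nats 18 0 = 1 ↔ P) (hlen : σ.reals 5 0 = I.treeLength par) :
    Run recordProgram σ (recordTime I.n) (fun σ' =>
      if P ∧ ¬ (σ.nats 17 0 = 1 ∧ σ.reals 6 0 ≤ I.treeLength par) then Recorded I σ' par
      else σ' = σ) := by
  have htest : (Test.both (.natEq (rd 18) (.const 1)) (.neg (.both (.natEq (rd 17) (.const 1))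
      (.neg (.realLt (.read 5 (.const 0)) (.read 6 (.const 0))))))).Holds σ ↔
      P ∧ ¬ (σ.nats 17 0 = 1 ∧ σ.reals 6 0 ≤ I.treeLength par) := by
    simp [Test.Holds, NatExpr.eval, RealExpr.eval, hok, hlen]
  refine Run.mono (Run.branch (T := 10 + forTime I.n 20 4) ?_ ?_) ?_ (fun _ h => h)
  · intro h
    rw [htest] at h
    simp only [if_pos h]
    refine Run.seqAgree (T₁ := 10) (Q' := fun σ' => σ'.nats 17 0 = 1 ∧
      σ'.reals 6 0 = I.treeLength par) ((run_of_loopFree rfl ?_).mono (by decide) fun _ h => h) ?_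
    · simp [Program.step, NatExpr.eval, RealExpr.eval, hlen]
    rintro σ₁ ag₁ ⟨h17, h6⟩
    have hR₁ := hR.agree ag₁ (by decide) (by decide)
    refine Run.mono ?_ (forTime_pred_le _ _ _) fun _ h => h
    refine Run.forLoop (N := I.n - 1) (B := 20) (Inv := fun i σ' =>
      (∀ v < i, σ'.nats 1 v = v + 1) ∧ ∀ v < i, σ'.nats 2 v = par (v + 1))
      (by decide) ?_ ?_ (by simp) ?_ ?_
    · intro σ' ag
      simp [NatExpr.eval, (hR₁.agree ag (by decide) (by decide)).n]
    · intro i σ' v h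
      simpa using h
    · rintro i σ' hi ag h29 ⟨h1, h2⟩
      refine (run_of_loopFree rfl ?_).mono (by decide) fun _ h => h
      have e : σ'.nats 13 = par := by rw [ag.1 13 (by decide), ag₁.1 13 (by decide), hpar]
      simp only [Program.step, NatExpr.eval, h29, storeNat_nats]
      simp only [Nat.reduceEqDiff, if_true, if_false, e, h29]
      constructor <;> intro v hv <;> rw [Function.update_apply] <;> split_ifs with hvi
      · rw [hvi]
      · exact h1 v (by omega)
      · rw [hvi]
      · exact h2 v (by omega)
    · rintro σ' ag ⟨h1, h2⟩
      exact ⟨by rw [ag.1 17 (by decide), h17], by rw [ag.2 6 (by decide), h6], h1, h2⟩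
  · intro h
    rw [htest] at h
    simp only [if_neg h]
    exact (run_of_loopFree (c := .skip) (Q := fun σ' => σ' = σ) rfl rfl).mono
      (by simp [Program.cost]; omega) fun _ h => h
  · simp [recordTime, Test.cost, NatExpr.cost, RealExpr.cost]

/-- The treatment of a guess. -/
def guessProgram : Program :=
  .seq colourProgram (.seq layoutProgram (.seq checkProgram (.seq lengthProgram recordProgram)))

/-- A bound for the number of steps of the treatment of a guess. -/
def guessTime (n k : ℕ) : ℕ :=
  colourTime n k + (layoutTime n k + (checkTime n k + (lengthTime n + recordTime n)))

open Classical in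
theorem run_guess (hR : Ready I σ) (hg : σ.nats 9 = g)
    (hrange : ∀ i < guessLen I.k, g i < radix I.n I.k i) :
    Run guessProgram σ (guessTime I.n I.k) (fun σ' => ∃ par, I.GuessLayout g par ∧
      if I.GuessPasses g par ∧ ¬ (σ.nats 17 0 = 1 ∧ σ.reals 6 0 ≤ I.treeLength par)
      then Recorded I σ' par
      else σ'.nats 17 = σ.nats 17 ∧ σ'.reals 6 = σ.reals 6 ∧
        ∀ par', Recorded I σ par' → Recorded I σ' par') := by
  refine Run.seqAgree (run_colour hR hg) ?_
  intro σ₁ ag₁ hcol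
  have hR₁ := hR.agree ag₁ (by decide) (by decide)
  have e₁ : σ₁.nats 9 = g := by rw [ag₁.1 9 (by decide), hg]
  refine Run.seqAgree (run_layout hR₁ e₁ hcol) ?_
  intro σ₂ ag₂ hlay
  have hR₂ := hR₁.agree ag₂ (by decide) (by decide)
  have e₂ : σ₂.nats 9 = g := by rw [ag₂.1 9 (by decide), e₁]
  have hcol₂ : ∀ v < I.n, σ₂.nats 12 v = I.colour g v := by
    rw [ag₂.1 12 (by decide)]; exact hcol
  refine Run.seqAgree (run_check hR₂ e₂ rfl hcol₂ fun v hv =>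
    (Instance.colouring hrange).le ⟨v, hv⟩) ?_
  intro σ₃ ag₃ hok
  have hR₃ := hR₂.agree ag₃ (by decide) (by decide)
  have e₃ : σ₃.nats 13 = σ₂.nats 13 := ag₃.1 13 (by decide)
  refine Run.seqAgree (run_length hR₃ e₃) ?_
  intro σ₄ ag₄ hlen
  have hR₄ := hR₃.agree ag₄ (by decide) (by decide)
  refine (run_record hR₄ (P := I.GuessPasses g (σ₂.nats 13)) (by rw [ag₄.1 13 (by decide), e₃])
    (by rw [ag₄.1 18 (by decide), hok]) hlen).mono le_rfl ?_
  have f : ∀ b ∈ [1, 2, 17], σ₄.nats b = σ.nats b := by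
    intro b hb
    rw [ag₄.1 b (by revert b; decide), ag₃.1 b (by revert b; decide),
      ag₂.1 b (by revert b; decide), ag₁.1 b (by revert b; decide)]
  have f6 : σ₄.reals 6 = σ.reals 6 := by
    rw [ag₄.2 6 (by decide), ag₃.2 6 (by decide), ag₂.2 6 (by decide), ag₁.2 6 (by decide)]
  intro σ' h
  refine ⟨_, hlay, ?_⟩
  rw [f 17 (by decide), f6] at h
  split_ifs at h ⊢ with hc
  · exact h
  · rw [h]
    refine ⟨f 17 (by decide), f6, fun par' h' => ?_⟩
    exact h'.congr (f 17 (by decide)) (f 1 (by decide)) (f 2 (by decide)) f6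

end MMST

/-! ### The enumeration of all guesses -/

namespace MMST

open RealRAM

/-- The weight of the digit at position `i` in a mixed radix system. -/
def weight (R : ℕ → ℕ) : ℕ → ℕ
  | 0 => 1
  | i + 1 => weight R i * R i

/-- The number with the digits `G 0, …, G (i - 1)`, least significant digit first. -/
def digitValue (R G : ℕ → ℕ) : ℕ → ℕ
  | 0 => 0
  | i + 1 => digitValue R G i + G i * weight R i

/-- `G` is a digit string of length `L`, padded with zeros. -/
def IsDigits (R : ℕ → ℕ) (L : ℕ) (G : ℕ → ℕ) : Prop :=
  (∀ i < L, G i < R i) ∧ ∀ i, L ≤ i → G i = 0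

variable {R G G' : ℕ → ℕ} {L : ℕ}

theorem digitValue_lt {m : ℕ} (h : ∀ i < m, G i < R i) : digitValue R G m < weight R m := by
  induction m with
  | zero => simp [digitValue, weight]
  | succ m ih =>
    have h1 := ih fun i hi => h i (by omega)
    have h2 := h m (by omega)
    have h3 : (G m + 1) * weight R m ≤ R m * weight R m := Nat.mul_le_mul_right _ h2
    rw [Nat.add_mul, one_mul, mul_comm (R m)] at h3
    rw [digitValue, weight]
    omega

theorem digitValue_inj {m : ℕ} (h : ∀ i < m, G i < R i) (h' : ∀ i < m, G' i < R i)
    (he : digitValue R G m = digitValue R G' m) : ∀ i < m, G i = G' i := by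
  induction m with
  | zero => simp
  | succ m ih =>
    have h1 := digitValue_lt (m := m) (fun i hi => h i (by omega))
    have h2 := digitValue_lt (m := m) (fun i hi => h' i (by omega))
    rw [digitValue, digitValue] at he
    have hdiv := congrArg (· / weight R m) he
    have hmod := congrArg (· % weight R m) he
    simp only [Nat.add_mul_mod_self_right, Nat.mod_eq_of_lt h1, Nat.mod_eq_of_lt h2] at hmod
    simp only [Nat.add_mul_div_right _ _ (Nat.zero_lt_of_lt h1), Nat.div_eq_of_lt h1,
      Nat.div_eq_of_lt h2, zero_add] at hdiv
    intro i hi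
    rcases Nat.lt_succ_iff_lt_or_eq.1 hi with hi | rfl
    · exact ih (fun i hi => h i (by omega)) (fun i hi => h' i (by omega)) hmod i hi
    · exact hdiv

theorem IsDigits.ext (h : IsDigits R L G) (h' : IsDigits R L G')
    (he : digitValue R G L = digitValue R G' L) : G = G' := by
  funext i
  by_cases hi : i < L
  · exact digitValue_inj h.1 h'.1 he i hi
  · rw [h.2 i (by omega), h'.2 i (by omega)]

theorem digitValue_of_zero {m : ℕ} (h : ∀ i < m, G i = 0) : digitValue R G m = 0 := by
  induction m with
  | zero => rfl
  | succ m ih => rw [digitValue, ih fun i hi => h i (by omega), h m (by omega)]; simp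

theorem digitValue_of_max {m : ℕ} (h : ∀ i < m, G i + 1 = R i) :
    digitValue R G m + 1 = weight R m := by
  induction m with
  | zero => rfl
  | succ m ih =>
    have h1 := ih fun i hi => h i (by omega)
    rw [digitValue, weight, ← h m (by omega), mul_comm, mul_add, ← h1]
    ring

/-- The carry rule. -/
theorem digitValue_increment {i m : ℕ} (him : i < m) (hmax : ∀ l < i, G l + 1 = R l)
    (hzero : ∀ l < i, G' l = 0) (hi : G' i = G i + 1) (hsame : ∀ l, i < l → G' l = G l) :
    digitValue R G' m = digitValue R G m + 1 := by
  induction m with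
  | zero => omega
  | succ m ih =>
    rcases Nat.lt_succ_iff_lt_or_eq.1 him with h | rfl
    · rw [digitValue, digitValue, ih h, hsame m h]
      ring
    · rw [digitValue, digitValue, digitValue_of_zero hzero, hi, Nat.add_mul, one_mul,
        ← digitValue_of_max hmax]
      ring

variable {I : Instance} {σ : State}

/-- Whether the digit at the current position exists and has its largest value. -/
def carryTest : Test :=
  .both (.natLt (rd 35) (rd 8))
    (.neg (.natLt (.plus (.read 9 (rd 35)) (.const 1)) (.read 10 (rd 35))))

/-- Replace the guess by its successor; bank `11` is set if there is none. -/
def odometer : Program :=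
  .seq (put 35 (.const 0))
  (.seq (.loop carryTest
    (.seq (.setNat 9 (rd 35) (.const 0)) (put 35 (.plus (rd 35) (.const 1)))))
  (.branch (.natLt (rd 35) (rd 8))
    (.setNat 9 (rd 35) (.plus (.read 9 (rd 35)) (.const 1))) (put 11 (.const 1))))

/-- A bound for the number of steps of the computation of the next guess. -/
def odometerTime (k : ℕ) : ℕ := 3 + ((guessLen k * (15 + 16 + 1) + 16 + 1) + 30)

theorem run_odometer (hR : Ready I σ) (hG : σ.nats 9 = G) (h11 : σ.nats 11 0 = 0)
    (hd : IsDigits (radix I.n I.k) (guessLen I.k) G) :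
    Run odometer σ (odometerTime I.k) (fun σ' =>
      (σ'.nats 11 0 = 0 ∧ IsDigits (radix I.n I.k) (guessLen I.k) (σ'.nats 9) ∧
        digitValue (radix I.n I.k) (σ'.nats 9) (guessLen I.k) =
          digitValue (radix I.n I.k) G (guessLen I.k) + 1) ∨
      (σ'.nats 11 0 = 1 ∧
        digitValue (radix I.n I.k) G (guessLen I.k) + 1 =
          weight (radix I.n I.k) (guessLen I.k))) := by
  obtain ⟨L, hL⟩ : ∃ L, L = guessLen I.k := ⟨_, rfl⟩
  obtain ⟨R, hRad⟩ : ∃ R, R = radix I.n I.k := ⟨_, rfl⟩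
  have htime : odometerTime I.k =
      3 + ((L * (15 + carryTest.cost + 1) + carryTest.cost + 1) + 30) := by
    rw [odometerTime, hL, show carryTest.cost = 16 from rfl]
  rw [htime]
  rw [← hL, ← hRad] at hd ⊢
  refine Run.seqAgree (Q' := fun σ' => σ'.nats 35 0 = 0) (run_of_loopFree rfl ?_) ?_
  · simp [Program.step, NatExpr.eval]
  intro σ₁ ag₁ h35
  have hR₁ := hR.agree ag₁ (by decide) (by decide)
  have htest : ∀ σ', Ready I σ' → ∀ i, σ'.nats 35 0 = i → σ'.nats 9 i = G i →
      (carryTest.Holds σ' ↔ i < L ∧ G i + 1 = R i) := by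
    intro σ' hR' i hi hGi
    simp only [carryTest, Test.Holds, NatExpr.eval, hi, hR'.len, hGi, ← hL]
    refine and_congr_right fun hlt => ?_
    rw [hR'.radix i (hL ▸ hlt), ← hRad]
    have := hd.1 i hlt
    omega
  refine Run.seqAgree (T₁ := L * (15 + carryTest.cost + 1) + carryTest.cost + 1)
    (Q' := fun σ' => ∃ i ≤ L, σ'.nats 35 0 = i ∧ (∀ l < i, G l + 1 = R l) ∧
      (∀ l < i, σ'.nats 9 l = 0) ∧ (∀ l, i ≤ l → σ'.nats 9 l = G l) ∧
      (i < L → G i + 1 < R i))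
    ((Run.loop (N := L) (B := 15) (Inv := fun i σ' => i ≤ L ∧ σ'.nats 35 0 = i ∧
      (∀ l < i, G l + 1 = R l) ∧ (∀ l < i, σ'.nats 9 l = 0) ∧ ∀ l, i ≤ l → σ'.nats 9 l = G l)
      ?_ ?_).agree.mono le_rfl ?_) ?_
  · refine ⟨Nat.zero_le _, h35, by simp, by simp, fun l _ => ?_⟩
    rw [ag₁.1 9 (by decide), hG]
  · rintro i σ' ag ⟨hi, h1, h2, h3, h4⟩ hb
    rw [htest σ' (hR₁.agree ag (by decide) (by decide)) i h1 (h4 i le_rfl)] at hb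
    refine ⟨hb.1, (run_of_loopFree rfl ?_).mono (by decide) fun _ h => h⟩
    have e9 : ((Program.seq (.setNat 9 (rd 35) (.const 0))
        (put 35 (.plus (rd 35) (.const 1)))).step σ').nats 9 =
        Function.update (σ'.nats 9) i 0 := by
      simp [Program.step, NatExpr.eval, h1]
    rw [e9]
    refine ⟨hb.1, by simp [Program.step, NatExpr.eval, h1], fun l hl => ?_, fun l hl => ?_,
      fun l hl => ?_⟩
    · rcases Nat.lt_succ_iff_lt_or_eq.1 hl with h | rfl
      · exact h2 l h
      · exact hb.2
    · rw [Function.update_apply]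
      split_ifs with h
      · rfl
      · exact h3 l (by omega)
    · rw [Function.update_of_ne (by omega)]
      exact h4 l (by omega)
  · rintro σ' ⟨ag, i, ⟨hi, h1, h2, h3, h4⟩, hb⟩
    rw [htest σ' (hR₁.agree ag (by decide) (by decide)) i h1 (h4 i le_rfl)] at hb
    refine ⟨i, hi, h1, h2, h3, h4, fun hlt => ?_⟩
    have := hd.1 i hlt
    have : ¬ G i + 1 = R i := fun h => hb ⟨hlt, h⟩
    omega
  · rintro σ₂ ag₂ ⟨i, hi, h1, h2, h3, h4, h5⟩
    have hR₂ := hR₁.agree ag₂ (by decide) (by decide)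
    have e11 : σ₂.nats 11 0 = 0 := by rw [ag₂.1 11 (by decide), ag₁.1 11 (by decide), h11]
    refine (run_of_loopFree rfl ?_).mono (by decide) fun _ h => h
    rcases hi.lt_or_eq with hlt | rfl
    · left
      have e : ∀ l, ((Program.branch (.natLt (rd 35) (rd 8))
          (.setNat 9 (rd 35) (.plus (.read 9 (rd 35)) (.const 1))) (put 11 (.const 1))).step
          σ₂).nats 9 l = if l = i then G i + 1 else σ₂.nats 9 l := by
        intro l
        simp [Program.step, Test.Holds, NatExpr.eval, h1, hR₂.len, ← hL, hlt, h4 i le_rfl,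
          Function.update_apply]
      refine ⟨?_, ⟨fun l hl => ?_, fun l hl => ?_⟩, ?_⟩
      · simp [Program.step, Test.Holds, NatExpr.eval, h1, hR₂.len, ← hL, hlt, e11]
      · rw [e]
        split_ifs with h
        · rw [h]; exact h5 hlt
        · have := hd.1 l hl
          rcases lt_or_ge l i with h' | h'
          · rw [h3 l h']; omega
          · rw [h4 l h']; exact this
      · rw [e, if_neg (by omega), h4 l (by omega), hd.2 l hl]
      · refine digitValue_increment hlt h2 (fun l hl => ?_) ?_ fun l hl => ?_
        · rw [e, if_neg (by omega), h3 l hl]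
        · rw [e, if_pos rfl]
        · rw [e, if_neg (by omega), h4 l (by omega)]
    · right
      refine ⟨?_, digitValue_of_max h2⟩
      simp [Program.step, Test.Holds, NatExpr.eval, h1, hR₂.len, ← hL]

/-- Compute the quantities that do not depend on the guess. -/
def setupProgram : Program :=
  .seq (.seq (put 3 (.plus (.read 0 (.const 1)) (.read 0 (.const 1))))
    (.seq (put 5 (.minus (rd 3) (.const 1))) (put 4 (.const 1))))
  (.seq (forLoop 36 (.read 0 (.const 1)) (.seq
    (.setReal 2 (.plus (.read 0 (.const 1)) (rd 36)) (.minus (.const 0) (.read 2 (rd 36))))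
    (.setReal 3 (.plus (.read 0 (.const 1)) (rd 36)) (.minus (.const 0) (.read 3 (rd 36))))))
  (.seq (forLoop 35 (rd 5) (forLoop 36 (rd 3) (put 4 (.plus (rd 4) (rd 4)))))
  (.seq (.seq (put 6 (.plus (rd 5) (rd 4)))
    (.seq (put 7 (.plus (.plus (rd 6) (rd 4)) (.const 1))) (put 8 (rd 7))))
  (.seq (forLoop 35 (.plus (rd 4) (.const 1)) (put 8 (.plus (rd 8) (.plus (rd 4) (.const 1)))))
  (.seq (forLoop 35 (rd 8) (.setNat 10 (rd 35) (rd 4)))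
  (.seq (forLoop 35 (rd 5) (.setNat 10 (rd 35) (rd 0)))
  (.setNat 10 (.const 0) (.const 1))))))))

/-- A bound for the number of steps of the preparation. -/
def setupTime (k : ℕ) : ℕ :=
  30 + (forTime k 30 2 + (forTime (offF k) (forTime (2 * k) 7 2) 2 + (30 +
    (forTime (sigCount k + 1) 9 4 + (forTime (guessLen k) 5 2 + (forTime (offF k) 5 2 + 3))))))

theorem run_setup (I : Instance) :
    Run setupProgram I.input (setupTime I.k) (fun σ' => Ready I σ') := by
  have hk := I.k_pos
  refine Run.seqAgree (T₁ := 30) (Q' := fun σ' => σ'.nats 3 0 = 2 * I.k ∧ σ'.nats 5 0 = offF I.k ∧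
    σ'.nats 4 0 = 1) ((run_of_loopFree rfl ?_).mono (by decide) fun _ h => h) ?_
  · simp [Program.step, NatExpr.eval, Instance.input, offF]
    omega
  rintro σ₁ ag₁ ⟨a3, a5, a4⟩
  have in0 : I.input.nats 0 0 = I.n := rfl
  have in1 : I.input.nats 0 1 = I.k := rfl
  refine Run.seqAgree (Q' := fun σ' => (∀ j, σ'.reals 2 j = I.signedDir j 0) ∧
      ∀ j, σ'.reals 3 j = I.signedDir j 1)
    (Run.forLoop (N := I.k) (B := 30) (Inv := fun i σ' =>
      (∀ j, σ'.reals 2 j = if j < I.k + i then I.signedDir j 0 else 0) ∧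
      (∀ j, σ'.reals 3 j = if j < I.k + i then I.signedDir j 1 else 0))
      (by decide) ?_ ?_ ?_ ?_ ?_) ?_
  · intro σ' ag
    simp only [NatExpr.eval]
    rw [ag.1 0 (by decide), ag₁.1 0 (by decide), in1]
  · intro i σ' v h
    simpa using h
  · rw [ag₁.2 2 (by decide), ag₁.2 3 (by decide)]
    constructor <;> intro j <;> by_cases hj : j < I.k <;>
      simp [Instance.input, Instance.signedDir, hj]
  · rintro i σ' hi ag h36 ⟨h1, h2⟩
    refine (run_of_loopFree rfl ?_).mono (by decide) fun _ h => h
    have e : σ'.nats 0 1 = I.k := by rw [ag.1 0 (by decide), ag₁.1 0 (by decide), in1]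
    have hs : I.signedDir (I.k + i) = - I.signedDir i := by
      simp [Instance.signedDir, hi]
    simp only [Program.step, NatExpr.eval, RealExpr.eval, h36, storeReal_reals, storeReal_nats, e]
    simp only [Nat.reduceEqDiff, if_true, if_false]
    constructor <;> intro j <;> rw [Function.update_apply] <;> split_ifs with h3 h4 h4
    · rw [h3, hs, h1 i, if_pos (by omega)]; simp
    · omega
    · rw [h1 j, if_pos (by omega)]
    · rw [h1 j, if_neg (by omega)]
    · rw [h3, hs, h2 i, if_pos (by omega)]; simp
    · omega
    · rw [h2 j, if_pos (by omega)]
    · rw [h2 j, if_neg (by omega)]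
  · rintro σ' _ ⟨h1, h2⟩
    have h0 : ∀ j, ¬ j < I.k + I.k → I.signedDir j = 0 := by
      intro j hj
      have c1 : ¬ j < I.k := by omega
      have c2 : ¬ j - I.k < I.k := by omega
      simp [Instance.signedDir, c1, c2]
    constructor <;> intro j
    · rw [h1 j]
      split_ifs with h
      · rfl
      · simp [h0 j h]
    · rw [h2 j]
      split_ifs with h
      · rfl
      · simp [h0 j h]
  rintro σ₂ ag₂ ⟨d2, d3⟩
  have b3 : σ₂.nats 3 0 = 2 * I.k := by rw [ag₂.1 3 (by decide), a3]
  have b4 : σ₂.nats 4 0 = 1 := by rw [ag₂.1 4 (by decide), a4]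
  have b5 : σ₂.nats 5 0 = offF I.k := by rw [ag₂.1 5 (by decide), a5]
  refine Run.seqAgree (Q' := fun σ' => σ'.nats 4 0 = sigCount I.k)
    (Run.forLoop (N := offF I.k) (Inv := fun i σ' => σ'.nats 4 0 = 2 ^ (i * (2 * I.k)))
      (by decide) ?_ ?_ (by simpa using b4) ?_ (fun _ _ h => h)) ?_
  · intro σ' ag
    simp only [NatExpr.eval]
    rw [ag.1 5 (by decide), b5]
  · intro i σ' v h
    simpa using h
  · rintro i σ' hi ag h35 h
    refine Run.forLoop (N := 2 * I.k) (B := 7) (Inv := fun j σ' =>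
      σ'.nats 4 0 = 2 ^ (i * (2 * I.k) + j)) (by decide) ?_ ?_ (by simpa using h) ?_ ?_
    · intro σ'' ag'
      simp only [NatExpr.eval]
      rw [ag'.1 3 (by decide), ag.1 3 (by decide), b3]
    · intro i σ' v h
      simpa using h
    · intro j σ'' hj ag' _ h'
      refine (run_of_loopFree rfl ?_).mono (by decide) fun _ h => h
      simp [Program.step, NatExpr.eval, h']
      ring
    · intro σ'' _ h'
      rw [h', Nat.add_mul i 1, one_mul]
  intro σ₃ ag₃ c4
  have c5 : σ₃.nats 5 0 = offF I.k := by rw [ag₃.1 5 (by decide), b5]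
  refine Run.seqAgree (T₁ := 30) (Q' := fun σ' => σ'.nats 6 0 = offA I.k ∧
    σ'.nats 7 0 = offC I.k ∧ σ'.nats 8 0 = offC I.k)
    ((run_of_loopFree rfl ?_).mono (by decide) fun _ h => h) ?_
  · simp [Program.step, NatExpr.eval, c4, c5, offC, offA]
  rintro σ₄ ag₄ ⟨d6, d7, d8⟩
  have d4 : σ₄.nats 4 0 = sigCount I.k := by rw [ag₄.1 4 (by decide), c4]
  refine Run.seqAgree (Q' := fun σ' => σ'.nats 8 0 = guessLen I.k)
    (Run.forLoop (N := sigCount I.k + 1) (B := 9) (Inv := fun i σ' =>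
      σ'.nats 8 0 = offC I.k + i * (sigCount I.k + 1)) (by decide) ?_ ?_ (by simpa using d8) ?_
      (fun _ _ h => h)) ?_
  · intro σ' ag
    simp only [NatExpr.eval]
    rw [ag.1 4 (by decide), d4]
  · intro i σ' v h
    simpa using h
  · intro i σ' hi ag _ h
    refine (run_of_loopFree rfl ?_).mono (by decide) fun _ h => h
    have e : σ'.nats 4 0 = sigCount I.k := by rw [ag.1 4 (by decide), d4]
    simp [Program.step, NatExpr.eval, h, e]
    ring
  intro σ₅ ag₅ e8
  have e4 : σ₅.nats 4 0 = sigCount I.k := by rw [ag₅.1 4 (by decide), d4]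
  have e5 : σ₅.nats 5 0 = offF I.k := by rw [ag₅.1 5 (by decide), ag₄.1 5 (by decide), c5]
  have e0 : σ₅.nats 0 0 = I.n := by
    rw [ag₅.1 0 (by decide), ag₄.1 0 (by decide), ag₃.1 0 (by decide), ag₂.1 0 (by decide),
      ag₁.1 0 (by decide), in0]
  refine Run.seqAgree (Q' := fun σ' => ∀ l < guessLen I.k, σ'.nats 10 l = sigCount I.k)
    (Run.forLoop (N := guessLen I.k) (B := 5) (Inv := fun i σ' =>
      ∀ l < i, σ'.nats 10 l = sigCount I.k) (by decide) ?_ ?_ (by simp) ?_ (fun _ _ h => h)) ?_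
  · intro σ' ag
    simp only [NatExpr.eval]
    rw [ag.1 8 (by decide), e8]
  · intro i σ' v h
    simpa using h
  · intro i σ' hi ag h35 h
    refine (run_of_loopFree rfl ?_).mono (by decide) fun _ h => h
    have e : σ'.nats 4 0 = sigCount I.k := by rw [ag.1 4 (by decide), e4]
    intro l hl
    simp only [Program.step, NatExpr.eval, h35, e, storeNat_nats, if_true, Function.update_apply]
    split_ifs with hli
    · rfl
    · exact h l (by omega)
  intro σ₆ ag₆ f10
  refine Run.seqAgree (Q' := fun σ' => ∀ l < guessLen I.k, σ'.nats 10 l =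
      if l < offF I.k then I.n else sigCount I.k)
    (Run.forLoop (N := offF I.k) (B := 5) (Inv := fun i σ' => ∀ l < guessLen I.k, σ'.nats 10 l =
      if l < i then I.n else sigCount I.k) (by decide) ?_ ?_ (by simpa using f10) ?_
      (fun _ _ h => h)) ?_
  · intro σ' ag
    simp only [NatExpr.eval]
    rw [ag.1 5 (by decide), ag₆.1 5 (by decide), e5]
  · intro i σ' v h
    simpa using h
  · intro i σ' hi ag h35 h
    refine (run_of_loopFree rfl ?_).mono (by decide) fun _ h => h
    have e : σ'.nats 0 0 = I.n := by rw [ag.1 0 (by decide), ag₆.1 0 (by decide), e0]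
    intro l hl
    simp only [Program.step, NatExpr.eval, h35, e, storeNat_nats, if_true, Function.update_apply]
    split_ifs with hli h' h'
    · rfl
    · omega
    · rw [h l hl, if_pos (by omega)]
    · rw [h l hl, if_neg (by omega)]
  intro σ₇ ag₇ g10
  refine run_of_loopFree (c := .setNat 10 (.const 0) (.const 1)) rfl ?_
  have ag : Agree [3, 5, 4, 6, 7, 8, 10, 35, 36] [2, 3] I.input
      ((Program.setNat 10 (.const 0) (.const 1)).step σ₇) :=
    (ag₁.mono (by decide) (by decide)).trans <| (ag₂.mono (by decide) (by decide)).trans <|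
    (ag₃.mono (by decide) (by decide)).trans <| (ag₄.mono (by decide) (by decide)).trans <|
    (ag₅.mono (by decide) (by decide)).trans <| (ag₆.mono (by decide) (by decide)).trans <|
    (ag₇.mono (by decide) (by decide)).trans <|
      (agree_step rfl σ₇).mono (by decide) (by decide)
  have hstep : ∀ b, b ≠ 10 → ((Program.setNat 10 (.const 0) (.const 1)).step σ₇).nats b =
      σ₇.nats b := fun b hb => (agree_step rfl σ₇).1 b (by simpa [Program.natWrites] using hb)
  constructor
  · rw [ag.1 0 (by decide), in0]
  · rw [hstep 3 (by decide), ag₇.1 3 (by decide), ag₆.1 3 (by decide), ag₅.1 3 (by decide),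
      ag₄.1 3 (by decide), ag₃.1 3 (by decide), b3]
  · rw [hstep 4 (by decide), ag₇.1 4 (by decide), ag₆.1 4 (by decide), e4]
  · rw [hstep 5 (by decide), ag₇.1 5 (by decide), ag₆.1 5 (by decide), e5]
  · rw [hstep 6 (by decide), ag₇.1 6 (by decide), ag₆.1 6 (by decide), ag₅.1 6 (by decide), d6]
  · rw [hstep 7 (by decide), ag₇.1 7 (by decide), ag₆.1 7 (by decide), ag₅.1 7 (by decide), d7]
  · rw [hstep 8 (by decide), ag₇.1 8 (by decide), ag₆.1 8 (by decide), e8]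
  · intro l hl
    have : ((Program.setNat 10 (.const 0) (.const 1)).step σ₇).nats 10 l =
        if l = 0 then 1 else σ₇.nats 10 l := by
      simp [Program.step, NatExpr.eval, Function.update_apply]
    rw [this, g10 l hl, radix]
  · rw [ag.2 0 (by decide)]
    rfl
  · rw [ag.2 1 (by decide)]
    rfl
  · funext j
    rw [← d2 j]
    change σ₇.reals 2 j = _
    rw [ag₇.2 2 (by decide), ag₆.2 2 (by decide), ag₅.2 2 (by decide), ag₄.2 2 (by decide),
      ag₃.2 2 (by decide)]
  · funext j
    rw [← d3 j]
    change σ₇.reals 3 j = _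
    rw [ag₇.2 3 (by decide), ag₆.2 3 (by decide), ag₅.2 3 (by decide), ag₄.2 3 (by decide),
      ag₃.2 3 (by decide)]

end MMST

/-! ### Exhaustive search -/

namespace MMST

open RealRAM

variable {I : Instance} {σ : State}

/-- Treat all guesses one after the other. -/
def mainProgram : Program :=
  .seq setupProgram (.loop (.natEq (rd 11) (.const 0)) (.seq guessProgram odometer))

/-- The guesses, encoded as digit strings. -/
abbrev IsGuess (I : Instance) (g : ℕ → ℕ) : Prop := IsDigits (radix I.n I.k) (guessLen I.k) g

/-- The position of a guess in the enumeration of all guesses. -/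
abbrev guessIndex (I : Instance) (g : ℕ → ℕ) : ℕ := digitValue (radix I.n I.k) g (guessLen I.k)

/-- The number of guesses. -/
abbrev guessCount (n k : ℕ) : ℕ := weight (radix n k) (guessLen k)

/-- If a tree is recorded, then it is the tree of a guess that passes the test. -/
def RecordSound (I : Instance) (σ : State) : Prop :=
  σ.nats 17 0 = 1 → ∃ g par, IsGuess I g ∧ I.GuessLayout g par ∧ I.GuessPasses g par ∧
    Recorded I σ par

/-- The recorded tree is at least as short as those of the first `t` guesses. -/
def RecordOptimal (I : Instance) (t : ℕ) (σ : State) : Prop :=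
  ∀ g, IsGuess I g → guessIndex I g < t → ∃ par, I.GuessLayout g par ∧
    (I.GuessPasses g par → σ.nats 17 0 = 1 ∧ σ.reals 6 0 ≤ I.treeLength par)

theorem record_step {σ' : State} {g par : ℕ → ℕ} {t : ℕ} (hg : IsGuess I g)
    (ht : guessIndex I g = t) (hlay : I.GuessLayout g par) (hs : RecordSound I σ)
    (ho : RecordOptimal I t σ)
    (h : (I.GuessPasses g par ∧ ¬ (σ.nats 17 0 = 1 ∧ σ.reals 6 0 ≤ I.treeLength par)) ∧
        Recorded I σ' par ∨
      ¬ (I.GuessPasses g par ∧ ¬ (σ.nats 17 0 = 1 ∧ σ.reals 6 0 ≤ I.treeLength par)) ∧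
        σ'.nats 17 = σ.nats 17 ∧ σ'.reals 6 = σ.reals 6 ∧
        ∀ par', Recorded I σ par' → Recorded I σ' par') :
    RecordSound I σ' ∧ RecordOptimal I (t + 1) σ' := by
  rcases h with ⟨⟨hp, hc⟩, hrec⟩ | ⟨hc, h17, h6, hkeep⟩
  · refine ⟨fun _ => ⟨g, par, hg, hlay, hp, hrec⟩, fun g' hg' ht' => ?_⟩
    rcases Nat.lt_succ_iff_lt_or_eq.1 ht' with hlt | heq
    · obtain ⟨par', hlay', hopt⟩ := ho g' hg' hlt
      refine ⟨par', hlay', fun hp' => ⟨hrec.1, ?_⟩⟩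
      obtain ⟨h1, h2⟩ := hopt hp'
      have h3 : I.treeLength par < σ.reals 6 0 := by
        by_contra h4
        exact hc ⟨h1, not_lt.1 h4⟩
      rw [hrec.2.1]
      linarith
    · have : g' = g := hg'.ext hg (heq.trans ht.symm)
      subst this
      exact ⟨par, hlay, fun _ => ⟨hrec.1, hrec.2.1.le⟩⟩
  · refine ⟨fun h => ?_, fun g' hg' ht' => ?_⟩
    · rw [h17] at h
      obtain ⟨g₀, par₀, h1, h2, h3, h4⟩ := hs h
      exact ⟨g₀, par₀, h1, h2, h3, hkeep _ h4⟩
    · rw [h17, h6]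
      rcases Nat.lt_succ_iff_lt_or_eq.1 ht' with hlt | heq
      · exact ho g' hg' hlt
      · have : g' = g := hg'.ext hg (heq.trans ht.symm)
        subst this
        refine ⟨par, hlay, fun hp => ?_⟩
        by_contra h
        exact hc ⟨hp, h⟩

/-- A bound for the number of steps of the program. -/
def mainTime (n k : ℕ) : ℕ :=
  setupTime k + (guessCount n k * (guessTime n k + odometerTime k + 4 + 1) + 4 + 1)

theorem run_main (I : Instance) : Run mainProgram I.input (mainTime I.n I.k) (fun σ' =>
    RecordSound I σ' ∧ RecordOptimal I (guessCount I.n I.k) σ') := by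
  have hk := I.k_pos
  have hn := I.n_pos
  refine Run.seqAgree (run_setup I) ?_
  intro σ₁ ag₁ hR₁
  have e9 : σ₁.nats 9 = fun _ => 0 := by rw [ag₁.1 9 (by decide)]; rfl
  have e11 : σ₁.nats 11 0 = 0 := by rw [ag₁.1 11 (by decide)]; rfl
  have e17 : σ₁.nats 17 0 = 0 := by rw [ag₁.1 17 (by decide)]; rfl
  have hradix : ∀ i, 0 < radix I.n I.k i := by
    intro i
    unfold radix
    split_ifs
    · exact one_pos
    · exact hn
    · exact sigCount_pos _
  refine (Run.loop (b := .natEq (rd 11) (.const 0)) (N := guessCount I.n I.k)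
    (B := guessTime I.n I.k + odometerTime I.k)
    (Inv := fun t σ' => RecordSound I σ' ∧ RecordOptimal I t σ' ∧
      ((σ'.nats 11 0 = 0 ∧ IsGuess I (σ'.nats 9) ∧ guessIndex I (σ'.nats 9) = t) ∨
        (σ'.nats 11 0 = 1 ∧ t = guessCount I.n I.k))) ?_ ?_).mono le_rfl ?_
  · refine ⟨fun h => by omega, fun g _ h => by omega, Or.inl ⟨e11, ?_, ?_⟩⟩
    · rw [e9]
      exact ⟨fun i _ => hradix i, fun _ _ => rfl⟩
    · rw [e9]
      exact digitValue_of_zero fun _ _ => rfl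
  · rintro t σ₂ ag₂ ⟨hs, ho, h⟩ hb
    have h11 : σ₂.nats 11 0 = 0 := by simpa [Test.Holds, NatExpr.eval] using hb
    obtain ⟨_, hg, ht⟩ := h.resolve_right fun h' => by omega
    refine ⟨ht ▸ digitValue_lt hg.1, ?_⟩
    have hR₂ := hR₁.agree ag₂ (by decide) (by decide)
    refine Run.seqAgree (run_guess hR₂ rfl hg.1) ?_
    rintro σ₃ ag₃ ⟨par, hlay, hpost⟩
    have hR₃ := hR₂.agree ag₃ (by decide) (by decide)
    obtain ⟨hs', ho'⟩ := record_step (σ' := σ₃) hg ht hlay hs ho (by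
      split_ifs at hpost with hc
      · exact Or.inl ⟨hc, hpost⟩
      · exact Or.inr ⟨hc, hpost⟩)
    have k9 : σ₃.nats 9 = σ₂.nats 9 := ag₃.1 9 (by decide)
    refine (run_odometer hR₃ k9 (by rw [ag₃.1 11 (by decide), h11]) hg).agree.mono le_rfl ?_
    rintro σ₄ ⟨ag₄, hpost'⟩
    have r17 : σ₄.nats 17 = σ₃.nats 17 := ag₄.1 17 (by decide)
    have r6 : σ₄.reals 6 = σ₃.reals 6 := ag₄.2 6 (by decide)
    refine ⟨fun h => ?_, ?_, ?_⟩
    · rw [r17] at h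
      obtain ⟨g₀, par₀, h1, h2, h3, h4⟩ := hs' h
      exact ⟨g₀, par₀, h1, h2, h3,
        h4.congr r17 (ag₄.1 1 (by decide)) (ag₄.1 2 (by decide)) r6⟩
    · unfold RecordOptimal
      rw [r17, r6]
      exact ho'
    · rcases hpost' with ⟨h1, h2, h3⟩ | ⟨h1, h2⟩
      · exact Or.inl ⟨h1, h2, h3.trans (congrArg (· + 1) ht)⟩
      · exact Or.inr ⟨h1, (congrArg (· + 1) ht).symm.trans h2⟩
  · rintro σ' ⟨t, ⟨hs, ho, h⟩, hb⟩
    have h11 : σ'.nats 11 0 ≠ 0 := by simpa [Test.Holds, NatExpr.eval] using hb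
    obtain ⟨_, rfl⟩ := h.resolve_left fun h' => h11 h'.1
    exact ⟨hs, ho⟩

theorem isSolution_of_record (hs : RecordSound I σ)
    (ho : RecordOptimal I (guessCount I.n I.k) σ) : I.IsSolution σ := by
  have key : ∀ T, IsMonotoneSpanningTree I.directions I.pt T →
      σ.nats 17 0 = 1 ∧ σ.reals 6 0 ≤ length I.pt T := by
    intro T hT
    obtain ⟨g, hg, hg0, h⟩ := Instance.exists_guess hT
    obtain ⟨par, hlay, hopt⟩ := ho g ⟨hg, hg0⟩ (digitValue_lt hg)
    obtain ⟨hp, rfl⟩ := h par hlay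
    rw [Instance.length_graph (fun v hv hv0 => hlay.par_lt hg hv hv0) (hlay.rooted hg)]
    exact hopt hp
  obtain ⟨T₀, hT₀⟩ := Instance.exists_monotone I
  obtain ⟨g, par, hg, hlay, hp, -, h6, h1, h2⟩ := hs (key T₀ hT₀).1
  have hlt : ∀ v < I.n, v ≠ 0 → par v < I.n := fun v hv hv0 => hlay.par_lt hg.1 hv hv0
  unfold Instance.IsSolution
  rw [Instance.outputGraph_eq hlt h1 h2]
  refine ⟨hlay.isMonotoneSpanningTree hg.1 hp, fun T' hT' => ?_⟩
  rw [Instance.length_graph hlt (hlay.rooted hg.1), ← h6]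
  exact (key T' hT').2

/-! ### The running time -/

theorem weight_radix_special {n k i : ℕ} (hi : i < offF k) :
    weight (radix n k) (i + 1) = n ^ i := by
  induction i with
  | zero => simp [weight, radix]
  | succ i ih =>
    rw [weight, ih (by omega), radix, if_neg (by omega), if_pos hi, pow_succ]

theorem guessCount_eq {n k : ℕ} (hk : 0 < k) :
    guessCount n k = n ^ (2 * k - 2) * sigCount k ^ (guessLen k - offF k) := by
  have h : ∀ m, weight (radix n k) (offF k + m) = n ^ (2 * k - 2) * sigCount k ^ m := by
    intro m
    induction m with
    | zero =>
      have h1 : offF k = 2 * k - 2 + 1 := by unfold offF; omega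
      rw [add_zero, h1, weight_radix_special (by omega)]
      simp
    | succ m ih =>
      rw [← add_assoc, weight, ih, Instance.radix_of_ge hk (by omega), pow_succ, mul_assoc]
  have h2 : guessLen k = offF k + (guessLen k - offF k) := by
    unfold guessLen offC offA
    omega
  conv_lhs => rw [guessCount, h2]
  exact h _

/-- `T` grows at most like `n * log n`, with its value at `1` as the constant factor. -/
def QuasiLinear (T : ℕ → ℕ) : Prop := ∀ n, 0 < n → T n ≤ n * (Nat.log 2 n + 1) * T 1

theorem one_le_bound {n : ℕ} (hn : 0 < n) : 1 ≤ n * (Nat.log 2 n + 1) :=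
  Nat.mul_pos hn (Nat.succ_pos _)

theorem QuasiLinear.const (c : ℕ) : QuasiLinear fun _ => c := fun _ hn =>
  Nat.le_mul_of_pos_left _ (one_le_bound hn)

theorem QuasiLinear.add {T T' : ℕ → ℕ} (h : QuasiLinear T) (h' : QuasiLinear T') :
    QuasiLinear fun n => T n + T' n := fun n hn => by
  rw [mul_add]
  exact Nat.add_le_add (h n hn) (h' n hn)

theorem QuasiLinear.const_mul {T : ℕ → ℕ} (c : ℕ) (h : QuasiLinear T) :
    QuasiLinear fun n => c * T n := fun n hn => by
  have := Nat.mul_le_mul_left c (h n hn)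
  dsimp only
  rwa [mul_left_comm] at this

theorem forTime_le (n B e : ℕ) (hn : 0 < n) : forTime n B e ≤ n * forTime 1 B e := by
  unfold forTime
  nlinarith

theorem QuasiLinear.of_le {T : ℕ → ℕ} (h : ∀ n, 0 < n → T n ≤ n * T 1) : QuasiLinear T :=
  fun n hn => (h n hn).trans (Nat.mul_le_mul_right _ (Nat.le_mul_of_pos_right _ (Nat.succ_pos _)))

theorem QuasiLinear.forTime (B e : ℕ) : QuasiLinear fun n => forTime n B e :=
  .of_le fun n hn => forTime_le n B e hn

theorem QuasiLinear.forTime_const {B : ℕ → ℕ} (N e : ℕ) (h : QuasiLinear B) :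
    QuasiLinear fun n => RealRAM.forTime N (B n) e := by
  unfold RealRAM.forTime
  exact (const 3).add (((const_mul N (((h.add (const _)).add (const _)).add (const 1))).add
    (const _)).add (const 1))

theorem quasiLinear_sortTime : QuasiLinear sortTime := by
  have h : ∀ n, 0 < n → mergePassTime n + 7 + 5 + 1 ≤ n * (mergePassTime 1 + 7 + 5 + 1) := by
    intro n hn
    have h1 := forTime_le n (blockStart.cost + mergeOne.cost) 2 hn
    have h2 := forTime_le n 6 2 hn
    unfold mergePassTime
    nlinarith
  have h' : QuasiLinear fun n => (Nat.log 2 n + 1) * (mergePassTime n + 7 + 5 + 1) := by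
    intro n hn
    have := Nat.mul_le_mul_left (Nat.log 2 n + 1) (h n hn)
    simp only [Nat.log_one_right, zero_add, one_mul]
    calc _ ≤ _ := this
      _ = _ := by ring
  exact (QuasiLinear.forTime 5 2).add ((QuasiLinear.const 3).add
    ((h'.add (.const 5)).add (.const 1)))

theorem quasiLinear_guessTime (k : ℕ) : QuasiLinear fun n => guessTime n k := by
  have hcol : QuasiLinear fun n => colourTime n k := (QuasiLinear.forTime _ 2).add (.const 3)
  have hchain : QuasiLinear chainTime :=
    (QuasiLinear.const (3 + 5 + 4 + 8)).add ((QuasiLinear.forTime 18 2).add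
      (quasiLinear_sortTime.add ((QuasiLinear.const 14).add
        ((QuasiLinear.forTime _ 2).add (.const 5)))))
  have hlay : QuasiLinear fun n => layoutTime n k :=
    (QuasiLinear.const 3).add (hchain.forTime_const _ _)
  have hpair : QuasiLinear fun n => pairTime n k :=
    (QuasiLinear.const _).add ((QuasiLinear.forTime _ 2).add (.const 6))
  have hcheck : QuasiLinear fun n => checkTime n k :=
    (QuasiLinear.const (3 + 4)).add
      (((QuasiLinear.const _).add (hpair.forTime_const _ _)).forTime_const _ _)
  have hlen : QuasiLinear lengthTime := (QuasiLinear.const 3).add (.forTime 60 4)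
  have hrec : QuasiLinear recordTime :=
    (QuasiLinear.const 20).add ((QuasiLinear.const 10).add (.forTime 20 4))
  exact hcol.add (hlay.add (hcheck.add (hlen.add hrec)))

/-- The factor of the running time that depends only on the number of directions. -/
def timeFactor (k : ℕ) : ℕ :=
  setupTime k + (sigCount k ^ (guessLen k - offF k) * (guessTime 1 k + odometerTime k + 4 + 1) +
    4 + 1)

theorem mainTime_le {n k : ℕ} (hn : 0 < n) (hk : 0 < k) :
    mainTime n k ≤ timeFactor k * n ^ (2 * k - 1) * (Nat.log 2 n + 1) := by
  have h1 : QuasiLinear fun n => guessTime n k + odometerTime k + 4 + 1 :=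
    (((quasiLinear_guessTime k).add (.const _)).add (.const 4)).add (.const 1)
  have h2 := h1 n hn
  dsimp only at h2
  have hpow : 0 < n ^ (2 * k - 2) := Nat.pow_pos hn
  have h3 := one_le_bound hn
  have hexp : n ^ (2 * k - 1) = n ^ (2 * k - 2) * n := by
    rw [← pow_succ]
    congr 1
    omega
  rw [mainTime, guessCount_eq hk, hexp]
  rw [timeFactor]
  generalize guessTime 1 k + odometerTime k + 4 + 1 = a at *
  generalize guessTime n k + odometerTime k + 4 + 1 = b at *
  generalize sigCount k ^ (guessLen k - offF k) = q at *
  have hX : 1 ≤ n ^ (2 * k - 2) * n * (Nat.log 2 n + 1) := by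
    rw [mul_assoc]
    exact Nat.mul_pos hpow h3
  have h4 := Nat.mul_le_mul_left (n ^ (2 * k - 2) * q) h2
  have h5 := Nat.mul_le_mul_left (setupTime k + 5) hX
  calc setupTime k + (n ^ (2 * k - 2) * q * b + 4 + 1)
      ≤ (setupTime k + 5) * (n ^ (2 * k - 2) * n * (Nat.log 2 n + 1)) +
        n ^ (2 * k - 2) * q * (n * (Nat.log 2 n + 1) * a) := by omega
    _ = (setupTime k + (q * a + 4 + 1)) * (n ^ (2 * k - 2) * n) * (Nat.log 2 n + 1) := by ring

theorem log_le {n : ℕ} (hn : 2 ≤ n) : ((Nat.log 2 n + 1 : ℕ) : ℝ) ≤ 3 * Real.log n := by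
  have h1 : (Nat.log 2 n : ℝ) ≤ Real.logb 2 n := by
    exact_mod_cast Real.natLog_le_logb n 2
  have h2 : (1 : ℝ) ≤ Real.logb 2 n := by
    rw [Real.le_logb_iff_rpow_le (by norm_num) (by positivity)]
    simpa using (by exact_mod_cast hn : (2 : ℝ) ≤ n)
  have h3 : Real.logb 2 n = Real.log n / Real.log 2 := rfl
  have h4 := Real.log_two_gt_d9
  have h5 : Real.logb 2 n * Real.log 2 = Real.log n := by
    rw [h3, div_mul_cancel₀]
    positivity
  push_cast
  nlinarith

/-! ### The time bound is computable -/

theorem primrec_forTime {N B e : ℕ → ℕ} (hN : Primrec N) (hB : Primrec B) (he : Primrec e) :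
    Primrec fun k => forTime (N k) (B k) (e k) := by
  have hc : ∀ c : ℕ, Primrec fun _ : ℕ => c := fun c => Primrec.const c
  have ha : ∀ {u v : ℕ → ℕ}, Primrec u → Primrec v → Primrec fun k => u k + v k :=
    fun hu hv => Primrec.nat_add.comp hu hv
  have hm : ∀ {u v : ℕ → ℕ}, Primrec u → Primrec v → Primrec fun k => u k * v k :=
    fun hu hv => Primrec.nat_mul.comp hu hv
  unfold forTime
  exact ha (hc 3) (ha (ha (hm hN (ha (ha (ha hB (hc 6)) (ha he (hc 3))) (hc 1))) (ha he (hc 3)))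
    (hc 1))

theorem primrec_timeFactor : Primrec timeFactor := by
  have hc : ∀ c : ℕ, Primrec fun _ : ℕ => c := fun c => Primrec.const c
  have ha : ∀ {u v : ℕ → ℕ}, Primrec u → Primrec v → Primrec fun k => u k + v k :=
    fun hu hv => Primrec.nat_add.comp hu hv
  have hm : ∀ {u v : ℕ → ℕ}, Primrec u → Primrec v → Primrec fun k => u k * v k :=
    fun hu hv => Primrec.nat_mul.comp hu hv
  have hs : ∀ {u v : ℕ → ℕ}, Primrec u → Primrec v → Primrec fun k => u k - v k :=
    fun hu hv => Primrec.nat_sub.comp hu hv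
  have hp : ∀ {u v : ℕ → ℕ}, Primrec u → Primrec v → Primrec fun k => u k ^ v k :=
    fun hu hv => (Primrec₂.unpaired'.1 Nat.Primrec.pow).comp hu hv
  have hK : Primrec fun k => 2 * k := hm (hc 2) Primrec.id
  have hF : Primrec offF := hs hK (hc 1)
  have hQ : Primrec sigCount := hp (hc 2) (hm (hs hK (hc 1)) hK)
  have hA : Primrec offA := ha hF hQ
  have hC : Primrec offC := ha (ha hA hQ) (hc 1)
  have hL : Primrec guessLen := ha hC (hm (ha hQ (hc 1)) (ha hQ (hc 1)))
  have hQ1 : Primrec fun k => sigCount k + 1 := ha hQ (hc 1)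
  have hsig : Primrec sigTime :=
    ha (hc 3) (primrec_forTime hF (primrec_forTime hK (hc _) (hc 2)) (hc 2))
  have hcol : Primrec fun k => colourTime 1 k :=
    ha (primrec_forTime (hc 1) (ha hsig (hc 11)) (hc 2)) (hc 3)
  have hlay : Primrec fun k => layoutTime 1 k := ha (hc 3) (primrec_forTime hQ (hc _) (hc 2))
  have hmark : Primrec markTime :=
    ha (primrec_forTime hQ1 (hc 4) (hc 4)) (ha (hc 4) (primrec_forTime hQ1 (hc 18) (hc 4)))
  have hpair : Primrec fun k => pairTime 1 k := ha hmark (hc _)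
  have hcheck : Primrec fun k => checkTime 1 k :=
    ha (hc _) (primrec_forTime hQ1 (ha hmark (primrec_forTime hQ1 hpair (hc 4))) (hc 4))
  have hguess : Primrec fun k => guessTime 1 k := ha hcol (ha hlay (ha hcheck (hc _)))
  have hodo : Primrec odometerTime :=
    ha (hc 3) (ha (ha (ha (hm hL (hc _)) (hc 16)) (hc 1)) (hc 30))
  have hsetup : Primrec setupTime :=
    ha (hc 30) (ha (primrec_forTime Primrec.id (hc 30) (hc 2))
      (ha (primrec_forTime hF (primrec_forTime hK (hc 7) (hc 2)) (hc 2)) (ha (hc 30)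
        (ha (primrec_forTime hQ1 (hc 9) (hc 4)) (ha (primrec_forTime hL (hc 5) (hc 2))
          (ha (primrec_forTime hF (hc 5) (hc 2)) (hc 3)))))))
  exact ha hsetup (ha (ha (hm (hp hQ (hs hL hF)) (ha (ha (ha hguess hodo) (hc 4)) (hc 1))) (hc 4))
    (hc 1))

end MMST

theorem mainTheorem2 :
    (∃ (c : RealRAM.Program) (f : ℕ → ℕ), ∀ I : MMST.Instance,
      ∃ (t : ℕ) (σ : RealRAM.State), RealRAM.Exec c I.input t σ ∧ I.IsSolution σ ∧
        (2 ≤ I.n → (t : ℝ) ≤ (f I.k : ℝ) * (I.n : ℝ) ^ (2 * I.k - 1) * Real.log I.n)) ∧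
    RealRAM.InXP MMST.problem := by
  have key : ∀ I : MMST.Instance, ∃ (t : ℕ) (σ : RealRAM.State),
      RealRAM.Exec MMST.mainProgram I.input t σ ∧ I.IsSolution σ ∧
        t ≤ MMST.timeFactor I.k * I.n ^ (2 * I.k - 1) * (Nat.log 2 I.n + 1) := by
    intro I
    obtain ⟨t, σ, e, ht, hs, ho⟩ := MMST.run_main I
    exact ⟨t, σ, e, MMST.isSolution_of_record hs ho,
      ht.trans (MMST.mainTime_le I.n_pos I.k_pos)⟩
  refine ⟨⟨MMST.mainProgram, fun k => 3 * MMST.timeFactor k, fun I => ?_⟩,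
    MMST.mainProgram, MMST.timeFactor, fun k => 2 * k, MMST.primrec_timeFactor.to_comp,
    (Primrec.nat_mul.comp (Primrec.const 2) Primrec.id).to_comp, fun I => ?_⟩
  · obtain ⟨t, σ, e, hsol, ht⟩ := key I
    refine ⟨t, σ, e, hsol, fun hn => ?_⟩
    have h1 : (t : ℝ) ≤ (MMST.timeFactor I.k : ℝ) * (I.n : ℝ) ^ (2 * I.k - 1) *
        ((Nat.log 2 I.n + 1 : ℕ) : ℝ) := by exact_mod_cast ht
    refine h1.trans ((mul_le_mul_of_nonneg_left (MMST.log_le hn) (by positivity)).trans ?_)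
    push_cast
    linarith
  · obtain ⟨t, σ, e, hsol, ht⟩ := key I
    refine ⟨t, σ, e, hsol, ht.trans ?_⟩
    have hn := I.n_pos
    have hk := I.k_pos
    have hlog : Nat.log 2 I.n + 1 ≤ I.n := Nat.log_lt_self 2 hn.ne'
    change _ ≤ MMST.timeFactor I.k * (2 * I.n + 2 * I.k + 2) ^ (2 * I.k)
    rw [mul_assoc]
    refine Nat.mul_le_mul_left _ ?_
    calc I.n ^ (2 * I.k - 1) * (Nat.log 2 I.n + 1) ≤ I.n ^ (2 * I.k - 1) * I.n :=
          Nat.mul_le_mul_left _ hlog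
      _ = I.n ^ (2 * I.k) := by rw [← pow_succ]; congr 1; omega
      _ ≤ _ := Nat.pow_le_pow_left (by omega) _
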